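/- **Corollary (Generalized Cauchy distribution, case $n\ge 3$).** Let $n\ge 3$ and $\beta>n/2$. Let $\mu$ be the generalized Cauchy distribution of parameter $\beta$ on $\mathbb R^n$, i.e. the probability measure with Lebesgue density proportional to $(1+\|x\|^2)^{-\beta}$, and let $\nu$ be its radial part, the probability measure on $(0,+\infty)$ with density proportional to $r^{n-1}(1+r^2)^{-\beta}$. With the weight $\sigma^2(x)=1+\|x\|^2$, consider $$\mathcal L_\mu^\sigma h(x)=(1+\|x\|^2)\,\Delta h(x)+2(1-\beta)\,x\cdot\nabla h(x),\qquad x\in\mathbb R^n,$$ on $\mathcal C_0^\infty(\mathbb R^n)$ and $$\mathcal L_\nu^\sigma g(r)=(1+r^2)\,g''(r)+\Big((n+1-2\beta)\,r+\frac{n-1}{r}\Big)g'(r),\qquad r>0,$$ on the smooth compactly supported functions $g$ on $[0,+\infty)$ with Neumann's condition $g'(0)=0$. Denote by the same letters the self-adjoint operators they generate in $L^2(\mu)$ and $L^2(\nu)$, that is, the self-adjoint extension whose domain is included in the domain of the closed Dirichlet form (the closure of the form $f\mapsto\int f(-\mathcal L f)$ on the initial domain). The spectral gap $\lambda_1(-\mathcal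 L)$ is the largest real $\lambda$ such that the spectrum of $-\mathcal L$ lies in $\{0\}\cup[\lambda,+\infty)$. Then both spectral gaps exist and satisfy: * for $n/2<\beta\le n/2+2$, $$\lambda_1(-\mathcal L_\mu^\sigma)=\lambda_1(-\mathcal L_\nu^\sigma)=\Big(\beta-\frac n2\Big)^2;$$ * for $n/2+2<\beta\le \frac{n(n+2)}{n+1}$, $$\lambda_1(-\mathcal L_\mu^\sigma)=\lambda_1(-\mathcal L_\nu^\sigma)=4\Big(\beta-\frac n2-1\Big);$$ * for $\frac{n(n+2)}{n+1}<\beta\le n+1$, $$\frac{2\beta(n-1)}{n}\le\lambda_1(-\mathcal L_\mu^\sigma)\le\lambda_1(-\mathcal L_\nu^\sigma)=4\Big(\beta-\frac n2-1\Big);$$ * for $\beta>n+1$, $$\frac{2\beta(n-1)}{n}\le\lambda_1(-\mathcal L_\mu^\sigma)\le 2(\beta-1)<\lambda_1(-\mathcal L_\nu^\sigma)=4\Big(\beta-\frac n2-1\Big).$$ -/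

import Mathlib

open MeasureTheory Filter Topology Set
open scoped ContDiff InnerProductSpace ENNReal Laplacian

noncomputable section

namespace CauchyGap

/-! ### Unbounded operators on a real Hilbert space: self-adjoint realisation, spectrum, gap -/

section Abstract

variable {H : Type*} [NormedAddCommGroup H] [InnerProductSpace ℝ H] [CompleteSpace H]

/-- The domain of the closure of the quadratic form `u ↦ ⟪u, T u⟫`: limits in `H` of sequences
of the domain of `T` that are Cauchy for the form. -/
def formDomain (T : H →ₗ.[ℝ] H) : Set H :=
  {u | ∃ w : ℕ → T.domain,
    Tendsto (fun k => (w k : H)) atTop (𝓝 u) ∧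
    Tendsto (fun p : ℕ × ℕ => ⟪((w p.1 - w p.2 : T.domain) : H), T (w p.1 - w p.2)⟫_ℝ)
      atTop (𝓝 0)}

/-- `A` is the self-adjoint operator generated by the non-negative symmetric operator `T`:
a self-adjoint extension of `T` whose domain lies in the domain of the closed form of `T`.
(There is exactly one such extension, the Friedrichs extension; when `T` is essentially
self-adjoint it is the closure of `T`.) -/
structure IsSelfAdjointRealization (T A : H →ₗ.[ℝ] H) : Prop where
  extends_op : T ≤ A
  selfAdjoint : IsSelfAdjoint A
  domain_subset : (A.domain : Set H) ⊆ formDomain T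

/-- The (real) spectrum of an unbounded operator `A`: those `z` for which `A - z` is not a
bijection from the domain of `A` onto `H` with bounded inverse. -/
def opSpectrum (A : H →ₗ.[ℝ] H) : Set ℝ :=
  {z | ¬ (Function.Bijective (fun u : A.domain => A u - z • (u : H)) ∧
    ∃ C : ℝ, ∀ u : A.domain, ‖(u : H)‖ ≤ C * ‖A u - z • (u : H)‖)}

/-- `l` is the spectral gap of `A`: the largest real `l` such that the spectrum of `A` lies in
`{0} ∪ [l, ∞)`. -/
def IsSpectralGap (A : H →ₗ.[ℝ] H) (l : ℝ) : Prop :=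
  IsGreatest {l : ℝ | opSpectrum A ⊆ {0} ∪ Ici l} l

end Abstract

section Concrete

variable {α : Type*} [MeasurableSpace α]

/-- The graph in `L²(μ) × L²(μ)` of the operator `h ↦ -L h` with domain the (classes of) functions
of the space `C`. -/
def negGraph (μ : Measure α) (C : Submodule ℝ (α → ℝ)) (L : C →ₗ[ℝ] (α → ℝ)) :
    Submodule ℝ (Lp ℝ 2 μ × Lp ℝ 2 μ) where
  carrier := {p | ∃ h : C, p.1 =ᵐ[μ] (h : α → ℝ) ∧ p.2 =ᵐ[μ] -(L h)}
  zero_mem' := ⟨0, by simpa using Lp.coeFn_zero ℝ 2 μ, by simpa using Lp.coeFn_zero ℝ 2 μ⟩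
  add_mem' := by
    rintro p q ⟨h, hp1, hp2⟩ ⟨k, hq1, hq2⟩
    refine ⟨h + k, ?_, ?_⟩
    · exact (Lp.coeFn_add p.1 q.1).trans (hp1.add hq1)
    · rw [map_add, neg_add]
      exact (Lp.coeFn_add p.2 q.2).trans (hp2.add hq2)
  smul_mem' := by
    rintro c p ⟨h, hp1, hp2⟩
    refine ⟨c • h, ?_, ?_⟩
    · exact (Lp.coeFn_smul c p.1).trans (hp1.const_smul c)
    · rw [map_smul, ← smul_neg]
      exact (Lp.coeFn_smul c p.2).trans (hp2.const_smul c)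

/-- The operator `-L` on `L²(μ)`, initially defined on the functions of the space `C`. -/
def negOp (μ : Measure α) (C : Submodule ℝ (α → ℝ)) (L : C →ₗ[ℝ] (α → ℝ)) :
    Lp ℝ 2 μ →ₗ.[ℝ] Lp ℝ 2 μ :=
  (negGraph μ C L).toLinearPMap

theorem negOp_graph {μ : Measure α} {C : Submodule ℝ (α → ℝ)} {L : C →ₗ[ℝ] (α → ℝ)}
    (hL : ∀ h : C, (h : α → ℝ) =ᵐ[μ] 0 → L h =ᵐ[μ] 0) :
    (negOp μ C L).graph = negGraph μ C L := by
  refine Submodule.toLinearPMap_graph_eq _ ?_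
  rintro p ⟨h, h1, h2⟩ h0
  have hz : (h : α → ℝ) =ᵐ[μ] 0 := by
    rw [h0] at h1
    exact h1.symm.trans (Lp.coeFn_zero ℝ 2 μ)
  rw [Lp.eq_zero_iff_ae_eq_zero]
  refine h2.trans ?_
  filter_upwards [hL h hz] with x hx
  simp [hx]

end Concrete

/-! ### The generalized Cauchy distribution and its weighted dynamics -/

/-- The measure with density `(1 + ‖x‖²)^{-β}` on `ℝⁿ`. -/
def cauchyWeight (n : ℕ) (β : ℝ) : Measure (EuclideanSpace ℝ (Fin n)) :=
  volume.withDensity fun x => ENNReal.ofReal ((1 + ‖x‖ ^ 2) ^ (-β))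

/-- The generalized Cauchy distribution `μ` of parameter `β` on `ℝⁿ`. -/
def cauchyMeasure (n : ℕ) (β : ℝ) : Measure (EuclideanSpace ℝ (Fin n)) :=
  (cauchyWeight n β univ)⁻¹ • cauchyWeight n β

/-- The measure with density `r^{n-1} (1 + r²)^{-β}` on `(0, ∞)`. -/
def radialWeight (n : ℕ) (β : ℝ) : Measure ℝ :=
  (volume.restrict (Ioi 0)).withDensity fun r =>
    ENNReal.ofReal (r ^ (n - 1) * (1 + r ^ 2) ^ (-β))

/-- The radial part `ν` of the generalized Cauchy distribution. -/
def radialMeasure (n : ℕ) (β : ℝ) : Measure ℝ :=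
  (radialWeight n β univ)⁻¹ • radialWeight n β

/-- Smooth compactly supported functions on `ℝⁿ`. -/
def testSpace (n : ℕ) : Submodule ℝ (EuclideanSpace ℝ (Fin n) → ℝ) where
  carrier := {h | ContDiff ℝ ∞ h ∧ HasCompactSupport h}
  zero_mem' := ⟨contDiff_const, HasCompactSupport.zero⟩
  add_mem' h k := ⟨h.1.add k.1, h.2.add k.2⟩
  smul_mem' c _ h := ⟨contDiff_const.smul h.1, h.2.smul_left (f := fun _ => c)⟩

/-- Smooth compactly supported functions on `[0, ∞)` with Neumann's condition `g'(0) = 0`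
(represented by smooth compactly supported functions on `ℝ`, of which only the restriction to
`[0, ∞)` matters). -/
def neumannTestSpace : Submodule ℝ (ℝ → ℝ) where
  carrier := {g | ContDiff ℝ ∞ g ∧ HasCompactSupport g ∧ deriv g 0 = 0}
  zero_mem' := ⟨contDiff_const, HasCompactSupport.zero, by
    change deriv (fun _ : ℝ => (0 : ℝ)) 0 = 0; simp⟩
  add_mem' {g k} hg hk := ⟨hg.1.add hk.1, hg.2.1.add hk.2.1, by
    rw [deriv_add (hg.1.differentiable (by simp)).differentiableAt
      (hk.1.differentiable (by simp)).differentiableAt, hg.2.2, hk.2.2, add_zero]⟩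
  smul_mem' c g hg := ⟨contDiff_const.smul hg.1, hg.2.1.smul_left (f := fun _ => c), by
    rw [deriv_const_smul c (hg.1.differentiable (by simp)).differentiableAt, hg.2.2, smul_zero]⟩

theorem deriv2_add {g k : ℝ → ℝ} (hg : ContDiff ℝ ∞ g) (hk : ContDiff ℝ ∞ k) :
    deriv (g + k) = deriv g + deriv k ∧
      deriv (deriv (g + k)) = deriv (deriv g) + deriv (deriv k) := by
  have h1 : deriv (g + k) = deriv g + deriv k := funext fun r =>
    deriv_add (hg.differentiable (by simp)).differentiableAt
      (hk.differentiable (by simp)).differentiableAt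
  have hg' : ContDiff ℝ ∞ (deriv g) := (contDiff_infty_iff_deriv.1 hg).2
  have hk' : ContDiff ℝ ∞ (deriv k) := (contDiff_infty_iff_deriv.1 hk).2
  refine ⟨h1, ?_⟩
  rw [h1]
  exact funext fun r => deriv_add (hg'.differentiable (by simp)).differentiableAt
      (hk'.differentiable (by simp)).differentiableAt

theorem deriv2_smul (c : ℝ) {g : ℝ → ℝ} (hg : ContDiff ℝ ∞ g) :
    deriv (c • g) = c • deriv g ∧ deriv (deriv (c • g)) = c • deriv (deriv g) := by
  have h1 : deriv (c • g) = c • deriv g := funext fun r =>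
    deriv_const_smul c (hg.differentiable (by simp)).differentiableAt
  have hg' : ContDiff ℝ ∞ (deriv g) := (contDiff_infty_iff_deriv.1 hg).2
  refine ⟨h1, ?_⟩
  rw [h1]
  exact funext fun r => deriv_const_smul c (hg'.differentiable (by simp)).differentiableAt

/-- The weighted generator
`L h (x) = (1 + ‖x‖²) Δh(x) + 2 (1 - β) x · ∇h(x)` on smooth compactly supported functions. -/
def cauchyGenerator (n : ℕ) (β : ℝ) :
    testSpace n →ₗ[ℝ] (EuclideanSpace ℝ (Fin n) → ℝ) where
  toFun h x := (1 + ‖x‖ ^ 2) * (Δ (h : EuclideanSpace ℝ (Fin n) → ℝ)) x +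
    2 * (1 - β) * ⟪x, gradient (h : EuclideanSpace ℝ (Fin n) → ℝ) x⟫_ℝ
  map_add' h k := by
    funext x
    have h2 := (contDiff_infty.1 h.2.1 2).contDiffAt (x := x)
    have k2 := (contDiff_infty.1 k.2.1 2).contDiffAt (x := x)
    have hd := (h.2.1.differentiable (by simp)).differentiableAt (x := x)
    have kd := (k.2.1.differentiable (by simp)).differentiableAt (x := x)
    have e1 : gradient ((h : EuclideanSpace ℝ (Fin n) → ℝ) + (k : EuclideanSpace ℝ (Fin n) → ℝ)) x
        = gradient (h : EuclideanSpace ℝ (Fin n) → ℝ) x + gradient (k : EuclideanSpace ℝ (Fin n) → ℝ) x := by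
      simp [gradient, fderiv_add hd kd]
    simp only [Submodule.coe_add, Pi.add_apply, e1, h2.laplacian_add k2, inner_add_right]
    ring
  map_smul' c h := by
    funext x
    have h2 := (contDiff_infty.1 h.2.1 2).contDiffAt (x := x)
    have hd := (h.2.1.differentiable (by simp)).differentiableAt (x := x)
    have e1 : gradient (c • (h : EuclideanSpace ℝ (Fin n) → ℝ)) x
        = c • gradient (h : EuclideanSpace ℝ (Fin n) → ℝ) x := by
      simp [gradient, fderiv_const_smul hd]
    simp only [Submodule.coe_smul, e1, InnerProductSpace.laplacian_smul c h2, inner_smul_right,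
      Pi.smul_apply, smul_eq_mul, RingHom.id_apply]
    ring

/-- The weighted radial generator
`L g (r) = (1 + r²) g''(r) + ((n + 1 - 2 β) r + (n - 1) / r) g'(r)`, `r > 0`, on smooth compactly
supported functions on `[0, ∞)` satisfying Neumann's condition. -/
def radialGenerator (n : ℕ) (β : ℝ) : neumannTestSpace →ₗ[ℝ] (ℝ → ℝ) where
  toFun g r := (1 + r ^ 2) * deriv (deriv (g : ℝ → ℝ)) r +
    (((n : ℝ) + 1 - 2 * β) * r + ((n : ℝ) - 1) / r) * deriv (g : ℝ → ℝ) r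
  map_add' g k := by
    funext r
    obtain ⟨e1, e2⟩ := deriv2_add g.2.1 k.2.1
    rw [Submodule.coe_add, e2, e1]
    simp only [Pi.add_apply]
    ring
  map_smul' c g := by
    funext r
    obtain ⟨e1, e2⟩ := deriv2_smul c g.2.1
    rw [Submodule.coe_smul, e2, e1]
    simp only [Pi.smul_apply, smul_eq_mul, RingHom.id_apply]
    ring

/-- The operator `-L` on `L²(μ)` with domain the smooth compactly supported functions. -/
def cauchyOp (n : ℕ) (β : ℝ) :
    Lp ℝ 2 (cauchyMeasure n β) →ₗ.[ℝ] Lp ℝ 2 (cauchyMeasure n β) :=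
  negOp (cauchyMeasure n β) (testSpace n) (cauchyGenerator n β)

/-- The radial operator `-L` on `L²(ν)` with domain the smooth compactly supported functions on
`[0, ∞)` satisfying Neumann's condition. -/
def radialOp (n : ℕ) (β : ℝ) :
    Lp ℝ 2 (radialMeasure n β) →ₗ.[ℝ] Lp ℝ 2 (radialMeasure n β) :=
  negOp (radialMeasure n β) neumannTestSpace (radialGenerator n β)

/-! Both operators are well defined on `L²` classes. -/

theorem cauchyOp_graph (n : ℕ) (β : ℝ) :
    (cauchyOp n β).graph =
      negGraph (cauchyMeasure n β) (testSpace n) (cauchyGenerator n β) := by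
  refine negOp_graph fun h hh => ?_
  rcases eq_or_ne ((cauchyWeight n β univ)⁻¹) 0 with h0 | h0
  · simp [cauchyMeasure, h0, EventuallyEq]
  have hpos : ∀ x : EuclideanSpace ℝ (Fin n),
      ENNReal.ofReal ((1 + ‖x‖ ^ 2) ^ (-β)) ≠ 0 := fun x => by
    have : 0 < (1 + ‖x‖ ^ 2) ^ (-β) := by positivity
    simpa using this
  have hm : Measurable fun x : EuclideanSpace ℝ (Fin n) =>
      ENNReal.ofReal ((1 + ‖x‖ ^ 2) ^ (-β)) := by fun_prop
  have h1 : (h : EuclideanSpace ℝ (Fin n) → ℝ) =ᵐ[volume] 0 := by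
    have : ∀ᵐ x ∂(cauchyWeight n β), (h : EuclideanSpace ℝ (Fin n) → ℝ) x = 0 :=
      (Measure.ae_ennreal_smul_measure_iff h0).1 hh
    rw [cauchyWeight, ae_withDensity_iff hm] at this
    filter_upwards [this] with x hx using hx (hpos x)
  have h2 : (h : EuclideanSpace ℝ (Fin n) → ℝ) = 0 :=
    (h.2.1.continuous.ae_eq_iff_eq volume continuous_zero).1 h1
  have h3 : h = 0 := Subtype.ext h2
  rw [h3, map_zero]

theorem radialOp_graph (n : ℕ) (β : ℝ) :
    (radialOp n β).graph =
      negGraph (radialMeasure n β) neumannTestSpace (radialGenerator n β) := by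
  refine negOp_graph fun g hg => ?_
  rcases eq_or_ne ((radialWeight n β univ)⁻¹) 0 with h0 | h0
  · simp [radialMeasure, h0, EventuallyEq]
  have hm : Measurable fun r : ℝ => ENNReal.ofReal (r ^ (n - 1) * (1 + r ^ 2) ^ (-β)) := by
    fun_prop
  have h1 : (g : ℝ → ℝ) =ᵐ[volume.restrict (Ioi 0)] 0 := by
    have : ∀ᵐ r ∂(radialWeight n β), (g : ℝ → ℝ) r = 0 :=
      (Measure.ae_ennreal_smul_measure_iff h0).1 hg
    rw [radialWeight, ae_withDensity_iff hm] at this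
    filter_upwards [this, ae_restrict_mem measurableSet_Ioi] with r hr hr0
    have hr0 : 0 < r := hr0
    refine hr ?_
    have : 0 < r ^ (n - 1) * (1 + r ^ 2) ^ (-β) := by positivity
    simpa using this
  have h2 : EqOn (g : ℝ → ℝ) 0 (Ioi 0) :=
    Measure.eqOn_open_of_ae_eq h1 isOpen_Ioi g.2.1.continuous.continuousOn
      continuous_zero.continuousOn
  have h3 : ∀ r ∈ Ioi (0 : ℝ), radialGenerator n β g r = 0 := by
    intro r hr
    have e0 : (g : ℝ → ℝ) =ᶠ[𝓝 r] fun _ => 0 := h2.eventuallyEq_of_mem (Ioi_mem_nhds hr)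
    have e1 : deriv (g : ℝ → ℝ) =ᶠ[𝓝 r] fun _ => 0 := by simpa using e0.deriv
    have e2 : deriv (deriv (g : ℝ → ℝ)) r = 0 := by simpa using e1.deriv_eq
    change (1 + r ^ 2) * deriv (deriv (g : ℝ → ℝ)) r + _ * deriv (g : ℝ → ℝ) r = 0
    rw [e2, e1.self_of_nhds]
    simp
  have h4 : ∀ᵐ r ∂(radialWeight n β), radialGenerator n β g r = 0 := by
    rw [radialWeight, ae_withDensity_iff hm]
    filter_upwards [ae_restrict_mem measurableSet_Ioi] with r hr _ using h3 r hr
  exact (Measure.ae_ennreal_smul_measure_iff h0).2 h4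

end CauchyGap

end

noncomputable section

namespace CauchyGap

/-! ### Friedrichs extension and spectral gap -/

section Friedrichs

/-! Put t = β − n/2. Both gaps are computed exactly: the radial gap is t² for t ≤ 2 and 4(t − 1) for
t > 2, and the gap of the full operator is the minimum of the radial gap and 2(β − 1). The four
cases of the theorem are comparisons of these numbers, the change of minimum taking place at β = n +
1.

A Poincaré inequality with constant l passes from test functions to the Friedrichs extension, whose
resolvent at −1 comes from completing the domain for the form norm. Since constants lie in the
kernel, it confines the spectrum to {0} ∪ [l, ∞). Conversely l belongs to the spectrum once
approximate eigenvectors exist, and these may be taken in the closure of the graph on test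
functions. Thus each gap needs a sharp inequality and a family of near-optimizers.

Radial inequality (`radial_poincare`). For centred f with primitive u = ∫₀ʳ f ρ, the difference of
the energy and l times the variance is an exact derivative plus a sum of squares, as soon as a
Riccati inequality holds for a weight W. Taking W from the flux of (1 + r²)^a gives l = 4a(t − a)
for 0 ≤ a ≤ min(1, t); optimizing in a yields t² or 4(t − 1).

Inequality orthogonally to radial functions (`sector_poincare`). Lift the problem to pairs (x, y)
with weight (1 + |x|² + |y|²)^{−β−n/2}, whose marginal is (1 + |x|²)^{−β} up to a constant.
Rotations mixing x and y preserve this weight, and a quarter turn replaces x by y. On the circle, a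
quarter-turn increment satisfies ∫(φ(s + π/2) − φ(s))² ≤ 2∫φ'², because |iᵏ − 1|² ≤ 2k². Averaging
over orbits bounds ∬(H(y) − H(x))² by 2∬⟨∇H(x), y⟩²; the cross term disappears by orthogonality and
the moments of the weight give the constant 2(β − 1). Frequency one saturates the circle inequality,
which corresponds to linear functions.

Subtracting the spherical mean splits a test function into these two sectors, orthogonally both in
L² and for the energy (`cauchy_poincare`).

Sharpness. The generator sends (1 + r²)^a to −4a(t − a)(1 + r²)^a plus a multiple of (1 + r²)^{a−1}.
For t > 2, a = 1 and a constant correction give an eigenfunction with eigenvalue 4(t − 1); for t ≤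
2, letting a increase to t/2 makes the L² norm blow up and gives approximate eigenvectors at t².
Linear functions are eigenfunctions with eigenvalue 2(β − 1). Truncation and dominated convergence
put all of them in the closure of the graph. -/

theorem mem_opSpectrum_of_approx {H : Type*} [NormedAddCommGroup H] [InnerProductSpace ℝ H]
    {A : H →ₗ.[ℝ] H} {z : ℝ}
    (h : ∀ ε > 0, ∃ u w : H, (u, w) ∈ A.graph ∧ ‖w - z • u‖ < ε * ‖u‖) :
    z ∈ opSpectrum A := by
  rintro ⟨-, C, hC⟩
  obtain ⟨u, w, hg, hlt⟩ := h (|C| + 1)⁻¹ (by positivity)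
  obtain ⟨u', hu1, hu2⟩ := (LinearPMap.mem_graph_iff A).1 hg
  simp only at hu1 hu2
  have h1 := hC u'
  rw [hu1, hu2] at h1
  have h2 : ‖u‖ ≤ (|C| + 1) * ‖w - z • u‖ :=
    h1.trans (mul_le_mul_of_nonneg_right (by linarith [le_abs_self C]) (norm_nonneg _))
  rw [inv_mul_eq_div, lt_div_iff₀ (by positivity)] at hlt
  linarith

variable {H : Type*} [NormedAddCommGroup H] [InnerProductSpace ℝ H] [CompleteSpace H]

/-- The resolvent at `-1` of the Friedrichs extension of a non-negative symmetric operator. -/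
theorem exists_friedrichs_resolvent {D : Type*} [AddCommGroup D] [Module ℝ D] (ι T : D →ₗ[ℝ] H)
    (hι : Function.Injective ι) (hs : ∀ u v, ⟪T u, ι v⟫_ℝ = ⟪ι u, T v⟫_ℝ)
    (hp : ∀ u, 0 ≤ ⟪ι u, T u⟫_ℝ) :
    ∃ R : H →L[ℝ] H, (∀ f g, ⟪R f, g⟫_ℝ = ⟪f, R g⟫_ℝ) ∧ (∀ u, R (ι u + T u) = ι u) ∧
      ∀ f, ∃ w : ℕ → D, Tendsto (fun k => ι (w k)) atTop (𝓝 (R f)) ∧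
        Tendsto (fun p : ℕ × ℕ => ⟪ι (w p.1 - w p.2), T (w p.1 - w p.2)⟫_ℝ) atTop (𝓝 0) ∧
        Tendsto (fun k => ⟪ι (w k), T (w k)⟫_ℝ) atTop (𝓝 ⟪R f, f - R f⟫_ℝ) := by
  -- The form norm (‖u‖² + ⟪u, Tu⟫)^{1/2}. With V the completion of D for it and J : V → H the
  -- extension of ι, the resolvent will be J J*.
  let core : InnerProductSpace.Core ℝ D :=
    { inner := fun u v => ⟪ι u, ι v⟫_ℝ + ⟪ι u, T v⟫_ℝ
      conj_inner_symm := fun u v => by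
        simp only [conj_trivial]
        rw [real_inner_comm, ← hs u v, real_inner_comm (ι v) (T u)]
      re_inner_nonneg := fun u => by
        have := hp u
        have h2 : 0 ≤ ⟪ι u, ι u⟫_ℝ := real_inner_self_nonneg
        simpa using add_nonneg h2 this
      add_left := fun u v w => by simp only [map_add, inner_add_left]; ring
      smul_left := fun u v r => by
        simp only [map_smul, inner_smul_left, conj_trivial]; ring
      definite := fun u hu => by
        have := hp u
        have h2 : 0 ≤ ⟪ι u, ι u⟫_ℝ := real_inner_self_nonneg
        have h3 : ⟪ι u, ι u⟫_ℝ = 0 := by linarith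
        exact hι (by rw [inner_self_eq_zero.1 h3, map_zero]) }
  let _ : NormedAddCommGroup D := core.toNormedAddCommGroup
  let _ : InnerProductSpace ℝ D := InnerProductSpace.ofCore core.toCore
  have hin : ∀ u v : D, ⟪u, v⟫_ℝ = ⟪ι u, ι v⟫_ℝ + ⟪ι u, T v⟫_ℝ := fun u v => rfl
  have hnorm : ∀ u : D, ‖u‖ ^ 2 = ‖ι u‖ ^ 2 + ⟪ι u, T u⟫_ℝ := fun u => by
    rw [← real_inner_self_eq_norm_sq, ← real_inner_self_eq_norm_sq, hin]
  have hle : ∀ u : D, ‖ι u‖ ≤ 1 * ‖u‖ := fun u => by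
    rw [one_mul]
    refine (pow_le_pow_iff_left₀ (norm_nonneg _) (norm_nonneg _) two_ne_zero).1 ?_
    rw [hnorm]; linarith [hp u]
  let ιc : D →L[ℝ] H := ι.mkContinuous 1 hle
  let V := UniformSpace.Completion D
  let e : D →L[ℝ] V := UniformSpace.Completion.toComplL
  have hde : DenseRange e := UniformSpace.Completion.denseRange_coe
  have hue : IsUniformInducing e := UniformSpace.Completion.isUniformInducing_coe D
  let J : V →L[ℝ] H := ιc.extend e
  have hJ : ∀ u : D, J (e u) = ι u := fun u => ContinuousLinearMap.extend_eq _ hde hue u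
  have hee : ∀ u v : D, ⟪e u, e v⟫_ℝ = ⟪u, v⟫_ℝ := fun u v => UniformSpace.Completion.inner_coe u v
  have hen : ∀ u : D, ‖e u‖ = ‖u‖ := fun u => UniformSpace.Completion.norm_coe u
  let Js := ContinuousLinearMap.adjoint J
  -- Both sides have the same pairing with every `e v`, and these are dense in V; applying J gives R
  -- (ι u + T u) = ι u.
  have hJs : ∀ u : D, Js (ι u + T u) = e u := fun u => by
    refine Dense.eq_of_inner_left (𝕜 := ℝ) (S := (LinearMap.range e.toLinearMap : Set _)) ?_ ?_
    · rw [LinearMap.coe_range]; exact hde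
    rintro _ ⟨v, rfl⟩
    change ⟪Js (ι u + T u), e v⟫_ℝ = ⟪e u, e v⟫_ℝ
    rw [ContinuousLinearMap.adjoint_inner_left, hJ, hee, hin, inner_add_left, hs]
  refine ⟨J ∘L Js, fun f g => ?_, fun u => ?_, fun f => ?_⟩
  · simp only [ContinuousLinearMap.comp_apply]
    rw [← ContinuousLinearMap.adjoint_inner_right, ContinuousLinearMap.adjoint_inner_left]
  · simp only [ContinuousLinearMap.comp_apply, hJs, hJ]
  · obtain ⟨w, hw⟩ : ∃ w : ℕ → D, Tendsto (fun k => e (w k)) atTop (𝓝 (Js f)) := by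
      obtain ⟨x, hx, hx'⟩ := mem_closure_iff_seq_limit.1 (hde.closure_range.symm ▸ mem_univ (Js f))
      choose w hw using hx
      exact ⟨w, by simpa only [hw] using hx'⟩
    have h1 : Tendsto (fun k => ι (w k)) atTop (𝓝 (J (Js f))) := by
      simpa only [Function.comp_def, hJ] using (J.continuous.tendsto _).comp hw
    have hform : ∀ u : D, ⟪ι u, T u⟫_ℝ = ‖e u‖ ^ 2 - ‖ι u‖ ^ 2 := fun u => by
      rw [hen, hnorm]; ring
    refine ⟨w, h1, ?_, ?_⟩
    · have hp1 : Tendsto (fun p : ℕ × ℕ => p.1) atTop atTop := prod_atTop_atTop_eq (α := ℕ) (β := ℕ) ▸ tendsto_fst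
      have hp2 : Tendsto (fun p : ℕ × ℕ => p.2) atTop atTop := prod_atTop_atTop_eq (α := ℕ) (β := ℕ) ▸ tendsto_snd
      have h2 := ((hw.comp hp1).sub (hw.comp hp2)).norm.pow 2
      have h3 := ((h1.comp hp1).sub (h1.comp hp2)).norm.pow 2
      have h4 := h2.sub h3
      simp only [sub_self, norm_zero] at h4
      norm_num at h4
      refine h4.congr fun p => ?_
      rw [hform]
      simp [map_sub]
    -- The limit ‖J* f‖² − ‖R f‖² is ⟪R f, f − R f⟫, that is ⟪u, A u⟫ for A = R⁻¹ − 1 and u = R f.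
    -- This is what transports a Poincaré inequality from T to A.
    · have h2 := (hw.norm.pow 2).sub (h1.norm.pow 2)
      have h3 : ‖Js f‖ ^ 2 - ‖J (Js f)‖ ^ 2 = ⟪J (Js f), f - J (Js f)⟫_ℝ := by
        rw [inner_sub_right, real_inner_self_eq_norm_sq, ← real_inner_self_eq_norm_sq (Js f),
          ContinuousLinearMap.adjoint_inner_right]
      rw [h3] at h2
      exact h2.congr fun k => (hform _).symm

/-- A densely defined non-negative symmetric operator has a self-adjoint realization, which
inherits the Poincaré inequality. -/
theorem exists_isSelfAdjointRealization (T : H →ₗ.[ℝ] H) (hd : Dense (T.domain : Set H))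
    (hs : ∀ u v : T.domain, ⟪T u, (v : H)⟫_ℝ = ⟪(u : H), T v⟫_ℝ)
    (hp : ∀ u : T.domain, 0 ≤ ⟪(u : H), T u⟫_ℝ) (e : H) (l : ℝ)
    (hl : ∀ u : T.domain, l * (‖(u : H)‖ ^ 2 - ⟪(u : H), e⟫_ℝ ^ 2) ≤ ⟪(u : H), T u⟫_ℝ) :
    ∃ A : H →ₗ.[ℝ] H, IsSelfAdjointRealization T A ∧
      ∀ u : A.domain, l * (‖(u : H)‖ ^ 2 - ⟪(u : H), e⟫_ℝ ^ 2) ≤ ⟪(u : H), A u⟫_ℝ := by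
  obtain ⟨R, hR, hRT, hRw⟩ := exists_friedrichs_resolvent T.domain.subtype T.toFun
    Subtype.val_injective hs hp
  have hinj : ∀ f, R f = 0 → f = 0 := fun f hf => by
    refine hd.eq_zero_of_inner_left ℝ fun u hu => ?_
    have := hRT ⟨u, hu⟩
    simp only [Submodule.subtype_apply] at this
    rw [← this, ← hR, hf, inner_zero_left]
  -- A = R⁻¹ − 1 is defined by its graph, the pairs (R f, f − R f).
  let G : Submodule ℝ (H × H) :=
    LinearMap.range ((R : H →ₗ[ℝ] H).prod (LinearMap.id - (R : H →ₗ[ℝ] H)))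
  have hG : ∀ p : H × H, p ∈ G ↔ p.1 = R (p.1 + p.2) := by
    rintro ⟨y, z⟩
    constructor
    · rintro ⟨f, hf⟩
      simp only [LinearMap.prod_apply, Function.prod, Prod.mk.injEq, LinearMap.sub_apply,
        LinearMap.id_apply, ContinuousLinearMap.coe_coe] at hf
      obtain ⟨rfl, rfl⟩ := hf
      simp
    · intro h
      refine ⟨y + z, ?_⟩
      simp only [LinearMap.prod_apply, Function.prod, Prod.mk.injEq, LinearMap.sub_apply,
        LinearMap.id_apply, ContinuousLinearMap.coe_coe]
      simp only at h
      rw [← h]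
      simp
  let A := G.toLinearPMap
  have hA : A.graph = G := Submodule.toLinearPMap_graph_eq _ fun p hp hp0 => by
    rw [hG, hp0, zero_add] at hp
    exact hinj _ hp.symm
  have hTA : T ≤ A := by
    refine LinearPMap.le_of_le_graph ?_
    rintro ⟨y, z⟩ hyz
    rw [hA, hG]
    obtain ⟨u, rfl, rfl⟩ := (LinearPMap.mem_graph_iff T).1 hyz
    exact (hRT u).symm
  have hAd : Dense (A.domain : Set H) := hd.mono hTA.1
  have hmem : ∀ u : A.domain, (u : H) = R (u + A u) := fun u => by
    have := A.mem_graph u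
    rwa [hA, hG] at this
  refine ⟨A, ⟨hTA, ?_, ?_⟩, ?_⟩
  · rw [LinearPMap.isSelfAdjoint_def]
    refine LinearPMap.eq_of_eq_graph ?_
    rw [LinearPMap.adjoint_graph_eq_graph_adjoint hAd, hA]
    ext ⟨y, z⟩
    rw [Submodule.mem_adjoint_iff, hG]
    constructor
    · intro h
      have h2 : y - R (y + z) = 0 := by
        rw [← inner_self_eq_zero (𝕜 := ℝ)]
        set f := y - R (y + z)
        -- Testing the adjoint relation on the pair built from the defect f = y − R (y + z) itself
        -- gives ⟪f, f⟫ = 0.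
        have := h (R f) (f - R f) (by rw [hG]; simp)
        simp only [inner_sub_left] at this
        rw [hR, hR] at this
        have h3 : ⟪f, y - R (y + z)⟫_ℝ = 0 := by
          rw [map_add, inner_sub_right, inner_add_right]; linarith
        exact h3
      exact sub_eq_zero.1 h2
    · intro h a b hab
      rw [hG] at hab
      simp only at h hab
      have h1 : ⟪a, y + z⟫_ℝ = ⟪a + b, y⟫_ℝ := by
        conv_lhs => rw [hab]
        rw [hR, ← h]
      rw [inner_add_left, inner_add_right] at h1
      simp only
      linarith
  · intro u hu
    obtain ⟨w, hw1, hw2, -⟩ := hRw (u + A ⟨u, hu⟩)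
    rw [← hmem ⟨u, hu⟩] at hw1
    exact ⟨w, hw1, hw2⟩
  · intro u
    obtain ⟨w, hw1, -, hw3⟩ := hRw (u + A u)
    rw [← hmem u] at hw1 hw3
    rw [add_sub_cancel_left] at hw3
    refine le_of_tendsto_of_tendsto' (Tendsto.const_mul l
      ((hw1.norm.pow 2).sub ((hw1.inner (tendsto_const_nhds (x := e))).pow 2))) hw3 fun k => hl (w k)

/-- A Poincaré inequality relative to a unit vector of the kernel is a spectral gap. -/
theorem opSpectrum_subset {A : H →ₗ.[ℝ] H} (hA : IsSelfAdjoint A) {e : H} (he : ‖e‖ = 1)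
    (he0 : (e, (0 : H)) ∈ A.graph) {l : ℝ}
    (hl : ∀ u : A.domain, l * (‖(u : H)‖ ^ 2 - ⟪(u : H), e⟫_ℝ ^ 2) ≤ ⟪(u : H), A u⟫_ℝ) :
    opSpectrum A ⊆ {0} ∪ Ici l := by
  intro z hz
  by_contra hcon
  simp only [mem_union, mem_singleton_iff, mem_Ici, not_or, not_le] at hcon
  obtain ⟨hz0, hzl⟩ := hcon
  refine hz ?_
  have hd := hA.dense_domain
  have hsym : ∀ u v : A.domain, ⟪A u, (v : H)⟫_ℝ = ⟪(u : H), A v⟫_ℝ := by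
    have := LinearPMap.adjoint_isFormalAdjoint hd
    rw [LinearPMap.isSelfAdjoint_def.1 hA] at this
    exact this
  obtain ⟨e', he1, he2⟩ := (LinearPMap.mem_graph_iff A).1 he0
  simp only at he1 he2
  -- Write u = p + m e with p orthogonal to e. A − z acts as −z on e, and on the orthogonal part the
  -- Poincaré inequality bounds it below by l − z; the two images being orthogonal, c is a lower
  -- bound for A − z.
  set c := min |z| (l - z) with hc
  have hcpos : 0 < c := lt_min (abs_pos.2 hz0) (by linarith)
  have hkey : ∀ u : A.domain, c * ‖(u : H)‖ ≤ ‖A u - z • (u : H)‖ := by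
    intro u
    set m := ⟪(u : H), e⟫_ℝ with hm
    have hAe : ⟪A u, e⟫_ℝ = 0 := by rw [← he1, hsym, he2, inner_zero_right]
    have hee : ⟪e, e⟫_ℝ = 1 := by rw [real_inner_self_eq_norm_sq, he]; norm_num
    set p : H := u - m • e with hpdef
    have hpe : ⟪p, e⟫_ℝ = 0 := by rw [hpdef, inner_sub_left, inner_smul_left, hee]; simp [hm]
    have hu : (u : H) = p + m • e := by rw [hpdef]; abel
    have hnu : ‖(u : H)‖ ^ 2 = ‖p‖ ^ 2 + m ^ 2 := by
      rw [← real_inner_self_eq_norm_sq, ← real_inner_self_eq_norm_sq, hu]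
      simp only [inner_add_left, inner_add_right, inner_smul_left, inner_smul_right, hpe, hee,
        real_inner_comm p e, conj_trivial]
      ring
    have hpA : ⟪p, A u⟫_ℝ = ⟪(u : H), A u⟫_ℝ := by
      rw [hpdef, inner_sub_left, inner_smul_left, real_inner_comm, real_inner_comm (A u) e, hAe,
        real_inner_comm]
      simp
    set y : H := A u - z • p with hy
    have hye : ⟪y, e⟫_ℝ = 0 := by rw [hy, inner_sub_left, inner_smul_left, hAe, hpe]; simp
    have hdec : A u - z • (u : H) = y - (z * m) • e := by
      rw [hy, hpdef, smul_sub, smul_smul]; abel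
    have hnd : ‖A u - z • (u : H)‖ ^ 2 = ‖y‖ ^ 2 + (z * m) ^ 2 := by
      rw [hdec, ← real_inner_self_eq_norm_sq, ← real_inner_self_eq_norm_sq]
      simp only [inner_sub_left, inner_sub_right, inner_smul_left, inner_smul_right, hye, hee,
        real_inner_comm y e, conj_trivial]
      ring
    have hpy : (l - z) * ‖p‖ ^ 2 ≤ ‖p‖ * ‖y‖ := by
      refine le_trans ?_ (real_inner_le_norm p y)
      rw [hy, inner_sub_right, inner_smul_right, real_inner_self_eq_norm_sq, hpA]
      have := hl u
      rw [hnu, ← hm] at this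
      linarith
    have hpy' : c * ‖p‖ ≤ ‖y‖ := by
      rcases (norm_nonneg p).eq_or_lt with h0 | h0
      · rw [← h0]; simp
      · refine le_trans (mul_le_mul_of_nonneg_right (min_le_right _ _) h0.le) ?_
        refine le_of_mul_le_mul_left ?_ h0
        linarith
    have hcz : c ^ 2 ≤ z ^ 2 := by
      rw [← sq_abs z]
      exact pow_le_pow_left₀ hcpos.le (min_le_left _ _) 2
    refine (pow_le_pow_iff_left₀ (by positivity) (norm_nonneg _) two_ne_zero).1 ?_
    rw [hnd, mul_pow, hnu]
    have h1 : (c * ‖p‖) ^ 2 ≤ ‖y‖ ^ 2 := pow_le_pow_left₀ (by positivity) hpy' 2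
    nlinarith [mul_le_mul_of_nonneg_right hcz (sq_nonneg m)]
  have hinjz : ∀ u : A.domain, A u - z • (u : H) = 0 → u = 0 := fun u hu => by
    have := hkey u
    rw [hu, norm_zero] at this
    have h2 : ‖(u : H)‖ = 0 := le_antisymm (nonpos_of_mul_nonpos_right this hcpos) (norm_nonneg _)
    exact Subtype.ext (norm_eq_zero.1 h2)
  refine ⟨⟨fun u v huv => ?_, fun y => ?_⟩, c⁻¹, fun u => ?_⟩
  · have : A (u - v) - z • ((u - v : A.domain) : H) = 0 := by
      simp only at huv
      rw [LinearPMap.map_sub, Submodule.coe_sub, smul_sub, sub_sub_sub_comm, huv, sub_self]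
    exact sub_eq_zero.1 (hinjz _ this)
  · let Φ : A.domain →ₗ[ℝ] H := A.toFun - z • A.domain.subtype
    have hΦ : ∀ u, Φ u = A u - z • (u : H) := fun u => rfl
    let S : Submodule ℝ H := LinearMap.range Φ
    have hclosed : IsClosed (S : Set H) := by
      refine IsSeqClosed.isClosed fun x b hx hb => ?_
      choose w hw using hx
      have hcau : CauchySeq (fun k => ((w k : A.domain) : H)) := by
        have hcx := hb.cauchySeq
        rw [Metric.cauchySeq_iff] at hcx ⊢
        intro ε hε
        obtain ⟨N, hN⟩ := hcx (c * ε) (by positivity)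
        refine ⟨N, fun p hp q hq => ?_⟩
        have h1 := hN p hp q hq
        have h2 := hkey (w p - w q)
        rw [← hΦ, map_sub, hw, hw, ← dist_eq_norm] at h2
        rw [dist_eq_norm, ← Submodule.coe_sub]
        exact lt_of_mul_lt_mul_left (lt_of_le_of_lt h2 h1) hcpos.le
      obtain ⟨u, hu⟩ := cauchySeq_tendsto_of_complete hcau
      have hAw : Tendsto (fun k => A (w k)) atTop (𝓝 (b + z • u)) := by
        have : Tendsto (fun k => x k + z • ((w k : A.domain) : H)) atTop (𝓝 (b + z • u)) :=
          hb.add (hu.const_smul z)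
        refine this.congr fun k => ?_
        rw [← hw k, hΦ]; abel
      have hg : (u, b + z • u) ∈ A.graph := by
        refine hA.isClosed.mem_of_tendsto (hu.prodMk_nhds hAw) (Eventually.of_forall fun k => ?_)
        exact A.mem_graph (w k)
      obtain ⟨u', hu1, hu2⟩ := (LinearPMap.mem_graph_iff A).1 hg
      refine ⟨u', ?_⟩
      simp only at hu1 hu2
      rw [hΦ, hu1, hu2]; abel
    -- The range is closed. A vector orthogonal to it lies in the domain of the adjoint, which is A,
    -- and is annihilated by A − z, hence is zero by injectivity.
    have htop : S = ⊤ := by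
      have : CompleteSpace S := hclosed.completeSpace_coe
      rw [← Submodule.orthogonal_eq_bot_iff, Submodule.eq_bot_iff]
      intro y hy
      have hy' : ∀ u : A.domain, ⟪z • y, (u : H)⟫_ℝ = ⟪y, A u⟫_ℝ := fun u => by
        have := (Submodule.mem_orthogonal' S y).1 hy (Φ u) ⟨u, rfl⟩
        rw [hΦ, inner_sub_right, inner_smul_right] at this
        rw [inner_smul_left]
        simp only [conj_trivial]
        linarith
      have hdom : y ∈ A.adjoint.domain := LinearPMap.mem_adjoint_domain_of_exists _ ⟨z • y, hy'⟩
      have hval := LinearPMap.adjoint_apply_eq hd ⟨y, hdom⟩ hy'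
      have hgr : (y, z • y) ∈ A.graph := by
        have h1 : (y, z • y) ∈ A.adjoint.graph :=
          (LinearPMap.mem_graph_iff _).2 ⟨⟨y, hdom⟩, rfl, hval⟩
        rwa [LinearPMap.isSelfAdjoint_def.1 hA] at h1
      obtain ⟨u, hu1, hu2⟩ := (LinearPMap.mem_graph_iff A).1 hgr
      simp only at hu1 hu2
      have := hinjz u (by rw [hu2, hu1, sub_self])
      rw [← hu1, this]; rfl
    obtain ⟨u, hu⟩ : y ∈ S := htop ▸ Submodule.mem_top
    exact ⟨u, hu⟩
  · rw [inv_mul_eq_div, le_div_iff₀ hcpos, mul_comm]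
    exact hkey u

/-- A positive point of the spectrum up to which a Poincaré inequality holds is the gap. -/
theorem isSpectralGap_of_poincare {A : H →ₗ.[ℝ] H} (hA : IsSelfAdjoint A) {e : H} (he : ‖e‖ = 1)
    (he0 : (e, (0 : H)) ∈ A.graph) {l : ℝ} (hl0 : 0 < l)
    (hl : ∀ u : A.domain, l * (‖(u : H)‖ ^ 2 - ⟪(u : H), e⟫_ℝ ^ 2) ≤ ⟪(u : H), A u⟫_ℝ)
    (hs : ∀ ε > 0, ∃ u w : H, (u, w) ∈ A.graph ∧ ‖w - l • u‖ < ε * ‖u‖) :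
    IsSpectralGap A l := by
  refine ⟨opSpectrum_subset hA he he0 hl, fun m hm => ?_⟩
  rcases hm (mem_opSpectrum_of_approx hs) with h | h
  · exact absurd h hl0.ne'
  · exact h

/-- Self-adjoint operators are closed. This gives access to powers and linear functions as vectors
of the domain, though they are only limits of test functions. -/
theorem mem_graph_of_mem_closure {T A : H →ₗ.[ℝ] H} (hTA : T ≤ A) (hA : IsSelfAdjoint A)
    {p : H × H} (hp : p ∈ closure (T.graph : Set (H × H))) : p ∈ A.graph :=
  hA.isClosed.closure_subset_iff.2 (LinearPMap.le_graph_of_le hTA) hp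

end Friedrichs

/-! ### The Poincaré inequality for the radial part -/

section RadialPoincare

/-- The density of the radial weight. -/
def radialDensity (n : ℕ) (β : ℝ) (r : ℝ) : ℝ := r ^ (n - 1) * (1 + r ^ 2) ^ (-β)

theorem continuous_radialDensity (n : ℕ) (β : ℝ) : Continuous (radialDensity n β) := by
  unfold radialDensity
  refine (continuous_pow _).mul ?_
  exact (by fun_prop : Continuous fun r : ℝ => 1 + r ^ 2).rpow_const fun r => Or.inl (by positivity)

theorem radialDensity_pos {n : ℕ} {β r : ℝ} (hr : 0 < r) : 0 < radialDensity n β r := by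
  unfold radialDensity; positivity

theorem radialDensity_le_pow {n : ℕ} {β r : ℝ} (hr : 0 ≤ r) (hβ : 0 ≤ β) :
    radialDensity n β r ≤ r ^ (n - 1) := by
  unfold radialDensity
  refine mul_le_of_le_one_right (by positivity) ?_
  exact Real.rpow_le_one_of_one_le_of_nonpos (by nlinarith) (by linarith)

theorem radialDensity_le_rpow {n : ℕ} (hn : 1 ≤ n) {β r : ℝ} (hr : 0 < r) (hβ : 0 ≤ β) :
    radialDensity n β r ≤ r ^ ((n : ℝ) - 1 - 2 * β) := by
  unfold radialDensity
  have h1 : (1 + r ^ 2) ^ (-β) ≤ (r ^ 2) ^ (-β) :=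
    Real.rpow_le_rpow_of_nonpos (by positivity) (by linarith) (by linarith)
  have h2 : r ^ (n - 1) = r ^ ((n : ℝ) - 1) := by
    rw [← Real.rpow_natCast, Nat.cast_sub hn]; simp
  have h3 : (r ^ 2) ^ (-β) = r ^ (-(2 * β)) := by
    rw [← Real.rpow_natCast, ← Real.rpow_mul hr.le]; norm_num
  calc r ^ (n - 1) * (1 + r ^ 2) ^ (-β) ≤ r ^ (n - 1) * (r ^ 2) ^ (-β) := by gcongr
    _ = _ := by rw [h2, h3, ← Real.rpow_add hr]; congr 1

theorem integrableOn_radialDensity {n : ℕ} (hn : 1 ≤ n) {β : ℝ} (hβ : (n : ℝ) / 2 < β) :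
    IntegrableOn (radialDensity n β) (Ioi 0) := by
  have hβ0 : 0 ≤ β := by have : (0 : ℝ) ≤ (n : ℝ) / 2 := by positivity
                         linarith
  have h1 : IntegrableOn (radialDensity n β) (Ioc 0 1) :=
    ((continuous_radialDensity n β).integrableOn_Icc (a := 0) (b := 1)).mono_set Ioc_subset_Icc_self
  have h2 : IntegrableOn (radialDensity n β) (Ioi 1) := by
    refine Integrable.mono' (integrableOn_Ioi_rpow_of_lt (a := (n : ℝ) - 1 - 2 * β) (by linarith)
      zero_lt_one) (continuous_radialDensity n β).aestronglyMeasurable ?_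
    filter_upwards [ae_restrict_mem measurableSet_Ioi] with r hr
    have hr : 1 < r := hr
    have hr0 : 0 < r := by linarith
    rw [Real.norm_of_nonneg (radialDensity_pos hr0).le]
    exact radialDensity_le_rpow hn hr0 hβ0
  rw [← Ioc_union_Ioi_eq_Ioi (zero_le_one (α := ℝ))]
  exact h1.union h2

theorem integral_radialDensity_pos {n : ℕ} (hn : 1 ≤ n) {β : ℝ} (hβ : (n : ℝ) / 2 < β) :
    0 < ∫ r in Ioi 0, radialDensity n β r := by
  rw [setIntegral_pos_iff_support_of_nonneg_ae]
  · refine lt_of_lt_of_le (?_ : 0 < volume (Ioi (0 : ℝ))) (measure_mono fun r hr => ?_)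
    · simp
    · exact ⟨(radialDensity_pos hr).ne', hr⟩
  · filter_upwards [ae_restrict_mem measurableSet_Ioi] with r hr using (radialDensity_pos hr).le
  · exact integrableOn_radialDensity hn hβ

/-- The Riccati weight attached to the test function `(1 + r²)^a`. -/
def riccatiWeight (n : ℕ) (β c r : ℝ) : ℝ :=
  ((n : ℝ) - 2 * c * r ^ 2) * (1 + r ^ 2) ^ (β - 1) / r ^ n

theorem hasDerivAt_one_add_sq_rpow (p r : ℝ) :
    HasDerivAt (fun r : ℝ => (1 + r ^ 2) ^ p) (2 * p * r * (1 + r ^ 2) ^ (p - 1)) r := by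
  have h := ((hasDerivAt_pow 2 r).const_add 1).rpow_const (p := p) (Or.inl (by positivity))
  convert! h using 1
  push_cast; ring

theorem hasDerivAt_riccatiWeight (n : ℕ) (β c : ℝ) {r : ℝ} (hr : 0 < r) :
    HasDerivAt (riccatiWeight n β c)
      ((-4 * c * r + ((n : ℝ) - 2 * c * r ^ 2) * (2 * (β - 1) * r / (1 + r ^ 2))
        - ((n : ℝ) - 2 * c * r ^ 2) * n / r) * ((1 + r ^ 2) ^ (β - 1) / r ^ n)) r := by
  have h1 : HasDerivAt (fun r : ℝ => (n : ℝ) - 2 * c * r ^ 2) (-4 * c * r) r := by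
    convert! ((hasDerivAt_pow 2 r).const_mul (2 * c)).const_sub (n : ℝ) using 1
    norm_num; ring
  have h3 : HasDerivAt (fun r : ℝ => r ^ n) (n * r ^ n / r) r := by
    convert! hasDerivAt_pow n r using 1
    rcases n with _ | k
    · simp
    · rw [pow_succ]; field_simp; simp
  have h := (h1.mul (hasDerivAt_one_add_sq_rpow (β - 1) r)).div h3 (by positivity)
  convert! h using 1
  rw [Real.rpow_sub_one (by positivity : (1 + r ^ 2) ≠ 0) (β - 1)]
  simp only [Pi.mul_apply]
  field_simp

/-- Here W = u₀' / (ρ u₀), where u₀ = rⁿ (1 + r²)^{a−β} is, up to a factor, the flux (1 + r²) ρ φ'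
of φ = (1 + r²)^a. The left side is the energy density minus l times the variance density, minus the
derivative of −2l u f + l W u²; here u' = f ρ, and g' = f'. Completing squares leaves only the
Riccati residual of W. -/
theorem riccati_inequality {n : ℕ} (hn : 1 ≤ n) {β a : ℝ} (ha0 : 0 ≤ a) (ha1 : a ≤ 1)
    (hat : a ≤ β - n / 2) {r f u g' : ℝ} (hr : 0 < r) :
    let c := β - n / 2 - a
    let l := 4 * a * c
    let ρ := radialDensity n β r
    let W := riccatiWeight n β c r
    let W' := ((-4 * c * r + ((n : ℝ) - 2 * c * r ^ 2) * (2 * (β - 1) * r / (1 + r ^ 2))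
        - ((n : ℝ) - 2 * c * r ^ 2) * n / r) * ((1 + r ^ 2) ^ (β - 1) / r ^ n))
    0 ≤ ((1 + r ^ 2) * g' ^ 2 * ρ - l * (f ^ 2 * ρ)) -
      (-2 * l * (f * ρ * f + u * g') + l * (W' * u ^ 2 + W * (2 * u * (f * ρ)))) := by
  intro c l ρ W W'
  have hc : 0 ≤ c := by simp only [c]; linarith
  have hl : 0 ≤ l := by positivity
  have hv : 0 < 1 + r ^ 2 := by positivity
  set P := (1 + r ^ 2) ^ (β - 1) with hP
  have hPpos : 0 < P := Real.rpow_pos_of_pos hv _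
  have hρ : ρ = r ^ (n - 1) / (P * (1 + r ^ 2)) := by
    simp only [ρ, radialDensity]
    rw [Real.rpow_neg hv.le, div_eq_mul_inv, hP, ← Real.rpow_add_one hv.ne']; simp
  have hrn : r ^ n = r ^ (n - 1) * r := by rw [← pow_succ]; congr 1; omega
  have hq : 0 < r ^ (n - 1) := by positivity
  have hWd : W = ((n : ℝ) - 2 * c * r ^ 2) * P / (r ^ (n - 1) * r) := by
    simp only [W, riccatiWeight]; rw [hrn]
  set q := r ^ (n - 1) with hqd
  have hβ : β = a + c + n / 2 := by simp only [c]; ring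
  -- The residual carries the factor 1 − a: W solves the Riccati equation exactly for a = 1, and is
  -- a strict one-sided solution for a < 1. This is where a ≤ 1 is needed.
  have hres : -W' - W ^ 2 * ρ - l / ((1 + r ^ 2) * ρ)
      = P / (q * r ^ 2 * (1 + r ^ 2)) * ((1 - a) * (4 * c + 2 * n) * r ^ 2) := by
    rw [hρ, hWd]
    simp only [W', hrn, l]
    rw [← hP]
    clear_value P c
    subst hβ
    field_simp
    ring
  have hres0 : 0 ≤ -W' - W ^ 2 * ρ - l / ((1 + r ^ 2) * ρ) := by
    rw [hres]
    have : 0 ≤ 1 - a := by linarith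
    positivity
  have hρpos : 0 < ρ := radialDensity_pos hr
  have hid : ((1 + r ^ 2) * g' ^ 2 * ρ - l * (f ^ 2 * ρ)) -
      (-2 * l * (f * ρ * f + u * g') + l * (W' * u ^ 2 + W * (2 * u * (f * ρ))))
      = (1 + r ^ 2) * ρ * (g' + l * u / ((1 + r ^ 2) * ρ)) ^ 2 + l * (ρ * (f - W * u) ^ 2
        + u ^ 2 * (-W' - W ^ 2 * ρ - l / ((1 + r ^ 2) * ρ))) := by
    field_simp
    ring
  rw [hid]
  positivity

/-- The Poincaré inequality for the radial part, for compactly supported functions of class `C¹`. -/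
theorem radial_poincare {n : ℕ} (hn : 1 ≤ n) {β a : ℝ} (hβ : (n : ℝ) / 2 < β) (hβ1 : 1 ≤ β)
    (ha0 : 0 ≤ a) (ha1 : a ≤ 1) (hat : a ≤ β - n / 2)
    {g : ℝ → ℝ} (hg : ContDiff ℝ 1 g) (hgc : HasCompactSupport g) :
    4 * a * (β - n / 2 - a) * ((∫ r in Ioi 0, g r ^ 2 * radialDensity n β r) -
        (∫ r in Ioi 0, g r * radialDensity n β r) ^ 2 / ∫ r in Ioi 0, radialDensity n β r)
      ≤ ∫ r in Ioi 0, (1 + r ^ 2) * deriv g r ^ 2 * radialDensity n β r := by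
  set ρ := radialDensity n β with hρdef
  set c := β - n / 2 - a with hc
  set l := 4 * a * c with hl
  have hρc : Continuous ρ := continuous_radialDensity n β
  have hρi : IntegrableOn ρ (Ioi 0) := integrableOn_radialDensity hn hβ
  set Z := ∫ r in Ioi 0, ρ r with hZ
  have hZ0 : 0 < Z := integral_radialDensity_pos hn hβ
  have hg0 : Continuous g := hg.continuous
  have hg1 : Continuous (deriv g) := hg.continuous_deriv le_rfl
  set m := (∫ r in Ioi 0, g r * ρ r) / Z with hm
  obtain ⟨K, hK⟩ := hgc.exists_bound_of_continuous hg0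
  have hgi : IntegrableOn (fun r => g r * ρ r) (Ioi 0) :=
    ((hg0.mul hρc).integrable_of_hasCompactSupport hgc.mul_right).integrableOn
  have hg2i : IntegrableOn (fun r => g r ^ 2 * ρ r) (Ioi 0) :=
    (((hg0.pow 2).mul hρc).integrable_of_hasCompactSupport
      (HasCompactSupport.mul_right (by simpa [sq] using hgc.mul_right))).integrableOn
  have hgd : HasCompactSupport (deriv g) := hgc.deriv
  have hg1i : IntegrableOn (fun r => (1 + r ^ 2) * deriv g r ^ 2 * ρ r) (Ioi 0) := by
    refine (Continuous.integrable_of_hasCompactSupport (by fun_prop) ?_).integrableOn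
    refine HasCompactSupport.mul_right (HasCompactSupport.mul_left ?_)
    simpa only [sq] using! hgd.mul_right
  let f : ℝ → ℝ := fun r => g r - m
  have hf0 : Continuous f := hg0.sub continuous_const
  have hfb : ∀ r, |f r| ≤ K + |m| := fun r => (abs_sub _ _).trans (add_le_add (hK r) le_rfl)
  have hfi : IntegrableOn (fun r => f r * ρ r) (Ioi 0) := by
    simp only [f, sub_mul]; exact hgi.sub (hρi.const_mul m)
  have hfint : ∫ r in Ioi 0, f r * ρ r = 0 := by
    simp only [f, sub_mul]
    rw [integral_sub hgi (hρi.const_mul m), integral_const_mul, ← hZ, hm]; field_simp; simp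
  have hf2 : ∀ r, f r ^ 2 * ρ r = g r ^ 2 * ρ r - 2 * m * (g r * ρ r) + m ^ 2 * ρ r := fun r => by
    simp only [f]; ring
  have hf2i : IntegrableOn (fun r => f r ^ 2 * ρ r) (Ioi 0) := by
    simp only [hf2]; exact (hg2i.sub (hgi.const_mul _)).add (hρi.const_mul _)
  have hf2int : ∫ r in Ioi 0, f r ^ 2 * ρ r = (∫ r in Ioi 0, g r ^ 2 * ρ r) -
      (∫ r in Ioi 0, g r * ρ r) ^ 2 / Z := by
    simp only [hf2]
    have e1 := integral_add (hg2i.sub (hgi.const_mul (2 * m))) (hρi.const_mul (m ^ 2))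
    have e2 := integral_sub hg2i (hgi.const_mul (2 * m))
    simp only [Pi.sub_apply] at e1
    rw [e1, e2, integral_const_mul, integral_const_mul, ← hZ, hm]
    field_simp; ring
  -- Since f has mean zero, u vanishes at infinity as well as at 0. The two decay rates below are
  -- what beats the singularity of W at 0 and its growth at infinity.
  let u : ℝ → ℝ := fun r => ∫ s in (0 : ℝ)..r, f s * ρ s
  have hud : ∀ r, HasDerivAt u (f r * ρ r) r := fun r =>
    intervalIntegral.integral_hasDerivAt_right ((hf0.mul hρc).intervalIntegrable _ _)
      ((hf0.mul hρc).stronglyMeasurableAtFilter _ _) (hf0.mul hρc).continuousAt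
  have hu0 : ∀ r, 0 < r → |u r| ≤ (K + |m|) * r ^ n := by
    intro r hr
    have h1 : ∀ s ∈ uIoc (0 : ℝ) r, ‖f s * ρ s‖ ≤ (K + |m|) * r ^ (n - 1) := by
      intro s hs
      rw [uIoc_of_le hr.le] at hs
      rw [norm_mul, Real.norm_eq_abs, Real.norm_of_nonneg (radialDensity_pos hs.1).le]
      refine mul_le_mul (hfb s) ?_ (radialDensity_pos hs.1).le ((abs_nonneg _).trans (hfb s))
      exact (radialDensity_le_pow hs.1.le (by linarith)).trans (pow_le_pow_left₀ hs.1.le hs.2 _)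
    have h2 := intervalIntegral.norm_integral_le_of_norm_le_const h1
    rw [sub_zero, abs_of_pos hr, mul_assoc, ← pow_succ] at h2
    rwa [show n - 1 + 1 = n by omega] at h2
  obtain ⟨R0, hR0⟩ : ∃ R0 : ℝ, ∀ r, R0 ≤ r → g r = 0 := by
    obtain ⟨R, hR⟩ := hgc.isCompact.isBounded.subset_closedBall 0
    refine ⟨R + 1, fun r hr => ?_⟩
    by_contra h
    have := hR (subset_tsupport _ h)
    rw [Metric.mem_closedBall, dist_zero_right, Real.norm_eq_abs] at this
    linarith [le_abs_self r]
  set t := β - n / 2 with ht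
  have ht0 : 0 < t := by simp only [ht]; linarith
  -- Beyond the support of g, f is the constant −m, so u is m times the tail of ρ.
  have hu1 : ∀ r, 0 < r → R0 ≤ r → |u r| ≤ |m| / (2 * t) * r ^ (-(2 * t)) := by
    intro r hr hrR
    have hsplit : u r + ∫ s in Ioi r, f s * ρ s = 0 := by
      rw [← hfint]
      exact intervalIntegral.integral_interval_add_Ioi
        (hfi) (hfi.mono_set (Ioi_subset_Ioi hr.le))
    have h2 : u r = m * ∫ s in Ioi r, ρ s := by
      have : ∫ s in Ioi r, f s * ρ s = ∫ s in Ioi r, (-m) * ρ s := by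
        refine setIntegral_congr_fun measurableSet_Ioi fun s hs => ?_
        simp only [f, hR0 s (hrR.trans (le_of_lt hs)), zero_sub]
      rw [this, integral_const_mul] at hsplit
      linarith
    have h3 : ∫ s in Ioi r, ρ s ≤ ∫ s in Ioi r, s ^ ((n : ℝ) - 1 - 2 * β) := by
      refine setIntegral_mono_on (hρi.mono_set (Ioi_subset_Ioi hr.le))
        (integrableOn_Ioi_rpow_of_lt (by linarith) hr) measurableSet_Ioi fun s hs => ?_
      exact radialDensity_le_rpow hn (hr.trans hs) (by linarith)
    rw [integral_Ioi_rpow_of_lt (by linarith) hr,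
      show (n : ℝ) - 1 - 2 * β + 1 = -(2 * t) by rw [ht]; ring] at h3
    have h4 : 0 ≤ ∫ s in Ioi r, ρ s := setIntegral_nonneg measurableSet_Ioi fun s hs =>
      (radialDensity_pos (hr.trans hs)).le
    rw [h2, abs_mul, abs_of_nonneg h4]
    calc |m| * ∫ s in Ioi r, ρ s ≤ |m| * (-r ^ (-(2 * t)) / -(2 * t)) := by gcongr
      _ = _ := by rw [neg_div_neg_eq]; ring
  let W := riccatiWeight n β c
  have hc0 : 0 ≤ c := by rw [hc]; linarith
  let F : ℝ → ℝ := fun r => (1 + r ^ 2) * deriv g r ^ 2 * ρ r - l * (f r ^ 2 * ρ r)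
  have hF0 : Continuous F := by fun_prop
  have hFi : IntegrableOn F (Ioi 0) := hg1i.sub (hf2i.const_mul l)
  -- The pointwise inequality says F ≥ B', so Φ = ∫F − B is nondecreasing. As B tends to 0 at both
  -- ends, Φ goes from 0 to the integral of F, which is therefore nonnegative.
  let B : ℝ → ℝ := fun r => -2 * l * (u r * f r) + l * (W r * u r ^ 2)
  let Φ : ℝ → ℝ := fun r => (∫ s in (0 : ℝ)..r, F s) - B r
  have hfd : ∀ r, HasDerivAt f (deriv g r) r := fun r =>
    ((hg.differentiable one_ne_zero) r).hasDerivAt.sub_const m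
  have hΦd : ∀ r, 0 < r → ∃ d, 0 ≤ d ∧ HasDerivAt Φ d r := by
    intro r hr
    refine ⟨_, riccati_inequality hn ha0 ha1 hat (f := f r) (u := u r) (g' := deriv g r) hr, ?_⟩
    have e1 : HasDerivAt (fun r => ∫ s in (0 : ℝ)..r, F s) (F r) r :=
      intervalIntegral.integral_hasDerivAt_right (hF0.intervalIntegrable _ _)
        (hF0.stronglyMeasurableAtFilter _ _) hF0.continuousAt
    have e2 := (hud r).mul (hfd r)
    have e3 := (hasDerivAt_riccatiWeight n β c hr).mul ((hud r).pow 2)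
    have e4 := e1.sub ((e2.const_mul (-2 * l)).add (e3.const_mul l))
    convert! e4 using 1
    simp only [F, Pi.pow_apply]
    norm_num
    rfl
  have hmono : MonotoneOn Φ (Ioi 0) := by
    refine monotoneOn_of_deriv_nonneg (convex_Ioi 0) ?_ ?_ ?_
    · intro r hr
      obtain ⟨d, -, hd⟩ := hΦd r hr
      exact hd.continuousAt.continuousWithinAt
    · intro r hr
      rw [interior_Ioi] at hr
      obtain ⟨d, -, hd⟩ := hΦd r hr
      exact hd.differentiableAt.differentiableWithinAt
    · intro r hr
      rw [interior_Ioi] at hr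
      obtain ⟨d, hd0, hd⟩ := hΦd r hr
      rwa [hd.deriv]
  have hu00 : u 0 = 0 := intervalIntegral.integral_same
  have hucont : Continuous u := continuous_iff_continuousAt.2 fun r => (hud r).continuousAt
  have hlim0 : Tendsto Φ (𝓝[>] 0) (𝓝 0) := by
    have k1 : Tendsto (fun r => ∫ s in (0 : ℝ)..r, F s) (𝓝[>] 0) (𝓝 0) := by
      have : Continuous fun r => ∫ s in (0 : ℝ)..r, F s :=
        intervalIntegral.continuous_primitive (fun a b => hF0.intervalIntegrable a b) 0
      have h := (this.tendsto 0).mono_left (nhdsWithin_le_nhds (s := Ioi 0))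
      simpa using h
    have k2 : Tendsto (fun r => u r * f r) (𝓝[>] 0) (𝓝 0) := by
      have h := ((hucont.mul hf0).tendsto 0).mono_left (nhdsWithin_le_nhds (s := Ioi 0))
      simpa [hu00] using! h
    -- Near 0, W is O(r⁻ⁿ) while u is O(rⁿ).
    have k3 : Tendsto (fun r => W r * u r ^ 2) (𝓝[>] 0) (𝓝 0) := by
      have hb : Tendsto (fun r : ℝ => (((n : ℝ) + 2 * c) * 2 ^ (β - 1) * (K + |m|) ^ 2) * r ^ n)
          (𝓝[>] 0) (𝓝 0) := by
        have : Continuous fun r : ℝ =>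
          (((n : ℝ) + 2 * c) * 2 ^ (β - 1) * (K + |m|) ^ 2) * r ^ n := by fun_prop
        have h := (this.tendsto 0).mono_left (nhdsWithin_le_nhds (s := Ioi 0))
        simpa [show n ≠ 0 by omega] using h
      refine squeeze_zero_norm' ?_ hb
      filter_upwards [Ioo_mem_nhdsGT (zero_lt_one (α := ℝ))] with r hr
      have hr0 : 0 < r := hr.1
      have e1 : |(n : ℝ) - 2 * c * r ^ 2| ≤ n + 2 * c := by
        have h1 : 2 * c * r ^ 2 ≤ 2 * c * 1 := by
          gcongr; nlinarith [hr.2]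
        have h2 : 0 ≤ 2 * c * r ^ 2 := by positivity
        have h3 : (0 : ℝ) ≤ n := by positivity
        rw [abs_le]; constructor <;> linarith
      have e2 : (1 + r ^ 2) ^ (β - 1) ≤ 2 ^ (β - 1) :=
        Real.rpow_le_rpow (by positivity) (by nlinarith [hr.2]) (by linarith)
      have e3 := pow_le_pow_left₀ (abs_nonneg _) (hu0 r hr0) 2
      simp only [W, riccatiWeight]
      rw [norm_mul, norm_div, norm_mul, Real.norm_eq_abs, Real.norm_eq_abs, Real.norm_eq_abs,
        Real.norm_eq_abs, abs_pow, abs_pow, abs_of_pos hr0,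
        abs_of_pos (Real.rpow_pos_of_pos (by positivity : 0 < 1 + r ^ 2) _)]
      calc _ ≤ ((n : ℝ) + 2 * c) * 2 ^ (β - 1) / r ^ n * ((K + |m|) * r ^ n) ^ 2 := by gcongr
        _ = _ := by field_simp
    have := k1.sub ((k2.const_mul (-2 * l)).add (k3.const_mul l))
    simpa [Φ, B] using this
  have hlim1 : Tendsto Φ atTop (𝓝 (∫ r in Ioi 0, F r)) := by
    have k1 : Tendsto (fun r => ∫ s in (0 : ℝ)..r, F s) atTop (𝓝 (∫ r in Ioi 0, F r)) :=
      intervalIntegral_tendsto_integral_Ioi 0 hFi tendsto_id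
    have ku : Tendsto u atTop (𝓝 0) := by
      rw [← hfint]; exact intervalIntegral_tendsto_integral_Ioi 0 hfi tendsto_id
    have k2 : Tendsto (fun r => u r * f r) atTop (𝓝 0) := by
      refine squeeze_zero_norm (a := fun r => |u r| * (K + |m|)) (fun r => ?_) ?_
      · rw [norm_mul]; exact mul_le_mul_of_nonneg_left (hfb r) (abs_nonneg _)
      · simpa using ku.abs.mul_const (K + |m|)
    -- At infinity W is O(r^{2t}) while u² is O(r^{−4t}).
    have k3 : Tendsto (fun r => W r * u r ^ 2) atTop (𝓝 0) := by
      have hb : Tendsto (fun r : ℝ => (((n : ℝ) + 2 * c) * 2 ^ (β - 1) * (|m| / (2 * t)) ^ 2) *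
          r ^ (-(2 * t))) atTop (𝓝 0) := by
        simpa using (tendsto_rpow_neg_atTop (by linarith : 0 < 2 * t)).const_mul
          (((n : ℝ) + 2 * c) * 2 ^ (β - 1) * (|m| / (2 * t)) ^ 2)
      refine squeeze_zero_norm' ?_ hb
      filter_upwards [eventually_ge_atTop R0, eventually_ge_atTop 1] with r hrR hr1
      have hr0 : 0 < r := by linarith
      have hr2 : 1 ≤ r ^ 2 := by nlinarith
      have e1 : |(n : ℝ) - 2 * c * r ^ 2| ≤ (n + 2 * c) * r ^ 2 := by
        have h2 : 0 ≤ 2 * c * r ^ 2 := by positivity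
        have h3 : (0 : ℝ) ≤ n := by positivity
        rw [abs_le]; constructor <;> nlinarith
      have e2 : (1 + r ^ 2) ^ (β - 1) ≤ 2 ^ (β - 1) * (r ^ 2) ^ (β - 1) := by
        rw [← Real.mul_rpow (by norm_num) (by positivity)]
        exact Real.rpow_le_rpow (by positivity) (by linarith) (by linarith)
      have e3 := pow_le_pow_left₀ (abs_nonneg _) (hu1 r hr0 hrR) 2
      have e4 : (r ^ 2) ^ (β - 1) * r ^ 2 / r ^ n = r ^ (2 * t) := by
        rw [← Real.rpow_add_one (by positivity), ← Real.rpow_natCast r 2, ← Real.rpow_mul hr0.le,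
          ← Real.rpow_natCast r n, ← Real.rpow_sub hr0]
        congr 1; rw [ht]; push_cast; ring
      have e5 : r ^ (2 * t) * r ^ (-(2 * t)) = 1 := by
        rw [← Real.rpow_add hr0]; simp
      simp only [W, riccatiWeight]
      rw [norm_mul, norm_div, norm_mul, Real.norm_eq_abs, Real.norm_eq_abs, Real.norm_eq_abs,
        Real.norm_eq_abs, abs_pow, abs_pow, abs_of_pos hr0,
        abs_of_pos (Real.rpow_pos_of_pos (by positivity : 0 < 1 + r ^ 2) _)]
      calc _ ≤ (((n : ℝ) + 2 * c) * r ^ 2) * (2 ^ (β - 1) * (r ^ 2) ^ (β - 1)) / r ^ n *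
            (|m| / (2 * t) * r ^ (-(2 * t))) ^ 2 := by gcongr
        _ = (((n : ℝ) + 2 * c) * 2 ^ (β - 1) * (|m| / (2 * t)) ^ 2) *
            ((r ^ 2) ^ (β - 1) * r ^ 2 / r ^ n * r ^ (-(2 * t))) * r ^ (-(2 * t)) := by ring
        _ = _ := by rw [e4, e5, mul_one]
    have := k1.sub ((k2.const_mul (-2 * l)).add (k3.const_mul l))
    simpa [Φ, B] using this
  have hΦ0 : ∀ r, 0 < r → 0 ≤ Φ r := fun r hr => by
    refine le_of_tendsto hlim0 ?_
    filter_upwards [Ioo_mem_nhdsGT hr] with s hs using hmono hs.1 hr hs.2.le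
  have hfin : 0 ≤ ∫ r in Ioi 0, F r := by
    refine ge_of_tendsto hlim1 ?_
    filter_upwards [eventually_gt_atTop 0] with r hr using hΦ0 r hr
  rw [integral_sub hg1i (hf2i.const_mul l), integral_const_mul, hf2int] at hfin
  linarith

end RadialPoincare

/-! ### Normalized densities -/

section NormalizedDensity

variable {α : Type*} [MeasurableSpace α]

/-- The probability measure with density proportional to `ρ` with respect to `m`. -/
def normalizedDensity (m : Measure α) (ρ : α → ℝ) : Measure α :=
  (m.withDensity (fun x => ENNReal.ofReal (ρ x)) univ)⁻¹ •
    m.withDensity fun x => ENNReal.ofReal (ρ x)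

variable {m : Measure α} {ρ : α → ℝ}

theorem withDensity_univ_eq (hi : Integrable ρ m) (h0 : 0 ≤ᵐ[m] ρ) :
    m.withDensity (fun x => ENNReal.ofReal (ρ x)) univ = ENNReal.ofReal (∫ x, ρ x ∂m) := by
  rw [withDensity_apply _ MeasurableSet.univ, Measure.restrict_univ,
    ofReal_integral_eq_lintegral_ofReal hi h0]

theorem isProbabilityMeasure_normalizedDensity (hi : Integrable ρ m) (h0 : 0 ≤ᵐ[m] ρ)
    (hpos : 0 < ∫ x, ρ x ∂m) : IsProbabilityMeasure (normalizedDensity m ρ) := by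
  refine ⟨?_⟩
  rw [normalizedDensity, Measure.smul_apply, withDensity_univ_eq hi h0, smul_eq_mul,
    ENNReal.inv_mul_cancel (by simpa using hpos) ENNReal.ofReal_ne_top]

theorem integral_normalizedDensity (hm : Measurable ρ) (hi : Integrable ρ m) (h0 : 0 ≤ᵐ[m] ρ)
    (f : α → ℝ) :
    ∫ x, f x ∂(normalizedDensity m ρ) = (∫ x, f x * ρ x ∂m) / ∫ x, ρ x ∂m := by
  have hI : 0 ≤ ∫ x, ρ x ∂m := integral_nonneg_of_ae h0
  rw [normalizedDensity, integral_smul_measure, withDensity_univ_eq hi h0,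
    ENNReal.toReal_inv, ENNReal.toReal_ofReal hI,
    integral_withDensity_eq_integral_toReal_smul (by fun_prop) (by simp), smul_eq_mul,
    inv_mul_eq_div]
  congr 1
  refine integral_congr_ae ?_
  filter_upwards [h0] with x hx
  rw [ENNReal.toReal_ofReal hx, smul_eq_mul, mul_comm]

theorem integrable_normalizedDensity_iff (hm : Measurable ρ) (hi : Integrable ρ m)
    (h0 : 0 ≤ᵐ[m] ρ) (hpos : 0 < ∫ x, ρ x ∂m) {f : α → ℝ} :
    Integrable f (normalizedDensity m ρ) ↔ Integrable (fun x => f x * ρ x) m := by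
  rw [normalizedDensity, integrable_smul_measure, integrable_withDensity_iff (by fun_prop) (by simp)]
  · refine integrable_congr ?_
    filter_upwards [h0] with x hx
    rw [ENNReal.toReal_ofReal hx]
  · rw [withDensity_univ_eq hi h0]; simp
  · rw [withDensity_univ_eq hi h0]; simpa using hpos

theorem ae_normalizedDensity_of_ae {p : α → Prop} (h : ∀ᵐ x ∂m, p x) :
    ∀ᵐ x ∂(normalizedDensity m ρ), p x :=
  Measure.ae_smul_measure ((withDensity_absolutelyContinuous m _).ae_le h) _

end NormalizedDensity

/-! ### Self-adjoint realizations of generators -/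

section Realization

variable {α : Type*} [MeasurableSpace α] {μ : Measure α}

/-- The constant function `1` in `L²`. -/
def oneLp (μ : Measure α) [IsFiniteMeasure μ] : Lp ℝ 2 μ := (memLp_const (1 : ℝ)).toLp _

theorem oneLp_ae (μ : Measure α) [IsFiniteMeasure μ] : oneLp μ =ᵐ[μ] fun _ => (1 : ℝ) :=
  MemLp.coeFn_toLp _

theorem inner_eq_integral {u v : Lp ℝ 2 μ} {f g : α → ℝ} (hu : u =ᵐ[μ] f) (hv : v =ᵐ[μ] g) :
    ⟪u, v⟫_ℝ = ∫ x, f x * g x ∂μ := by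
  rw [L2.inner_def]
  refine integral_congr_ae ?_
  filter_upwards [hu, hv] with x h1 h2
  rw [h1, h2]; simp [mul_comm]

theorem norm_sq_eq_integral {u : Lp ℝ 2 μ} {f : α → ℝ} (hu : u =ᵐ[μ] f) :
    ‖u‖ ^ 2 = ∫ x, f x ^ 2 ∂μ := by
  rw [← real_inner_self_eq_norm_sq, inner_eq_integral hu hu]
  simp only [sq]

theorem norm_oneLp [IsProbabilityMeasure μ] : ‖oneLp μ‖ = 1 := by
  have h := norm_sq_eq_integral (oneLp_ae μ)
  simp only [one_pow, integral_const, probReal_univ, smul_eq_mul, mul_one] at h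
  exact (pow_eq_one_iff_of_nonneg (norm_nonneg _) two_ne_zero).1 h

/-- A generator with a symmetric Dirichlet form satisfying a Poincaré inequality has a self-adjoint
realization satisfying the same inequality. -/
theorem exists_realization_negOp [IsProbabilityMeasure μ] {C : Submodule ℝ (α → ℝ)}
    {L : C →ₗ[ℝ] (α → ℝ)} (hgr : (negOp μ C L).graph = negGraph μ C L)
    (hC : ∀ h : C, MemLp (h : α → ℝ) 2 μ) (hL : ∀ h : C, MemLp (L h) 2 μ) {E : C → C → ℝ}
    (hE : ∀ h k : C, ∫ x, -(L h) x * (k : α → ℝ) x ∂μ = E h k) (hsymm : ∀ h k, E h k = E k h)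
    (hnonneg : ∀ h, 0 ≤ E h h)
    (hdense : ∀ w : Lp ℝ 2 μ, (∀ h : C, ∫ x, w x * (h : α → ℝ) x ∂μ = 0) → w = 0) {l : ℝ}
    (hl : ∀ h : C, l * (∫ x, (h : α → ℝ) x ^ 2 ∂μ - (∫ x, (h : α → ℝ) x ∂μ) ^ 2) ≤ E h h) :
    ∃ A, IsSelfAdjointRealization (negOp μ C L) A ∧ ∀ u : A.domain,
      l * (‖(u : Lp ℝ 2 μ)‖ ^ 2 - ⟪(u : Lp ℝ 2 μ), oneLp μ⟫_ℝ ^ 2) ≤ ⟪(u : Lp ℝ 2 μ), A u⟫_ℝ := by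
  set T := negOp μ C L with hT
  have hrep : ∀ u : T.domain, ∃ h : C, (u : Lp ℝ 2 μ) =ᵐ[μ] (h : α → ℝ) ∧ T u =ᵐ[μ] -(L h) := by
    intro u
    have := T.mem_graph u
    rwa [hgr] at this
  have hform : ∀ u v : T.domain, ∀ h k : C, T u =ᵐ[μ] -(L h) →
      (v : Lp ℝ 2 μ) =ᵐ[μ] (k : α → ℝ) → ⟪T u, (v : Lp ℝ 2 μ)⟫_ℝ = E h k := by
    intro u v h k hu hv
    rw [← hE, inner_eq_integral hu hv]
    rfl
  refine exists_isSelfAdjointRealization T ?_ (fun u v => ?_) (fun u => ?_) (oneLp μ) l fun u => ?_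
  · rw [Submodule.dense_iff_topologicalClosure_eq_top, Submodule.topologicalClosure_eq_top_iff,
      Submodule.eq_bot_iff]
    intro w hw
    refine hdense w fun h => ?_
    have hmem : ((hC h).toLp _, (hL h).neg.toLp _) ∈ T.graph := by
      rw [hgr]
      exact ⟨h, (hC h).coeFn_toLp, (hL h).neg.coeFn_toLp⟩
    obtain ⟨u, hu, -⟩ := (LinearPMap.mem_graph_iff T).1 hmem
    simp only at hu
    have hz := (Submodule.mem_orthogonal' _ w).1 hw u u.2
    rw [hu, inner_eq_integral (EventuallyEq.refl _ _) (hC h).coeFn_toLp] at hz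
    exact hz
  · obtain ⟨h, hu1, hu2⟩ := hrep u
    obtain ⟨k, hv1, hv2⟩ := hrep v
    rw [hform u v h k hu2 hv1, real_inner_comm, hform v u k h hv2 hu1, hsymm]
  · obtain ⟨h, hu1, hu2⟩ := hrep u
    rw [real_inner_comm, hform u u h h hu2 hu1]
    exact hnonneg h
  · obtain ⟨h, hu1, hu2⟩ := hrep u
    rw [real_inner_comm (T u), hform u u h h hu2 hu1, norm_sq_eq_integral hu1,
      inner_eq_integral hu1 (oneLp_ae μ)]
    simpa using hl h

end Realization

/-! ### The generalized Cauchy distribution and its radial part -/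

section Measures

variable {n : ℕ} {β : ℝ}

theorem ae_radialDensity_pos (n : ℕ) (β : ℝ) :
    ∀ᵐ r ∂(volume.restrict (Ioi (0 : ℝ))), 0 < radialDensity n β r := by
  filter_upwards [ae_restrict_mem measurableSet_Ioi] with r hr using radialDensity_pos hr

theorem isProbabilityMeasure_radialMeasure (hn : 1 ≤ n) (hβ : (n : ℝ) / 2 < β) :
    IsProbabilityMeasure (radialMeasure n β) :=
  isProbabilityMeasure_normalizedDensity (integrableOn_radialDensity hn hβ)
    ((ae_radialDensity_pos n β).mono fun _ h => h.le) (integral_radialDensity_pos hn hβ)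

theorem integral_radialMeasure (hn : 1 ≤ n) (hβ : (n : ℝ) / 2 < β) (f : ℝ → ℝ) :
    ∫ r, f r ∂(radialMeasure n β) =
      (∫ r in Ioi 0, f r * radialDensity n β r) / ∫ r in Ioi 0, radialDensity n β r :=
  integral_normalizedDensity (continuous_radialDensity n β).measurable
    (integrableOn_radialDensity hn hβ) ((ae_radialDensity_pos n β).mono fun _ h => h.le) f

theorem integrable_radialMeasure_iff (hn : 1 ≤ n) (hβ : (n : ℝ) / 2 < β) {f : ℝ → ℝ} :
    Integrable f (radialMeasure n β) ↔ IntegrableOn (fun r => f r * radialDensity n β r) (Ioi 0) :=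
  integrable_normalizedDensity_iff (continuous_radialDensity n β).measurable
    (integrableOn_radialDensity hn hβ) ((ae_radialDensity_pos n β).mono fun _ h => h.le)
    (integral_radialDensity_pos hn hβ)

theorem ae_radialMeasure_pos (n : ℕ) (β : ℝ) : ∀ᵐ r ∂(radialMeasure n β), 0 < r :=
  ae_normalizedDensity_of_ae (ae_restrict_mem measurableSet_Ioi)

theorem continuous_cauchyDensity (n : ℕ) (β : ℝ) :
    Continuous fun x : EuclideanSpace ℝ (Fin n) => (1 + ‖x‖ ^ 2) ^ β :=
  (by fun_prop : Continuous fun x : EuclideanSpace ℝ (Fin n) => 1 + ‖x‖ ^ 2).rpow_const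
    fun r => Or.inl (by positivity)

theorem integrable_cauchyDensity (hβ : (n : ℝ) / 2 < β) :
    Integrable fun x : EuclideanSpace ℝ (Fin n) => (1 + ‖x‖ ^ 2) ^ (-β) := by
  have := integrable_rpow_neg_one_add_norm_sq (E := EuclideanSpace ℝ (Fin n)) (μ := volume)
    (r := 2 * β) (by simp; linarith)
  simpa [neg_div] using this

theorem integral_cauchyDensity_pos (hβ : (n : ℝ) / 2 < β) :
    0 < ∫ x : EuclideanSpace ℝ (Fin n), (1 + ‖x‖ ^ 2) ^ (-β) :=
  integral_pos_of_integrable_nonneg_nonzero (x := 0) (continuous_cauchyDensity n (-β))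
    (integrable_cauchyDensity hβ) (fun x => by positivity) (by simp)

theorem isProbabilityMeasure_cauchyMeasure (hβ : (n : ℝ) / 2 < β) :
    IsProbabilityMeasure (cauchyMeasure n β) :=
  isProbabilityMeasure_normalizedDensity (integrable_cauchyDensity hβ)
    (Eventually.of_forall fun x => by simp only [Pi.zero_apply]; positivity)
    (integral_cauchyDensity_pos hβ)

theorem integral_cauchyMeasure (hβ : (n : ℝ) / 2 < β) (f : EuclideanSpace ℝ (Fin n) → ℝ) :
    ∫ x, f x ∂(cauchyMeasure n β) = (∫ x, f x * (1 + ‖x‖ ^ 2) ^ (-β)) /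
      ∫ x : EuclideanSpace ℝ (Fin n), (1 + ‖x‖ ^ 2) ^ (-β) :=
  integral_normalizedDensity (continuous_cauchyDensity n (-β)).measurable
    (integrable_cauchyDensity hβ)
    (Eventually.of_forall fun x => by simp only [Pi.zero_apply]; positivity) f

theorem integrable_cauchyMeasure_iff (hβ : (n : ℝ) / 2 < β)
    {f : EuclideanSpace ℝ (Fin n) → ℝ} :
    Integrable f (cauchyMeasure n β) ↔ Integrable fun x => f x * (1 + ‖x‖ ^ 2) ^ (-β) :=
  integrable_normalizedDensity_iff (continuous_cauchyDensity n (-β)).measurable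
    (integrable_cauchyDensity hβ)
    (Eventually.of_forall fun x => by simp only [Pi.zero_apply]; positivity)
    (integral_cauchyDensity_pos hβ)

theorem integral_cauchyMeasure_norm (hn : 1 ≤ n) (hβ : (n : ℝ) / 2 < β) (f : ℝ → ℝ) :
    ∫ x, f ‖x‖ ∂(cauchyMeasure n β) = ∫ r, f r ∂(radialMeasure n β) := by
  have : Nontrivial (EuclideanSpace ℝ (Fin n)) := by
    have : Nonempty (Fin n) := ⟨⟨0, by omega⟩⟩
    infer_instance
  rw [integral_cauchyMeasure hβ, integral_radialMeasure hn hβ,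
    integral_fun_norm_addHaar volume (fun r => f r * (1 + r ^ 2) ^ (-β)),
    integral_fun_norm_addHaar volume (fun r => (1 + r ^ 2) ^ (-β))]
  simp only [finrank_euclideanSpace, Fintype.card_fin, smul_eq_mul, nsmul_eq_mul, radialDensity]
  have h1 : volume.real (Metric.ball (0 : EuclideanSpace ℝ (Fin n)) 1) ≠ 0 :=
    (ENNReal.toReal_pos (Metric.measure_ball_pos _ _ one_pos).ne' measure_ball_lt_top.ne).ne'
  have h2 : (n : ℝ) ≠ 0 := by positivity
  rw [mul_div_mul_left _ _ h2, mul_div_mul_left _ _ h1]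
  congr 2
  ext r
  ring

/-- Polar coordinates applied to indicator functions. It allows near-optimizers to be handled once,
as functions of a measure-preserving map q, with q the identity on the half-line or the norm on ℝⁿ.
-/
theorem measurePreserving_norm (hn : 1 ≤ n) (hβ : (n : ℝ) / 2 < β) :
    MeasurePreserving (fun x : EuclideanSpace ℝ (Fin n) => ‖x‖) (cauchyMeasure n β)
      (radialMeasure n β) := by
  have := isProbabilityMeasure_cauchyMeasure hβ
  have := isProbabilityMeasure_radialMeasure hn hβ
  have hm : Measurable fun x : EuclideanSpace ℝ (Fin n) => ‖x‖ := measurable_norm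
  refine ⟨hm, ?_⟩
  ext s hs
  have h := integral_cauchyMeasure_norm hn hβ (s.indicator fun _ => 1)
  rw [integral_indicator hs] at h
  have h2 : (fun x : EuclideanSpace ℝ (Fin n) => s.indicator (fun _ => (1 : ℝ)) ‖x‖) =
      ((fun x : EuclideanSpace ℝ (Fin n) => ‖x‖) ⁻¹' s).indicator fun _ => 1 := by
    ext x; rfl
  rw [h2, integral_indicator (hm hs)] at h
  simp only [setIntegral_const, smul_eq_mul, mul_one] at h
  rw [Measure.map_apply hm hs]
  exact (measureReal_eq_measureReal_iff).1 h

end Measures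

/-! ### The radial operator -/

section RadialOperator

variable {n : ℕ} {β : ℝ}

theorem exists_bound_mul_of_hasCompactSupport {X : Type*} [TopologicalSpace X] {f g : X → ℝ}
    (hf : Continuous f) (hg : Continuous g) (hgc : HasCompactSupport g) :
    ∃ K : ℝ, ∀ x, |f x * g x| ≤ K :=
  (hgc.mul_left (f := f)).exists_bound_of_continuous (hf.mul hg)

theorem radialGenerator_apply (g : neumannTestSpace) (r : ℝ) :
    radialGenerator n β g r = (1 + r ^ 2) * deriv (deriv (g : ℝ → ℝ)) r +
      (((n : ℝ) + 1 - 2 * β) * r + ((n : ℝ) - 1) / r) * deriv (g : ℝ → ℝ) r := rfl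

/-- The role of Neumann's condition: g' vanishes linearly at 0, which absorbs the singular drift (n
− 1)/r and keeps the generator bounded on test functions. -/
theorem exists_bound_deriv_of_neumann (g : neumannTestSpace) :
    ∃ K : ℝ, ∀ r, |deriv (g : ℝ → ℝ) r| ≤ K * |r| := by
  have hg1 : ContDiff ℝ ∞ (deriv (g : ℝ → ℝ)) := (contDiff_infty_iff_deriv.1 g.2.1).2
  have hg2 : Continuous (deriv (deriv (g : ℝ → ℝ))) := (contDiff_infty_iff_deriv.1 hg1).2.continuous
  obtain ⟨K, hK⟩ := g.2.2.1.deriv.deriv.exists_bound_of_continuous hg2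
  refine ⟨K, fun r => ?_⟩
  have h := convex_univ.norm_image_sub_le_of_norm_deriv_le (f := deriv (g : ℝ → ℝ))
    (fun x _ => (hg1.differentiable (by simp)) x) (fun x _ => hK x) (mem_univ 0) (mem_univ r)
  simpa [g.2.2.2] using h

theorem exists_bound_radialGenerator (g : neumannTestSpace) :
    ∃ K : ℝ, ∀ r, |radialGenerator n β g r| ≤ K := by
  have hg1 : ContDiff ℝ ∞ (deriv (g : ℝ → ℝ)) := (contDiff_infty_iff_deriv.1 g.2.1).2
  have hg2 : Continuous (deriv (deriv (g : ℝ → ℝ))) := (contDiff_infty_iff_deriv.1 hg1).2.continuous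
  have hc1 := hg1.continuous
  obtain ⟨K1, hK1⟩ := exists_bound_mul_of_hasCompactSupport
    (by fun_prop : Continuous fun r : ℝ => 1 + r ^ 2) hg2 g.2.2.1.deriv.deriv
  obtain ⟨K2, hK2⟩ := exists_bound_mul_of_hasCompactSupport
    (by fun_prop : Continuous fun r : ℝ => ((n : ℝ) + 1 - 2 * β) * r) hc1 g.2.2.1.deriv
  obtain ⟨K3, hK3⟩ := exists_bound_deriv_of_neumann g
  have hK30 : 0 ≤ K3 := by simpa using (abs_nonneg _).trans (hK3 1)
  refine ⟨K1 + K2 + |(n : ℝ) - 1| * K3, fun r => ?_⟩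
  have e : radialGenerator n β g r = (1 + r ^ 2) * deriv (deriv (g : ℝ → ℝ)) r +
      (((n : ℝ) + 1 - 2 * β) * r) * deriv (g : ℝ → ℝ) r +
      ((n : ℝ) - 1) * (deriv (g : ℝ → ℝ) r / r) := by
    rw [radialGenerator_apply]; ring
  rw [e]
  refine (abs_add_three _ _ _).trans (add_le_add (add_le_add (hK1 r) (hK2 r)) ?_)
  rw [abs_mul, abs_div]
  gcongr
  rcases eq_or_ne r 0 with rfl | hr
  · simpa using hK30
  · rw [div_le_iff₀ (abs_pos.2 hr)]; exact hK3 r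

theorem measurable_radialGenerator (g : neumannTestSpace) : Measurable (radialGenerator n β g) := by
  have e : radialGenerator n β g = fun r => (1 + r ^ 2) * deriv (deriv (g : ℝ → ℝ)) r +
      (((n : ℝ) + 1 - 2 * β) * r + ((n : ℝ) - 1) / r) * deriv (g : ℝ → ℝ) r := rfl
  rw [e]
  have h1 := measurable_deriv (g : ℝ → ℝ)
  have h2 := measurable_deriv (deriv (g : ℝ → ℝ))
  fun_prop

theorem memLp_neumann {μ : Measure ℝ} [IsFiniteMeasure μ] (g : neumannTestSpace) :
    MemLp (g : ℝ → ℝ) 2 μ := by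
  obtain ⟨K, hK⟩ := g.2.2.1.exists_bound_of_continuous g.2.1.continuous
  exact MemLp.of_bound g.2.1.continuous.aestronglyMeasurable K (Eventually.of_forall hK)

theorem memLp_radialGenerator {μ : Measure ℝ} [IsFiniteMeasure μ] (g : neumannTestSpace) :
    MemLp (radialGenerator n β g) 2 μ := by
  obtain ⟨K, hK⟩ := exists_bound_radialGenerator (n := n) (β := β) g
  exact MemLp.of_bound (measurable_radialGenerator g).aestronglyMeasurable K
    (Eventually.of_forall hK)

/-- The divergence form ρ L g = (r^{n−1} (1 + r²)^{1−β} g')', tested against k. -/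
theorem hasDerivAt_radial_flux (hn : 2 ≤ n) (g k : neumannTestSpace) {r : ℝ} (hr : 0 < r) :
    HasDerivAt (fun r => r ^ (n - 1) * (1 + r ^ 2) ^ (1 - β) * deriv (g : ℝ → ℝ) r
        * (k : ℝ → ℝ) r)
      (radialGenerator n β g r * (k : ℝ → ℝ) r * radialDensity n β r +
        (1 + r ^ 2) * deriv (g : ℝ → ℝ) r * deriv (k : ℝ → ℝ) r * radialDensity n β r) r := by
  have hg1 : ContDiff ℝ ∞ (deriv (g : ℝ → ℝ)) := (contDiff_infty_iff_deriv.1 g.2.1).2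
  have h1 := ((hg1.differentiable (by simp)) r).hasDerivAt
  have h2 := ((k.2.1.differentiable (by simp)) r).hasDerivAt
  have h := (((hasDerivAt_pow (n - 1) r).mul (hasDerivAt_one_add_sq_rpow (1 - β) r)).mul h1).mul h2
  convert! h using 1
  have hv : (1 + r ^ 2 : ℝ) ≠ 0 := by positivity
  rw [radialGenerator_apply, radialDensity]
  simp only [Pi.mul_apply]
  rw [show (1 - β - 1) = -β by ring, show (1 - β) = -β + 1 by ring, Real.rpow_add_one hv,
    show r ^ (n - 1) = r ^ (n - 1 - 1) * r by rw [← pow_succ]; congr 1; omega,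
    Nat.cast_sub (by omega)]
  field_simp
  push_cast
  ring

theorem radial_integration_by_parts (hn : 2 ≤ n) (hβ : (n : ℝ) / 2 < β) (g k : neumannTestSpace) :
    ∫ r, -(radialGenerator n β g) r * (k : ℝ → ℝ) r ∂(radialMeasure n β) =
      ∫ r, (1 + r ^ 2) * deriv (g : ℝ → ℝ) r * deriv (k : ℝ → ℝ) r ∂(radialMeasure n β) := by
  have hn1 : 1 ≤ n := by omega
  have := isProbabilityMeasure_radialMeasure hn1 hβ
  have hg1 : ContDiff ℝ ∞ (deriv (g : ℝ → ℝ)) := (contDiff_infty_iff_deriv.1 g.2.1).2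
  have hk1 : ContDiff ℝ ∞ (deriv (k : ℝ → ℝ)) := (contDiff_infty_iff_deriv.1 k.2.1).2
  have i1 : Integrable (fun r => radialGenerator n β g r * (k : ℝ → ℝ) r) (radialMeasure n β) :=
    (memLp_radialGenerator g).integrable_mul (memLp_neumann k)
  have i2 : Integrable (fun r => (1 + r ^ 2) * deriv (g : ℝ → ℝ) r * deriv (k : ℝ → ℝ) r)
      (radialMeasure n β) := by
    have c1 := hg1.continuous
    have c2 := hk1.continuous
    obtain ⟨K, hK⟩ := exists_bound_mul_of_hasCompactSupport
      (by fun_prop : Continuous fun r : ℝ => (1 + r ^ 2) * deriv (g : ℝ → ℝ) r) c2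
      k.2.2.1.deriv
    exact Integrable.of_bound (by fun_prop) K (Eventually.of_forall hK)
  have j1 := (integrable_radialMeasure_iff hn1 hβ).1 i1
  have j2 := (integrable_radialMeasure_iff hn1 hβ).1 i2
  have hcont : Continuous (fun r => r ^ (n - 1) * (1 + r ^ 2) ^ (1 - β) * deriv (g : ℝ → ℝ) r
        * (k : ℝ → ℝ) r) := by
    have c1 := hg1.continuous
    have c2 := k.2.1.continuous
    have c3 : Continuous fun r : ℝ => (1 + r ^ 2) ^ (1 - β) :=
      (by fun_prop : Continuous fun r : ℝ => 1 + r ^ 2).rpow_const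
        fun r => Or.inl (by positivity)
    fun_prop
  have hlim : Tendsto (fun r => r ^ (n - 1) * (1 + r ^ 2) ^ (1 - β) * deriv (g : ℝ → ℝ) r
        * (k : ℝ → ℝ) r) atTop (𝓝 0) := by
    have hcs : HasCompactSupport (fun r => r ^ (n - 1) * (1 + r ^ 2) ^ (1 - β) *
        deriv (g : ℝ → ℝ) r * (k : ℝ → ℝ) r) :=
      k.2.2.1.mul_left (f := fun r => r ^ (n - 1) * (1 + r ^ 2) ^ (1 - β) * deriv (g : ℝ → ℝ) r)
    have := hcs.is_zero_at_infty
    exact this.mono_left atTop_le_cocompact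
  have h := integral_Ioi_of_hasDerivAt_of_tendsto hcont.continuousWithinAt
    (fun r hr => hasDerivAt_radial_flux (β := β) hn g k hr) (j1.add j2) hlim
  -- The boundary term at 0 disappears because n ≥ 2.
  have hz : (0 : ℝ) ^ (n - 1) = 0 := zero_pow (by omega)
  simp only [hz, zero_mul, sub_zero] at h
  have h' := integral_add j1 j2
  rw [integral_radialMeasure hn1 hβ, integral_radialMeasure hn1 hβ]
  congr 1
  simp only [neg_mul, integral_neg]
  linarith

theorem radial_dense (hn : 1 ≤ n) (hβ : (n : ℝ) / 2 < β) (w : Lp ℝ 2 (radialMeasure n β))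
    (hw : ∀ h : neumannTestSpace, ∫ r, w r * (h : ℝ → ℝ) r ∂(radialMeasure n β) = 0) : w = 0 := by
  have := isProbabilityMeasure_radialMeasure hn hβ
  have hi : Integrable w (radialMeasure n β) := (Lp.memLp w).integrable (by norm_num)
  have hj := (integrable_radialMeasure_iff hn hβ).1 hi
  have hae : ∀ᵐ r ∂volume, r ∈ Ioi (0 : ℝ) → w r * radialDensity n β r = 0 := by
    refine isOpen_Ioi.ae_eq_zero_of_integral_contDiff_smul_eq_zero hj.locallyIntegrableOn ?_
    intro g hg hgc hgs
    -- Test functions supported in (0, ∞) satisfy Neumann's condition automatically, and they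
    -- suffice for density.
    have h0 : deriv g 0 = 0 := by
      have : (0 : ℝ) ∉ tsupport g := fun h => lt_irrefl (0 : ℝ) (hgs h)
      have e : g =ᶠ[𝓝 0] 0 := notMem_tsupport_iff_eventuallyEq.1 this
      rw [e.deriv_eq]; simp
    have h1 := hw ⟨g, hg, hgc, h0⟩
    rw [integral_radialMeasure hn hβ, div_eq_zero_iff] at h1
    replace h1 := h1.resolve_right (integral_radialDensity_pos hn hβ).ne'
    rw [← setIntegral_eq_integral_of_forall_compl_eq_zero (s := Ioi (0 : ℝ))]
    · refine Eq.trans (integral_congr_ae (Eventually.of_forall fun r => ?_)) h1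
      simp only [smul_eq_mul]; ring
    · intro r hr
      have : g r = 0 := by
        by_contra h
        exact hr (hgs (subset_tsupport _ h))
      simp [this]
  rw [Lp.eq_zero_iff_ae_eq_zero]
  refine ae_normalizedDensity_of_ae ?_
  rw [ae_restrict_iff' measurableSet_Ioi]
  filter_upwards [hae] with r hr h0
  exact (mul_eq_zero.1 (hr h0)).resolve_right (radialDensity_pos h0).ne'

theorem exists_radial_realization (hn : 2 ≤ n) (hβ : (n : ℝ) / 2 < β) (hβ1 : 1 ≤ β) {a : ℝ}
    (ha0 : 0 ≤ a) (ha1 : a ≤ 1) (hat : a ≤ β - n / 2) :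
    have := isProbabilityMeasure_radialMeasure (by omega) hβ
    ∃ A, IsSelfAdjointRealization (radialOp n β) A ∧ ∀ u : A.domain,
      4 * a * (β - n / 2 - a) *
        (‖(u : Lp ℝ 2 (radialMeasure n β))‖ ^ 2 - ⟪(u : Lp ℝ 2 (radialMeasure n β)), oneLp _⟫_ℝ ^ 2)
        ≤ ⟪(u : Lp ℝ 2 (radialMeasure n β)), A u⟫_ℝ := by
  intro _
  have hn1 : 1 ≤ n := by omega
  refine exists_realization_negOp (radialOp_graph n β) memLp_neumann memLp_radialGenerator
    (E := fun g k => ∫ r, (1 + r ^ 2) * deriv (g : ℝ → ℝ) r * deriv (k : ℝ → ℝ) r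
      ∂(radialMeasure n β)) (radial_integration_by_parts hn hβ) ?_ ?_ (radial_dense hn1 hβ) ?_
  · intro g k
    refine integral_congr_ae (Eventually.of_forall fun r => ?_)
    simp only; ring
  · intro g
    refine integral_nonneg fun r => ?_
    simp only [Pi.zero_apply]
    rw [mul_assoc, ← sq]
    positivity
  · intro g
    have h := radial_poincare hn1 hβ hβ1 ha0 ha1 hat (g.2.1.of_le (by exact_mod_cast le_top)) g.2.2.1
    have hZ := integral_radialDensity_pos hn1 hβ
    rw [integral_radialMeasure hn1 hβ, integral_radialMeasure hn1 hβ, integral_radialMeasure hn1 hβ,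
      le_div_iff₀ hZ]
    refine le_of_eq_of_le ?_ (h.trans_eq ?_)
    · field_simp
    · refine integral_congr_ae (Eventually.of_forall fun r => ?_)
      simp only; ring

end RadialOperator

/-! ### Truncated powers -/

section Cutoff

/-- A smooth compactly supported function equal to `1` on `[-1, 1]`. -/
def cutoff : ContDiffBump (0 : ℝ) := ⟨1, 2, one_pos, one_lt_two⟩

theorem contDiff_cutoff : ContDiff ℝ ∞ cutoff := cutoff.contDiff

theorem cutoff_eq_one {u : ℝ} (hu : |u| ≤ 1) : cutoff u = 1 :=
  cutoff.one_of_mem_closedBall (by simpa [cutoff] using hu)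

theorem deriv_cutoff_eq_zero {u : ℝ} (hu : |u| < 1) :
    deriv cutoff u = 0 ∧ deriv (deriv cutoff) u = 0 := by
  have h : (cutoff : ℝ → ℝ) =ᶠ[𝓝 u] fun _ => 1 := by
    filter_upwards [continuous_abs.continuousAt.eventually_lt_const hu] with v hv
      using cutoff_eq_one hv.le
  have h1 : deriv cutoff =ᶠ[𝓝 u] fun _ => 0 := by simpa using h.deriv
  exact ⟨h1.self_of_nhds, by simpa using h1.deriv_eq⟩

theorem contDiff_deriv_cutoff : ContDiff ℝ ∞ (deriv cutoff) :=
  (contDiff_infty_iff_deriv.1 contDiff_cutoff).2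

theorem contDiff_deriv_deriv_cutoff : ContDiff ℝ ∞ (deriv (deriv cutoff)) :=
  (contDiff_infty_iff_deriv.1 contDiff_deriv_cutoff).2

/-- On the support of χ'(s/R) and χ''(s/R), 1 + s is at most a constant times R. Each derivative of
the cutoff thus costs a factor 1/(1 + s), uniformly in R ≥ 1, exactly as for a power of 1 + s. -/
theorem exists_bound_deriv_cutoff :
    ∃ K : ℝ, 0 ≤ K ∧ ∀ R s : ℝ, 1 ≤ R → 0 ≤ s → (1 + s) * |deriv cutoff (s / R) / R| ≤ K ∧
      (1 + s) ^ 2 * |deriv (deriv cutoff) (s / R) / R ^ 2| ≤ K := by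
  obtain ⟨K1, h1⟩ := exists_bound_mul_of_hasCompactSupport
    (by fun_prop : Continuous fun u : ℝ => 1 + |u|) contDiff_deriv_cutoff.continuous
    cutoff.hasCompactSupport.deriv
  obtain ⟨K2, h2⟩ := exists_bound_mul_of_hasCompactSupport
    (by fun_prop : Continuous fun u : ℝ => (1 + |u|) ^ 2) contDiff_deriv_deriv_cutoff.continuous
    cutoff.hasCompactSupport.deriv.deriv
  have h10 : 0 ≤ K1 := (abs_nonneg _).trans (h1 0)
  have h20 : 0 ≤ K2 := (abs_nonneg _).trans (h2 0)
  refine ⟨K1 + K2, by positivity, fun R s hR hs => ?_⟩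
  have hR0 : 0 < R := by linarith
  have hle : (1 + s) / R ≤ 1 + |s / R| := by
    rw [abs_of_nonneg (by positivity), add_div]
    gcongr
    exact (div_le_one hR0).2 hR
  constructor
  · have := h1 (s / R)
    rw [abs_mul, abs_of_nonneg (by positivity)] at this
    calc (1 + s) * |deriv cutoff (s / R) / R| = (1 + s) / R * |deriv cutoff (s / R)| := by
          rw [abs_div, abs_of_pos hR0]; ring
      _ ≤ (1 + |s / R|) * |deriv cutoff (s / R)| := by gcongr
      _ ≤ K1 + K2 := by linarith
  · have := h2 (s / R)
    rw [abs_mul, abs_of_nonneg (by positivity)] at this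
    calc (1 + s) ^ 2 * |deriv (deriv cutoff) (s / R) / R ^ 2|
        = ((1 + s) / R) ^ 2 * |deriv (deriv cutoff) (s / R)| := by
          rw [abs_div, abs_of_pos (by positivity : 0 < R ^ 2)]; ring
      _ ≤ (1 + |s / R|) ^ 2 * |deriv (deriv cutoff) (s / R)| := by gcongr
      _ ≤ K1 + K2 := by linarith

/-- The truncated power `(1 + s)^a χ(s / R)` and its first two derivatives. -/
def truncPow (a R s : ℝ) : ℝ := (1 + s) ^ a * cutoff (s / R)

def truncPow' (a R s : ℝ) : ℝ :=
  a * (1 + s) ^ (a - 1) * cutoff (s / R) + (1 + s) ^ a * (deriv cutoff (s / R) / R)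

def truncPow'' (a R s : ℝ) : ℝ :=
  a * ((a - 1) * (1 + s) ^ (a - 1 - 1)) * cutoff (s / R) +
    2 * (a * (1 + s) ^ (a - 1)) * (deriv cutoff (s / R) / R) +
    (1 + s) ^ a * (deriv (deriv cutoff) (s / R) / R ^ 2)

variable {a R s : ℝ}

theorem hasDerivAt_one_add_rpow (a : ℝ) (hs : -1 < s) :
    HasDerivAt (fun s : ℝ => (1 + s) ^ a) (a * (1 + s) ^ (a - 1)) s := by
  have h := ((hasDerivAt_id s).const_add 1).rpow_const (p := a)
    (Or.inl (by simp only [id]; linarith))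
  convert! h using 1
  simp

theorem hasDerivAt_comp_div {f : ℝ → ℝ} (hf : ContDiff ℝ ∞ f) (R s : ℝ) :
    HasDerivAt (fun s => f (s / R)) (deriv f (s / R) / R) s := by
  have h := ((hf.differentiable (by simp)) (s / R)).hasDerivAt.comp s ((hasDerivAt_id s).div_const R)
  convert! h using 1
  simp [div_eq_mul_inv]

theorem hasDerivAt_truncPow (hs : -1 < s) :
    HasDerivAt (truncPow a R) (truncPow' a R s) s :=
  (hasDerivAt_one_add_rpow a hs).mul (hasDerivAt_comp_div contDiff_cutoff R s)

theorem hasDerivAt_truncPow' (hs : -1 < s) :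
    HasDerivAt (truncPow' a R) (truncPow'' a R s) s := by
  have h := (((hasDerivAt_one_add_rpow (a - 1) hs).const_mul a).mul
    (hasDerivAt_comp_div contDiff_cutoff R s)).add ((hasDerivAt_one_add_rpow a hs).mul
    ((hasDerivAt_comp_div contDiff_deriv_cutoff R s).div_const R))
  convert! h using 1
  rw [truncPow'']
  ring

theorem contDiffAt_truncPow (hs : -1 < s) : ContDiffAt ℝ ∞ (truncPow a R) s := by
  refine ContDiffAt.mul ?_ ?_
  · refine ContDiffAt.rpow_const_of_ne (by fun_prop) (by linarith)
  · exact (contDiff_cutoff.comp (contDiff_id.div_const R)).contDiffAt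

theorem truncPow_eq_zero (hR : 0 < R) (hs : 2 * R ≤ s) : truncPow a R s = 0 := by
  have : cutoff (s / R) = 0 := cutoff.zero_of_le_dist (by
    have : 2 ≤ s / R := by rw [le_div_iff₀ hR]; exact hs
    rw [dist_zero_right, Real.norm_eq_abs]
    exact this.trans (le_abs_self _))
  rw [truncPow, this, mul_zero]

theorem truncPow_eq (hs : 0 ≤ s) (hR : s < R) : truncPow a R s = (1 + s) ^ a ∧
    truncPow' a R s = a * (1 + s) ^ (a - 1) ∧
    truncPow'' a R s = a * ((a - 1) * (1 + s) ^ (a - 1 - 1)) := by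
  have h : |s / R| < 1 := by
    have hR0 : 0 < R := by linarith
    rw [abs_of_nonneg (by positivity), div_lt_one hR0]; exact hR
  obtain ⟨h1, h2⟩ := deriv_cutoff_eq_zero h
  simp [truncPow, truncPow', truncPow'', cutoff_eq_one h.le, h1, h2]

theorem abs_truncPow_le (hs : 0 ≤ s) : |truncPow a R s| ≤ (1 + s) ^ a := by
  rw [truncPow, abs_mul, abs_of_pos (by positivity : 0 < (1 + s) ^ a), abs_of_nonneg cutoff.nonneg]
  exact mul_le_of_le_one_right (by positivity) cutoff.le_one

theorem exists_bound_truncPow' (a : ℝ) : ∃ K : ℝ, 0 ≤ K ∧ ∀ R s : ℝ, 1 ≤ R → 0 ≤ s →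
    (1 + s) * |truncPow' a R s| ≤ K * (1 + s) ^ a ∧
      (1 + s) ^ 2 * |truncPow'' a R s| ≤ K * (1 + s) ^ a := by
  obtain ⟨K, hK0, hK⟩ := exists_bound_deriv_cutoff
  refine ⟨(|a| + K) + (|a * (a - 1)| + 2 * |a| * K + K), by positivity, fun R s hR hs => ?_⟩
  obtain ⟨h1, h2⟩ := hK R s hR hs
  have hv : 0 < 1 + s := by linarith
  have e1 : (1 + s) ^ (a - 1) = (1 + s) ^ a / (1 + s) := Real.rpow_sub_one hv.ne' a
  have e2 : (1 + s) ^ (a - 1 - 1) = (1 + s) ^ a / (1 + s) ^ 2 := by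
    rw [Real.rpow_sub_one hv.ne', e1]; field_simp
  have hP : 0 < (1 + s) ^ a := Real.rpow_pos_of_pos hv _
  set P := (1 + s) ^ a
  have hc0 : 0 ≤ cutoff (s / R) := cutoff.nonneg
  have hc1 : cutoff (s / R) ≤ 1 := cutoff.le_one
  have hc : |cutoff (s / R)| ≤ 1 := by rwa [abs_of_nonneg hc0]
  set X := cutoff (s / R)
  set Y := deriv cutoff (s / R) / R
  set Z := deriv (deriv cutoff) (s / R) / R ^ 2
  have hnn : 0 ≤ |a * (a - 1)| + 2 * |a| * K + K := by positivity
  have hnn' : 0 ≤ |a| + K := by positivity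
  constructor
  · rw [truncPow', e1]
    have : (1 + s) * |a * (P / (1 + s)) * X + P * Y| = |a * X * P + P * ((1 + s) * Y)| := by
      nth_rewrite 1 [← abs_of_pos hv]
      rw [← abs_mul]
      congr 1
      field_simp
    rw [this]
    calc |a * X * P + P * ((1 + s) * Y)| ≤ |a| * |X| * P + P * ((1 + s) * |Y|) := by
          refine (abs_add_le _ _).trans_eq ?_
          rw [abs_mul, abs_mul, abs_mul, abs_mul, abs_of_pos hP, abs_of_pos hv]
      _ ≤ |a| * 1 * P + P * K := by gcongr
      _ ≤ _ := by nlinarith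
  · rw [truncPow'', e1, e2]
    have : (1 + s) ^ 2 * |a * ((a - 1) * (P / (1 + s) ^ 2)) * X + 2 * (a * (P / (1 + s))) * Y + P * Z|
        = |a * (a - 1) * X * P + 2 * a * P * ((1 + s) * Y) + P * ((1 + s) ^ 2 * Z)| := by
      nth_rewrite 1 [← abs_of_pos (by positivity : 0 < (1 + s) ^ 2)]
      rw [← abs_mul]
      congr 1
      field_simp
    rw [this]
    calc _ ≤ |a * (a - 1)| * |X| * P + 2 * |a| * P * ((1 + s) * |Y|) + P * ((1 + s) ^ 2 * |Z|) := by
          refine (abs_add_three _ _ _).trans_eq ?_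
          simp only [abs_mul, abs_of_pos hP, abs_of_pos hv, abs_pow, abs_two]
      _ ≤ |a * (a - 1)| * 1 * P + 2 * |a| * P * K + P * K := by gcongr
      _ ≤ _ := by nlinarith

end Cutoff

/-! ### Closure of the graph -/

section Closure

variable {α : Type*} [MeasurableSpace α] {μ : Measure α}

/-- Dominated convergence for the graph of an operator. -/
theorem mem_closure_graph {C : Submodule ℝ (α → ℝ)} {L : C →ₗ[ℝ] (α → ℝ)}
    (hgr : (negOp μ C L).graph = negGraph μ C L)
    (hC : ∀ h : C, MemLp (h : α → ℝ) 2 μ) (hL : ∀ h : C, MemLp (L h) 2 μ)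
    (h : ℕ → C) {U W b : α → ℝ} (hb : MemLp b 2 μ)
    (hU : ∀ᵐ x ∂μ, ∀ᶠ k in atTop, (h k : α → ℝ) x = U x)
    (hW : ∀ᵐ x ∂μ, ∀ᶠ k in atTop, -(L (h k) x) = W x)
    (hbU : ∀ k, ∀ᵐ x ∂μ, |(h k : α → ℝ) x| ≤ b x) (hbW : ∀ k, ∀ᵐ x ∂μ, |L (h k) x| ≤ b x) :
    ∃ u w : Lp ℝ 2 μ, u =ᵐ[μ] U ∧ w =ᵐ[μ] W ∧ (u, w) ∈ closure ((negOp μ C L).graph : Set _) := by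
  have key : ∀ (f : ℕ → α → ℝ) (F : α → ℝ), (∀ k, MemLp (f k) 2 μ) →
      (∀ᵐ x ∂μ, ∀ᶠ k in atTop, f k x = F x) → (∀ k, ∀ᵐ x ∂μ, |f k x| ≤ b x) →
      ∃ u : Lp ℝ 2 μ, u =ᵐ[μ] F ∧ ∀ v : ℕ → Lp ℝ 2 μ, (∀ k, v k =ᵐ[μ] f k) →
        Tendsto v atTop (𝓝 u) := by
    intro f F hf hlim hbd
    have hlim' : ∀ᵐ x ∂μ, Tendsto (fun k => f k x) atTop (𝓝 (F x)) := by
      filter_upwards [hlim] with x hx using tendsto_const_nhds.congr' (hx.mono fun _ h => h.symm)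
    have hFm : AEStronglyMeasurable F μ :=
      aestronglyMeasurable_of_tendsto_ae atTop (fun k => (hf k).1) hlim'
    have hFb : ∀ᵐ x ∂μ, |F x| ≤ b x := by
      filter_upwards [hlim', ae_all_iff.2 hbd] with x hx hx2
      exact le_of_tendsto hx.abs (Eventually.of_forall hx2)
    have hF : MemLp F 2 μ := by
      refine hb.of_le hFm ?_
      filter_upwards [hFb] with x hx
      rw [Real.norm_eq_abs, Real.norm_eq_abs]
      exact hx.trans (le_abs_self _)
    refine ⟨hF.toLp F, hF.coeFn_toLp, fun v hv => ?_⟩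
    rw [tendsto_iff_norm_sub_tendsto_zero]
    -- Dominated convergence for the squared difference, with dominating function 4b² since both
    -- terms are bounded by b.
    have hsq : Tendsto (fun k => ‖v k - hF.toLp F‖ ^ 2) atTop (𝓝 0) := by
      have e : ∀ k, ‖v k - hF.toLp F‖ ^ 2 = ∫ x, (f k x - F x) ^ 2 ∂μ := fun k => by
        refine norm_sq_eq_integral ?_
        exact (Lp.coeFn_sub _ _).trans ((hv k).sub hF.coeFn_toLp)
      simp only [e]
      have := tendsto_integral_of_dominated_convergence (μ := μ)
        (F := fun k x => (f k x - F x) ^ 2) (f := fun _ => 0) (fun x => 4 * b x ^ 2)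
        (fun k => ((hf k).1.sub hFm).pow 2) (hb.integrable_sq.const_mul 4) ?_ ?_
      · simpa using this
      · intro k
        filter_upwards [hbd k, hFb] with x h1 h2
        rw [Real.norm_eq_abs, abs_pow]
        have h3 : |f k x - F x| ≤ 2 * b x := (abs_sub _ _).trans (by linarith)
        calc |f k x - F x| ^ 2 ≤ (2 * b x) ^ 2 := pow_le_pow_left₀ (abs_nonneg _) h3 2
          _ = _ := by ring
      · filter_upwards [hlim'] with x hx
        simpa using (hx.sub_const (F x)).pow 2
    have := hsq.sqrt
    simpa [Real.sqrt_sq (norm_nonneg _)] using this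
  obtain ⟨u, hu1, hu2⟩ := key (fun k => h k) U (fun k => hC _) hU hbU
  obtain ⟨w, hw1, hw2⟩ := key (fun k x => -(L (h k) x)) W (fun k => (hL _).neg) hW
    (by simpa only [abs_neg] using hbW)
  refine ⟨u, w, hu1, hw1, mem_closure_of_tendsto
    ((hu2 (fun k => (hC (h k)).toLp _) fun k => (hC (h k)).coeFn_toLp).prodMk_nhds
      (hw2 (fun k => (hL (h k)).neg.toLp _) fun k => (hL (h k)).neg.coeFn_toLp))
    (Eventually.of_forall fun k => ?_)⟩
  rw [hgr]
  exact ⟨h k, (hC (h k)).coeFn_toLp, (hL (h k)).neg.coeFn_toLp⟩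

end Closure

/-! ### Powers in the domain of the radial operator -/

section Profile

variable {n : ℕ} {β : ℝ}

/-- The generator acting on functions of `s = ‖x‖²` with first and second derivatives `G'`, `G''`. -/
def profileGenerator (n : ℕ) (β s G' G'' : ℝ) : ℝ :=
  4 * s * (1 + s) * G'' + (2 * n + 2 * (n + 2 - 2 * β) * s) * G'

/-- The coefficients of G'' and G' are O((1 + s)²) and O(1 + s), which compensates the decay gained
by differentiating. Images of truncated powers are therefore dominated by the power itself,
independently of R. K ≥ 1 lets the same bound serve for the truncated power too. -/
theorem exists_bound_profileGenerator (n : ℕ) (β a : ℝ) : ∃ K : ℝ, 1 ≤ K ∧ ∀ R s : ℝ, 1 ≤ R → 0 ≤ s →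
    |profileGenerator n β s (truncPow' a R s) (truncPow'' a R s)| ≤ K * (1 + s) ^ a := by
  obtain ⟨K, hK0, hK⟩ := exists_bound_truncPow' a
  refine ⟨4 * K + (2 * n + 2 * |n + 2 - 2 * β|) * K + 1, ?_, fun R s hR hs => ?_⟩
  · have : 0 ≤ 4 * K + (2 * n + 2 * |n + 2 - 2 * β|) * K := by positivity
    linarith
  obtain ⟨h1, h2⟩ := hK R s hR hs
  have hP : 0 < (1 + s) ^ a := Real.rpow_pos_of_pos (by linarith) _
  rw [profileGenerator]
  have e1 : |4 * s * (1 + s) * truncPow'' a R s| ≤ 4 * ((1 + s) ^ 2 * |truncPow'' a R s|) := by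
    rw [abs_mul, abs_of_nonneg (by positivity), ← mul_assoc]
    exact mul_le_mul_of_nonneg_right (by nlinarith) (abs_nonneg _)
  have e2 : |(2 * n + 2 * (n + 2 - 2 * β) * s) * truncPow' a R s| ≤
      (2 * n + 2 * |n + 2 - 2 * β|) * ((1 + s) * |truncPow' a R s|) := by
    rw [abs_mul, ← mul_assoc]
    gcongr
    refine (abs_add_le _ _).trans ?_
    rw [abs_mul, abs_mul, abs_mul, abs_two, abs_of_nonneg hs, Nat.abs_cast]
    have h3 : (0 : ℝ) ≤ n := by positivity
    have h4 := abs_nonneg (n + 2 - 2 * β)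
    nlinarith
  calc _ ≤ 4 * ((1 + s) ^ 2 * |truncPow'' a R s|) +
        (2 * n + 2 * |n + 2 - 2 * β|) * ((1 + s) * |truncPow' a R s|) :=
          (abs_add_le _ _).trans (add_le_add e1 e2)
    _ ≤ 4 * (K * (1 + s) ^ a) + (2 * n + 2 * |n + 2 - 2 * β|) * (K * (1 + s) ^ a) := by gcongr
    _ ≤ _ := by nlinarith

/-- The image of `(1 + s)^a` under the negative of the generator. -/
def powImage (n : ℕ) (β a s : ℝ) : ℝ :=
  4 * a * (β - n / 2 - a) * (1 + s) ^ a - 4 * a * (β - a) * (1 + s) ^ (a - 1)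

/-- Where the cutoff equals 1, the power is an eigenfunction up to a term one degree lower. For a =
1 that term is constant, hence correctable by a constant function. -/
theorem neg_profileGenerator_truncPow {a R s : ℝ} (hs : 0 ≤ s) (hR : s < R) :
    -profileGenerator n β s (truncPow' a R s) (truncPow'' a R s) = powImage n β a s := by
  obtain ⟨-, h1, h2⟩ := truncPow_eq (a := a) hs hR
  have hv : (1 + s) ≠ 0 := by positivity
  rw [profileGenerator, h1, h2, powImage, Real.rpow_sub_one hv (a - 1), Real.rpow_sub_one hv]
  field_simp
  ring

/-- Squaring the power amounts to replacing β by β − 2a in the density, whence the threshold. -/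
theorem memLp_pow_radialMeasure (hn : 1 ≤ n) (hβ : (n : ℝ) / 2 < β) {a : ℝ}
    (ha : 2 * a < β - n / 2) : MemLp (fun r : ℝ => (1 + r ^ 2) ^ a) 2 (radialMeasure n β) := by
  have hc : Continuous fun r : ℝ => (1 + r ^ 2) ^ a :=
    (by fun_prop : Continuous fun r : ℝ => 1 + r ^ 2).rpow_const fun r => Or.inl (by positivity)
  rw [memLp_two_iff_integrable_sq hc.aestronglyMeasurable, integrable_radialMeasure_iff hn hβ]
  have h := integrableOn_radialDensity hn (β := β - 2 * a) (by linarith)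
  refine h.congr_fun (fun r _ => ?_) measurableSet_Ioi
  simp only [radialDensity]
  have hv : 0 < 1 + r ^ 2 := by positivity
  rw [← Real.rpow_natCast ((1 + r ^ 2) ^ a) 2, ← Real.rpow_mul hv.le, mul_left_comm,
    ← Real.rpow_add hv]
  congr 2
  push_cast
  ring

/-- The truncated power as a Neumann test function of `r`. -/
def radialTrunc (a R : ℝ) (hR : 0 < R) : neumannTestSpace :=
  ⟨fun r => truncPow a R (r ^ 2), by
    refine ⟨contDiff_iff_contDiffAt.2 fun r => ?_, ?_, ?_⟩
    · exact (contDiffAt_truncPow (by nlinarith [sq_nonneg r])).comp r (contDiff_id.pow 2).contDiffAt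
    · refine HasCompactSupport.intro (isCompact_Icc (a := -(2 * R + 1)) (b := 2 * R + 1))
        fun r hr => truncPow_eq_zero hR ?_
      by_contra h
      refine hr ⟨?_, ?_⟩ <;> nlinarith
    · have h := (hasDerivAt_truncPow (a := a) (R := R) (s := (0 : ℝ) ^ 2) (by norm_num)).comp 0
        (hasDerivAt_pow 2 (0 : ℝ))
      have e := h.deriv
      simp only [Function.comp_def] at e
      rw [e]; simp⟩

theorem radialGenerator_radialTrunc {a R r : ℝ} (hR : 0 < R) (hr : 0 < r) :
    radialGenerator n β (radialTrunc a R hR) r =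
      profileGenerator n β (r ^ 2) (truncPow' a R (r ^ 2)) (truncPow'' a R (r ^ 2)) := by
  have hneg : ∀ r : ℝ, -1 < r ^ 2 := fun r => by nlinarith [sq_nonneg r]
  have h1 : deriv (radialTrunc a R hR : ℝ → ℝ) = fun r => truncPow' a R (r ^ 2) * (2 * r) := by
    funext r
    have h := HasDerivAt.comp (h := fun x : ℝ => x ^ 2) r
      (hasDerivAt_truncPow (a := a) (R := R) (hneg r)) (hasDerivAt_pow 2 r)
    have e := h.deriv
    simp only [Function.comp_def] at e
    refine e.trans ?_
    norm_num
  have h2 : deriv (deriv (radialTrunc a R hR : ℝ → ℝ)) r =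
      truncPow'' a R (r ^ 2) * (2 * r) * (2 * r) + truncPow' a R (r ^ 2) * 2 := by
    rw [h1]
    have h := (HasDerivAt.comp (h := fun x : ℝ => x ^ 2) r
      (hasDerivAt_truncPow' (a := a) (R := R) (hneg r)) (hasDerivAt_pow 2 r)).mul ((hasDerivAt_id r).const_mul 2)
    refine Eq.trans (HasDerivAt.deriv h) ?_
    simp
  rw [radialGenerator_apply, h2, h1, profileGenerator]
  field_simp
  ring

theorem radial_pow_mem_closure (hn : 1 ≤ n) (hβ : (n : ℝ) / 2 < β) {a : ℝ}
    (ha : 2 * a < β - n / 2) :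
    ∃ u w : Lp ℝ 2 (radialMeasure n β), u =ᵐ[radialMeasure n β] (fun r => (1 + r ^ 2) ^ a) ∧
      w =ᵐ[radialMeasure n β] (fun r => powImage n β a (r ^ 2)) ∧
      (u, w) ∈ closure ((radialOp n β).graph : Set _) := by
  have := isProbabilityMeasure_radialMeasure hn hβ
  obtain ⟨K, hK1, hK⟩ := exists_bound_profileGenerator n β a
  refine mem_closure_graph (radialOp_graph n β) memLp_neumann memLp_radialGenerator
    (fun k : ℕ => radialTrunc a (k + 1) (by positivity))
    ((memLp_pow_radialMeasure hn hβ ha).const_mul K) ?_ ?_ (fun k => ?_) (fun k => ?_)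
  · refine Eventually.of_forall fun r => ?_
    obtain ⟨N, hN⟩ := exists_nat_gt (r ^ 2)
    filter_upwards [eventually_ge_atTop N] with k hk
    have : (N : ℝ) ≤ k := by exact_mod_cast hk
    exact (truncPow_eq (sq_nonneg r) (by linarith)).1
  · filter_upwards [ae_radialMeasure_pos n β] with r hr
    obtain ⟨N, hN⟩ := exists_nat_gt (r ^ 2)
    filter_upwards [eventually_ge_atTop N] with k hk
    have : (N : ℝ) ≤ k := by exact_mod_cast hk
    rw [radialGenerator_radialTrunc _ hr]
    exact neg_profileGenerator_truncPow (sq_nonneg r) (by linarith)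
  · refine Eventually.of_forall fun r => ?_
    refine (abs_truncPow_le (sq_nonneg r)).trans ?_
    exact le_mul_of_one_le_left (by positivity) hK1
  · filter_upwards [ae_radialMeasure_pos n β] with r hr
    rw [radialGenerator_radialTrunc _ hr]
    exact hK _ _ (by linarith [(k.cast_nonneg : (0 : ℝ) ≤ k)]) (sq_nonneg r)

end Profile

/-! ### Calculus for the weighted generator -/

section CauchyCalculus

variable {n : ℕ} {β : ℝ}

local notation "𝔼" => EuclideanSpace ℝ (Fin n)
local notation "𝕖" => EuclideanSpace.basisFun (Fin n) ℝ

theorem inner_gradient_left (f : 𝔼 → ℝ) (x v : 𝔼) : ⟪gradient f x, v⟫_ℝ = fderiv ℝ f x v := by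
  rw [gradient, InnerProductSpace.toDual_symm_apply]

theorem inner_gradient_gradient (f g : 𝔼 → ℝ) (x : 𝔼) :
    ⟪gradient f x, gradient g x⟫_ℝ = ∑ i, fderiv ℝ f x (𝕖 i) * fderiv ℝ g x (𝕖 i) := by
  rw [← (EuclideanSpace.basisFun (Fin n) ℝ).sum_inner_mul_inner]
  refine Finset.sum_congr rfl fun i _ => ?_
  rw [inner_gradient_left, real_inner_comm, inner_gradient_left]

theorem laplacian_eq_sum_fderiv {f : 𝔼 → ℝ} (hf : ContDiff ℝ 2 f) (x : 𝔼) :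
    Δ f x = ∑ i, fderiv ℝ (fun y => fderiv ℝ f y (𝕖 i)) x (𝕖 i) := by
  rw [InnerProductSpace.laplacian_eq_iteratedFDeriv_orthonormalBasis f
    (EuclideanSpace.basisFun (Fin n) ℝ)]
  refine Finset.sum_congr rfl fun i _ => ?_
  have hd : DifferentiableAt ℝ (fderiv ℝ f) x :=
    ((hf.fderiv_right (m := 1) (by norm_num)).differentiable one_ne_zero) x
  rw [iteratedFDeriv_two_apply, fderiv_clm_apply hd (differentiableAt_const _)]
  simp

theorem hasFDerivAt_comp_norm_sq {G : ℝ → ℝ} {g' : ℝ} {x : 𝔼} (hG : HasDerivAt G g' (‖x‖ ^ 2)) :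
    HasFDerivAt (fun y : 𝔼 => G (‖y‖ ^ 2)) ((2 * g') • innerSL ℝ x) x := by
  have h := hG.comp_hasFDerivAt x (hasStrictFDerivAt_norm_sq x).hasFDerivAt
  convert! h using 1
  ext v
  simp
  ring

theorem hasFDerivAt_affine_mul_comp_norm_sq {G : ℝ → ℝ} {g' b : ℝ} {p x : 𝔼}
    (hG : HasDerivAt G g' (‖x‖ ^ 2)) :
    HasFDerivAt (fun y : 𝔼 => (b + ⟪p, y⟫_ℝ) * G (‖y‖ ^ 2))
      ((b + ⟪p, x⟫_ℝ) • (2 * g') • innerSL ℝ x + G (‖x‖ ^ 2) • innerSL ℝ p) x :=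
  (((innerSL ℝ p).hasFDerivAt).const_add b).mul (hasFDerivAt_comp_norm_sq hG)

theorem inner_eq_sum_coord (x y : 𝔼) : ⟪x, y⟫_ℝ = ∑ i, ⟪x, 𝕖 i⟫_ℝ * ⟪y, 𝕖 i⟫_ℝ := by
  rw [← (EuclideanSpace.basisFun (Fin n) ℝ).sum_inner_mul_inner]
  refine Finset.sum_congr rfl fun i _ => ?_
  rw [real_inner_comm y]

/-- The generator on an affine function times a radial profile. -/
theorem cauchyGenerator_affine_mul {G G' : ℝ → ℝ} {g'' b : ℝ} {p x : 𝔼} (h : testSpace n)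
    (hh : (h : 𝔼 → ℝ) = fun y => (b + ⟪p, y⟫_ℝ) * G (‖y‖ ^ 2))
    (hG : ∀ s, 0 ≤ s → HasDerivAt G (G' s) s) (hG' : HasDerivAt G' g'' (‖x‖ ^ 2)) :
    cauchyGenerator n β h x =
      (b + ⟪p, x⟫_ℝ) * profileGenerator n β (‖x‖ ^ 2) (G' (‖x‖ ^ 2)) g'' +
        ⟪p, x⟫_ℝ * (4 * (1 + ‖x‖ ^ 2) * G' (‖x‖ ^ 2) + 2 * (1 - β) * G (‖x‖ ^ 2)) := by
  have h2 : ContDiff ℝ 2 (h : 𝔼 → ℝ) := contDiff_infty.1 h.2.1 2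
  have hd : ∀ y, HasFDerivAt (h : 𝔼 → ℝ)
      ((b + ⟪p, y⟫_ℝ) • (2 * G' (‖y‖ ^ 2)) • innerSL ℝ y + G (‖y‖ ^ 2) • innerSL ℝ p) y := fun y => by
    rw [hh]; exact hasFDerivAt_affine_mul_comp_norm_sq (hG _ (sq_nonneg _))
  have hlap : Δ (h : 𝔼 → ℝ) x = 4 * ⟪p, x⟫_ℝ * G' (‖x‖ ^ 2) +
      (b + ⟪p, x⟫_ℝ) * (2 * n * G' (‖x‖ ^ 2) + 4 * ‖x‖ ^ 2 * g'') := by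
    rw [laplacian_eq_sum_fderiv h2]
    have hi : ∀ i, fderiv ℝ (fun y => fderiv ℝ (h : 𝔼 → ℝ) y (𝕖 i)) x (𝕖 i) =
        4 * G' (‖x‖ ^ 2) * (⟪p, 𝕖 i⟫_ℝ * ⟪x, 𝕖 i⟫_ℝ) +
        4 * (b + ⟪p, x⟫_ℝ) * g'' * (⟪x, 𝕖 i⟫_ℝ * ⟪x, 𝕖 i⟫_ℝ) +
        2 * (b + ⟪p, x⟫_ℝ) * G' (‖x‖ ^ 2) := fun i => by
      have e : (fun y => fderiv ℝ (h : 𝔼 → ℝ) y (𝕖 i)) = fun y =>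
          2 * (((b + ⟪p, y⟫_ℝ) * G' (‖y‖ ^ 2)) * ⟪𝕖 i, y⟫_ℝ) + ⟪p, 𝕖 i⟫_ℝ * G (‖y‖ ^ 2) := by
        funext y
        rw [(hd y).fderiv, real_inner_comm y (𝕖 i)]
        simp only [add_apply, smul_apply, innerSL_apply_apply,
          smul_eq_mul]
        ring
      have k := ((((hasFDerivAt_affine_mul_comp_norm_sq (b := b) (p := p) hG').mul
        (innerSL ℝ (𝕖 i)).hasFDerivAt)).const_mul 2).add
        ((hasFDerivAt_comp_norm_sq (hG _ (sq_nonneg ‖x‖))).const_mul ⟪p, 𝕖 i⟫_ℝ)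
      rw [e]
      refine (congrArg (fun T : 𝔼 →L[ℝ] ℝ => T (𝕖 i)) (HasFDerivAt.fderiv k)).trans ?_
      have hone : ⟪𝕖 i, 𝕖 i⟫_ℝ = 1 := by
        rw [real_inner_self_eq_norm_sq, (EuclideanSpace.basisFun (Fin n) ℝ).norm_eq_one]; norm_num
      simp only [add_apply, smul_apply, innerSL_apply_apply,
          smul_eq_mul, hone, real_inner_comm x (𝕖 i)]
      ring
    simp only [hi]
    rw [Finset.sum_add_distrib, Finset.sum_add_distrib, ← Finset.mul_sum, ← Finset.mul_sum,
      ← inner_eq_sum_coord, ← inner_eq_sum_coord, real_inner_self_eq_norm_sq]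
    simp only [Finset.sum_const, Finset.card_univ, Fintype.card_fin, nsmul_eq_mul]
    ring
  have hgrad : ⟪x, gradient (h : 𝔼 → ℝ) x⟫_ℝ =
      (b + ⟪p, x⟫_ℝ) * (2 * G' (‖x‖ ^ 2)) * ‖x‖ ^ 2 + G (‖x‖ ^ 2) * ⟪p, x⟫_ℝ := by
    rw [real_inner_comm, inner_gradient_left, (hd x).fderiv]
    simp only [add_apply, smul_apply, innerSL_apply_apply,
      smul_eq_mul, real_inner_self_eq_norm_sq]
    ring
  change (1 + ‖x‖ ^ 2) * Δ (h : 𝔼 → ℝ) x + 2 * (1 - β) * ⟪x, gradient (h : 𝔼 → ℝ) x⟫_ℝ = _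
  rw [hlap, hgrad, profileGenerator]
  ring

/-- The truncation `(b + ⟪p, x⟫) (1 + ‖x‖²)^a χ(‖x‖² / R)` as a test function. -/
def affineTrunc (b : ℝ) (p : 𝔼) (a R : ℝ) (hR : 0 < R) : testSpace n :=
  ⟨fun x => (b + ⟪p, x⟫_ℝ) * truncPow a R (‖x‖ ^ 2), by
    refine ⟨contDiff_iff_contDiffAt.2 fun x => ?_, ?_⟩
    · refine ContDiffAt.mul (contDiffAt_const.add (innerSL ℝ p).contDiff.contDiffAt) ?_
      exact ContDiffAt.comp x (contDiffAt_truncPow (by nlinarith [sq_nonneg ‖x‖]))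
        (contDiff_norm_sq ℝ).contDiffAt
    · refine HasCompactSupport.intro (isCompact_closedBall (0 : 𝔼) (2 * R + 1)) fun x hx => ?_
      rw [Metric.mem_closedBall, dist_zero_right, not_le] at hx
      rw [truncPow_eq_zero hR (by nlinarith), mul_zero]⟩

theorem cauchyGenerator_affineTrunc (b : ℝ) (p x : 𝔼) {a R : ℝ} (hR : 0 < R) :
    cauchyGenerator n β (affineTrunc b p a R hR) x =
      (b + ⟪p, x⟫_ℝ) * profileGenerator n β (‖x‖ ^ 2) (truncPow' a R (‖x‖ ^ 2))
        (truncPow'' a R (‖x‖ ^ 2)) +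
      ⟪p, x⟫_ℝ * (4 * (1 + ‖x‖ ^ 2) * truncPow' a R (‖x‖ ^ 2) +
        2 * (1 - β) * truncPow a R (‖x‖ ^ 2)) :=
  cauchyGenerator_affine_mul _ rfl (fun s hs => hasDerivAt_truncPow (by linarith))
    (hasDerivAt_truncPow' (by nlinarith [sq_nonneg ‖x‖]))

theorem continuous_fderiv_apply {f : 𝔼 → ℝ} (hf : ContDiff ℝ ∞ f) (v : 𝔼) :
    ContDiff ℝ ∞ fun x => fderiv ℝ f x v :=
  (hf.fderiv_right (m := ∞) le_rfl).clm_apply contDiff_const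

theorem continuous_laplacian {f : 𝔼 → ℝ} (hf : ContDiff ℝ ∞ f) : Continuous (Δ f) := by
  have e : Δ f = fun x => ∑ i, fderiv ℝ (fun y => fderiv ℝ f y (𝕖 i)) x (𝕖 i) :=
    funext (laplacian_eq_sum_fderiv (contDiff_infty.1 hf 2))
  rw [e]
  exact continuous_finsetSum _ fun i _ =>
    (continuous_fderiv_apply (continuous_fderiv_apply hf (𝕖 i)) (𝕖 i)).continuous

theorem cauchyGenerator_apply (h : testSpace n) (x : 𝔼) :
    cauchyGenerator n β h x =
      (1 + ‖x‖ ^ 2) * Δ (h : 𝔼 → ℝ) x + 2 * (1 - β) * fderiv ℝ (h : 𝔼 → ℝ) x x := by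
  rw [← inner_gradient_left, real_inner_comm]
  rfl

theorem continuous_cauchyGenerator (h : testSpace n) : Continuous (cauchyGenerator n β h) := by
  have e : cauchyGenerator n β h = fun x =>
      (1 + ‖x‖ ^ 2) * Δ (h : 𝔼 → ℝ) x + 2 * (1 - β) * fderiv ℝ (h : 𝔼 → ℝ) x x :=
    funext (cauchyGenerator_apply h)
  rw [e]
  have h1 := continuous_laplacian h.2.1
  have h2 : Continuous fun x => fderiv ℝ (h : 𝔼 → ℝ) x x :=
    (h.2.1.continuous_fderiv (by simp)).clm_apply continuous_id
  fun_prop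

theorem hasCompactSupport_cauchyGenerator (h : testSpace n) :
    HasCompactSupport (cauchyGenerator n β h) := by
  refine h.2.2.mono' fun x hx => ?_
  by_contra hn
  refine hx ?_
  have e : (h : 𝔼 → ℝ) =ᶠ[𝓝 x] fun _ => 0 := notMem_tsupport_iff_eventuallyEq.1 hn
  rw [cauchyGenerator_apply, (InnerProductSpace.laplacian_congr_nhds e).self_of_nhds, e.fderiv_eq]
  simp

theorem memLp_of_continuous_hasCompactSupport {μ : Measure 𝔼} [IsFiniteMeasure μ] {f : 𝔼 → ℝ}
    (hf : Continuous f) (hc : HasCompactSupport f) : MemLp f 2 μ := by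
  obtain ⟨K, hK⟩ := hc.exists_bound_of_continuous hf
  exact MemLp.of_bound hf.aestronglyMeasurable K (Eventually.of_forall hK)

theorem memLp_testSpace {μ : Measure 𝔼} [IsFiniteMeasure μ] (h : testSpace n) :
    MemLp (h : 𝔼 → ℝ) 2 μ :=
  memLp_of_continuous_hasCompactSupport h.2.1.continuous h.2.2

theorem memLp_cauchyGenerator {μ : Measure 𝔼} [IsFiniteMeasure μ] (h : testSpace n) :
    MemLp (cauchyGenerator n β h) 2 μ :=
  memLp_of_continuous_hasCompactSupport (continuous_cauchyGenerator h)
    (hasCompactSupport_cauchyGenerator h)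

theorem hasFDerivAt_cauchyDensity (q : ℝ) (x : 𝔼) :
    HasFDerivAt (fun y : 𝔼 => (1 + ‖y‖ ^ 2) ^ q)
      ((2 * (q * (1 + ‖x‖ ^ 2) ^ (q - 1))) • innerSL ℝ x) x :=
  hasFDerivAt_comp_norm_sq (hasDerivAt_one_add_rpow q (by nlinarith [sq_nonneg ‖x‖]))

theorem cauchy_integration_by_parts (hβ : (n : ℝ) / 2 < β) (h k : testSpace n) :
    ∫ x, -(cauchyGenerator n β h x) * (k : 𝔼 → ℝ) x ∂(cauchyMeasure n β) =
      ∫ x, (1 + ‖x‖ ^ 2) * ⟪gradient (h : 𝔼 → ℝ) x, gradient (k : 𝔼 → ℝ) x⟫_ℝ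
        ∂(cauchyMeasure n β) := by
  have hdh : ∀ i, ContDiff ℝ ∞ fun x => fderiv ℝ (h : 𝔼 → ℝ) x (𝕖 i) := fun i =>
    continuous_fderiv_apply h.2.1 _
  have hdk : ∀ i, ContDiff ℝ ∞ fun x => fderiv ℝ (k : 𝔼 → ℝ) x (𝕖 i) := fun i =>
    continuous_fderiv_apply k.2.1 _
  -- The components of the flux (1 + ‖x‖²)^{1−β} ∇h, whose divergence is the density times the
  -- generator. `F' i` is the derivative of the i-th component in its own direction.
  let F : Fin n → 𝔼 → ℝ := fun i x => (1 + ‖x‖ ^ 2) ^ (1 - β) * fderiv ℝ (h : 𝔼 → ℝ) x (𝕖 i)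
  let F' : Fin n → 𝔼 → ℝ := fun i x => (1 + ‖x‖ ^ 2) ^ (1 - β) *
      fderiv ℝ (fun y => fderiv ℝ (h : 𝔼 → ℝ) y (𝕖 i)) x (𝕖 i) +
      fderiv ℝ (h : 𝔼 → ℝ) x (𝕖 i) * (2 * (1 - β) * (1 + ‖x‖ ^ 2) ^ (-β) * ⟪x, 𝕖 i⟫_ℝ)
  have hF : ∀ i x, HasFDerivAt (F i) ((1 + ‖x‖ ^ 2) ^ (1 - β) •
      fderiv ℝ (fun y => fderiv ℝ (h : 𝔼 → ℝ) y (𝕖 i)) x + fderiv ℝ (h : 𝔼 → ℝ) x (𝕖 i) •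
        ((2 * ((1 - β) * (1 + ‖x‖ ^ 2) ^ (1 - β - 1))) • innerSL ℝ x)) x := fun i x =>
    (hasFDerivAt_cauchyDensity (1 - β) x).mul ((hdh i).differentiable (by simp) x).hasFDerivAt
  have hF' : ∀ i x, fderiv ℝ (F i) x (𝕖 i) = F' i x := fun i x => by
    rw [(hF i x).fderiv]
    simp only [add_apply, smul_apply, innerSL_apply_apply,
      smul_eq_mul, F']
    rw [show 1 - β - 1 = -β by ring]
    ring
  have c1 := continuous_cauchyDensity n (1 - β)
  have c0 := continuous_cauchyDensity n (-β)
  have cF : ∀ i, Continuous (F i) := fun i => c1.mul (hdh i).continuous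
  have cF' : ∀ i, Continuous (F' i) := fun i => by
    have e1 := (hdh i).continuous
    have e2 := (continuous_fderiv_apply (hdh i) (𝕖 i)).continuous
    simp only [F']
    fun_prop
  have hint : ∀ f : 𝔼 → ℝ, Continuous f → Integrable (fun x => f x * (k : 𝔼 → ℝ) x) :=
    fun f hf => (hf.mul k.2.1.continuous).integrable_of_hasCompactSupport k.2.2.mul_left
  have hint' : ∀ i, Integrable (fun x => F i x * fderiv ℝ (k : 𝔼 → ℝ) x (𝕖 i)) := fun i =>
    ((cF i).mul (hdk i).continuous).integrable_of_hasCompactSupport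
      ((k.2.2.fderiv_apply (𝕜 := ℝ) (𝕖 i)).mul_left)
  have hibp : ∀ i, ∫ x, F i x * fderiv ℝ (k : 𝔼 → ℝ) x (𝕖 i) = -∫ x, F' i x * (k : 𝔼 → ℝ) x :=
    fun i => by
      have := integral_mul_fderiv_eq_neg_fderiv_mul_of_integrable (μ := (volume : Measure 𝔼))
        (f := F i) (g := (k : 𝔼 → ℝ)) (v := 𝕖 i) (by simpa only [hF'] using hint _ (cF' i))
        (hint' i) (hint _ (cF i)) (fun x _ => (hF i x).differentiableAt)
        (fun x _ => (k.2.1.differentiable (by simp)) x)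
      simpa only [hF'] using this
  rw [integral_cauchyMeasure hβ, integral_cauchyMeasure hβ]
  congr 1
  have e1 : ∀ x, -(cauchyGenerator n β h x) * (k : 𝔼 → ℝ) x * (1 + ‖x‖ ^ 2) ^ (-β) =
      ∑ i, -(F' i x * (k : 𝔼 → ℝ) x) := fun x => by
    have hv : (1 + ‖x‖ ^ 2 : ℝ) ≠ 0 := by positivity
    rw [Finset.sum_neg_distrib, ← Finset.sum_mul]
    simp only [F']
    rw [Finset.sum_add_distrib, ← Finset.mul_sum,
      ← laplacian_eq_sum_fderiv (contDiff_infty.1 h.2.1 2), cauchyGenerator_apply,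
      ← inner_gradient_left, inner_eq_sum_coord, show 1 - β = -β + 1 by ring,
      Real.rpow_add_one hv]
    have : ∑ i, fderiv ℝ (h : 𝔼 → ℝ) x (𝕖 i) *
          (2 * (-β + 1) * (1 + ‖x‖ ^ 2) ^ (-β) * ⟪x, 𝕖 i⟫_ℝ) = 2 * (-β + 1) * (1 + ‖x‖ ^ 2) ^ (-β) *
          ∑ i, ⟪gradient (h : 𝔼 → ℝ) x, 𝕖 i⟫_ℝ * ⟪x, 𝕖 i⟫_ℝ := by
      rw [Finset.mul_sum]
      refine Finset.sum_congr rfl fun i _ => ?_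
      rw [inner_gradient_left]; ring
    rw [this]
    ring
  have e2 : ∀ x, (1 + ‖x‖ ^ 2) * ⟪gradient (h : 𝔼 → ℝ) x, gradient (k : 𝔼 → ℝ) x⟫_ℝ *
      (1 + ‖x‖ ^ 2) ^ (-β) = ∑ i, F i x * fderiv ℝ (k : 𝔼 → ℝ) x (𝕖 i) := fun x => by
    have hv : (1 + ‖x‖ ^ 2 : ℝ) ≠ 0 := by positivity
    simp only [F]
    rw [inner_gradient_gradient, show 1 - β = -β + 1 by ring, Real.rpow_add_one hv, Finset.mul_sum,
      Finset.sum_mul]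
    refine Finset.sum_congr rfl fun i _ => ?_
    ring
  simp only [e1, e2]
  have hneg : ∀ i, Integrable fun x => -(F' i x * (k : 𝔼 → ℝ) x) := fun i => (hint _ (cF' i)).neg
  rw [integral_finsetSum _ fun i _ => hneg i, integral_finsetSum _ fun i _ => hint' i]
  refine Finset.sum_congr rfl fun i _ => ?_
  rw [hibp, integral_neg]

theorem cauchy_dense (hβ : (n : ℝ) / 2 < β) (w : Lp ℝ 2 (cauchyMeasure n β))
    (hw : ∀ h : testSpace n, ∫ x, w x * (h : 𝔼 → ℝ) x ∂(cauchyMeasure n β) = 0) : w = 0 := by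
  have := isProbabilityMeasure_cauchyMeasure hβ
  have hi : Integrable w (cauchyMeasure n β) := (Lp.memLp w).integrable (by norm_num)
  have hj := (integrable_cauchyMeasure_iff hβ).1 hi
  have hae : ∀ᵐ x ∂(volume : Measure 𝔼), w x * (1 + ‖x‖ ^ 2) ^ (-β) = 0 := by
    refine ae_eq_zero_of_integral_contDiff_smul_eq_zero hj.locallyIntegrable ?_
    intro g hg hgc
    have h1 := hw ⟨g, hg, hgc⟩
    rw [integral_cauchyMeasure hβ, div_eq_zero_iff] at h1
    replace h1 := h1.resolve_right (integral_cauchyDensity_pos hβ).ne'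
    refine Eq.trans (integral_congr_ae (Eventually.of_forall fun r => ?_)) h1
    simp only [smul_eq_mul]; ring
  rw [Lp.eq_zero_iff_ae_eq_zero]
  refine ae_normalizedDensity_of_ae ?_
  filter_upwards [hae] with x hx
  exact (mul_eq_zero.1 hx).resolve_right (by positivity)

theorem exists_cauchy_realization (hβ : (n : ℝ) / 2 < β) {l : ℝ}
    (hl : ∀ h : testSpace n, l * (∫ x, (h : 𝔼 → ℝ) x ^ 2 ∂(cauchyMeasure n β) -
      (∫ x, (h : 𝔼 → ℝ) x ∂(cauchyMeasure n β)) ^ 2) ≤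
      ∫ x, (1 + ‖x‖ ^ 2) * ‖gradient (h : 𝔼 → ℝ) x‖ ^ 2 ∂(cauchyMeasure n β)) :
    have := isProbabilityMeasure_cauchyMeasure hβ
    ∃ A, IsSelfAdjointRealization (cauchyOp n β) A ∧ ∀ u : A.domain,
      l * (‖(u : Lp ℝ 2 (cauchyMeasure n β))‖ ^ 2 -
        ⟪(u : Lp ℝ 2 (cauchyMeasure n β)), oneLp _⟫_ℝ ^ 2)
        ≤ ⟪(u : Lp ℝ 2 (cauchyMeasure n β)), A u⟫_ℝ := by
  intro _
  refine exists_realization_negOp (cauchyOp_graph n β) memLp_testSpace memLp_cauchyGenerator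
    (E := fun h k => ∫ x, (1 + ‖x‖ ^ 2) * ⟪gradient (h : 𝔼 → ℝ) x, gradient (k : 𝔼 → ℝ) x⟫_ℝ
        ∂(cauchyMeasure n β)) (cauchy_integration_by_parts hβ) ?_ ?_ (cauchy_dense hβ) ?_
  · intro h k
    simp only [real_inner_comm]
  · intro h
    refine integral_nonneg fun x => ?_
    simp only [Pi.zero_apply, real_inner_self_eq_norm_sq]
    positivity
  · intro h
    simpa only [real_inner_self_eq_norm_sq] using hl h

end CauchyCalculus

/-! ### Powers and linear functions in the domain of the weighted operator -/

section CauchyClosure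

variable {n : ℕ} {β : ℝ}

local notation "𝔼" => EuclideanSpace ℝ (Fin n)

theorem cauchy_pow_mem_closure (hn : 1 ≤ n) (hβ : (n : ℝ) / 2 < β) {a : ℝ}
    (ha : 2 * a < β - n / 2) :
    ∃ u w : Lp ℝ 2 (cauchyMeasure n β), u =ᵐ[cauchyMeasure n β] (fun x => (1 + ‖x‖ ^ 2) ^ a) ∧
      w =ᵐ[cauchyMeasure n β] (fun x => powImage n β a (‖x‖ ^ 2)) ∧
      (u, w) ∈ closure ((cauchyOp n β).graph : Set _) := by
  have := isProbabilityMeasure_cauchyMeasure hβ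
  obtain ⟨K, hK1, hK⟩ := exists_bound_profileGenerator n β a
  have hgen : ∀ (k : ℕ) (x : 𝔼), cauchyGenerator n β
      (affineTrunc 1 (0 : 𝔼) a (k + 1) (by positivity)) x = profileGenerator n β (‖x‖ ^ 2)
        (truncPow' a (k + 1) (‖x‖ ^ 2)) (truncPow'' a (k + 1) (‖x‖ ^ 2)) := fun k x => by
    rw [cauchyGenerator_affineTrunc]; simp
  have hval : ∀ (k : ℕ) (x : 𝔼), (affineTrunc 1 (0 : 𝔼) a ((k : ℝ) + 1) (by positivity) : 𝔼 → ℝ) x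
      = truncPow a (k + 1) (‖x‖ ^ 2) := fun k x => by
    change (1 + ⟪(0 : 𝔼), x⟫_ℝ) * truncPow a (k + 1) (‖x‖ ^ 2) = _
    simp
  have hmem : MemLp (fun x : 𝔼 => (1 + ‖x‖ ^ 2) ^ a) 2 (cauchyMeasure n β) :=
    (memLp_pow_radialMeasure hn hβ ha).comp_measurePreserving (measurePreserving_norm hn hβ)
  refine mem_closure_graph (cauchyOp_graph n β) memLp_testSpace memLp_cauchyGenerator
    (fun k : ℕ => affineTrunc 1 (0 : 𝔼) a (k + 1) (by positivity))
    (hmem.const_mul K) ?_ ?_ (fun k => ?_) (fun k => ?_)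
  · refine Eventually.of_forall fun x => ?_
    obtain ⟨N, hN⟩ := exists_nat_gt (‖x‖ ^ 2)
    filter_upwards [eventually_ge_atTop N] with k hk
    have : (N : ℝ) ≤ k := by exact_mod_cast hk
    rw [hval]
    exact (truncPow_eq (sq_nonneg _) (by linarith)).1
  · refine Eventually.of_forall fun x => ?_
    obtain ⟨N, hN⟩ := exists_nat_gt (‖x‖ ^ 2)
    filter_upwards [eventually_ge_atTop N] with k hk
    have : (N : ℝ) ≤ k := by exact_mod_cast hk
    rw [hgen]
    exact neg_profileGenerator_truncPow (sq_nonneg _) (by linarith)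
  · refine Eventually.of_forall fun x => ?_
    rw [hval]
    refine (abs_truncPow_le (sq_nonneg _)).trans ?_
    exact le_mul_of_one_le_left (by positivity) hK1
  · refine Eventually.of_forall fun x => ?_
    rw [hgen]
    exact hK _ _ (by linarith [(k.cast_nonneg : (0 : ℝ) ≤ k)]) (sq_nonneg _)

/-- The Laplacian kills a linear function and the drift multiplies it by 2(1 − β). Linear growth is
dominated by the power a = 1/2, which is square integrable when β > n/2 + 1. -/
theorem cauchy_linear_mem_closure (hn : 1 ≤ n) (hβ : (n : ℝ) / 2 + 1 < β) (p : 𝔼) :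
    ∃ u w : Lp ℝ 2 (cauchyMeasure n β), u =ᵐ[cauchyMeasure n β] (fun x => ⟪p, x⟫_ℝ) ∧
      w =ᵐ[cauchyMeasure n β] (fun x => 2 * (β - 1) * ⟪p, x⟫_ℝ) ∧
      (u, w) ∈ closure ((cauchyOp n β).graph : Set _) := by
  have hβ' : (n : ℝ) / 2 < β := by linarith
  have := isProbabilityMeasure_cauchyMeasure hβ'
  obtain ⟨K1, hK11, hK1⟩ := exists_bound_profileGenerator n β 0
  obtain ⟨K2, hK20, hK2⟩ := exists_bound_truncPow' 0
  simp only [Real.rpow_zero, mul_one] at hK1 hK2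
  have hgen : ∀ (k : ℕ) (x : 𝔼), cauchyGenerator n β
      (affineTrunc 0 p 0 (k + 1) (by positivity)) x = ⟪p, x⟫_ℝ * (profileGenerator n β (‖x‖ ^ 2)
        (truncPow' 0 (k + 1) (‖x‖ ^ 2)) (truncPow'' 0 (k + 1) (‖x‖ ^ 2)) +
        (4 * (1 + ‖x‖ ^ 2) * truncPow' 0 (k + 1) (‖x‖ ^ 2) +
        2 * (1 - β) * truncPow 0 (k + 1) (‖x‖ ^ 2))) := fun k x => by
    rw [cauchyGenerator_affineTrunc]; ring
  have hval : ∀ (k : ℕ) (x : 𝔼), (affineTrunc 0 p 0 ((k : ℝ) + 1) (by positivity) : 𝔼 → ℝ) x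
      = ⟪p, x⟫_ℝ * truncPow 0 (k + 1) (‖x‖ ^ 2) := fun k x => by
    change (0 + ⟪p, x⟫_ℝ) * truncPow 0 (k + 1) (‖x‖ ^ 2) = _
    simp
  have hmem : MemLp (fun x : 𝔼 => ⟪p, x⟫_ℝ) 2 (cauchyMeasure n β) := by
    have h1 : MemLp (fun x : 𝔼 => (1 + ‖x‖ ^ 2) ^ (1 / 2 : ℝ)) 2 (cauchyMeasure n β) :=
      (memLp_pow_radialMeasure hn hβ' (by linarith)).comp_measurePreserving
        (measurePreserving_norm hn hβ')
    refine (h1.const_mul ‖p‖).of_le (by fun_prop) (Eventually.of_forall fun x => ?_)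
    rw [norm_mul, norm_norm]
    refine (norm_inner_le_norm p x).trans ?_
    gcongr
    rw [← Real.sqrt_eq_rpow, Real.norm_of_nonneg (Real.sqrt_nonneg _)]
    exact Real.le_sqrt_of_sq_le (by linarith)
  have habs : MemLp (fun x : 𝔼 => |⟪p, x⟫_ℝ|) 2 (cauchyMeasure n β) := hmem.norm
  have hK3 : 1 ≤ K1 + 4 * K2 + 2 * |1 - β| := by
    have := abs_nonneg (1 - β)
    linarith
  have hq : ∀ (k : ℕ), (1 : ℝ) ≤ k + 1 := fun k => by linarith [(k.cast_nonneg : (0 : ℝ) ≤ k)]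
  refine mem_closure_graph (cauchyOp_graph n β) memLp_testSpace memLp_cauchyGenerator
    (fun k : ℕ => affineTrunc 0 p 0 (k + 1) (by positivity))
    (habs.const_mul (K1 + 4 * K2 + 2 * |1 - β|)) ?_ ?_ (fun k => ?_) (fun k => ?_)
  · refine Eventually.of_forall fun x => ?_
    obtain ⟨N, hN⟩ := exists_nat_gt (‖x‖ ^ 2)
    filter_upwards [eventually_ge_atTop N] with k hk
    have : (N : ℝ) ≤ k := by exact_mod_cast hk
    rw [hval, (truncPow_eq (sq_nonneg _) (by linarith)).1, Real.rpow_zero, mul_one]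
  · refine Eventually.of_forall fun x => ?_
    obtain ⟨N, hN⟩ := exists_nat_gt (‖x‖ ^ 2)
    filter_upwards [eventually_ge_atTop N] with k hk
    have : (N : ℝ) ≤ k := by exact_mod_cast hk
    obtain ⟨t0, t1, t2⟩ := truncPow_eq (a := 0) (R := k + 1) (sq_nonneg ‖x‖) (by linarith)
    rw [hgen, t0, t1, t2, profileGenerator, Real.rpow_zero]
    ring
  · refine Eventually.of_forall fun x => ?_
    rw [hval, abs_mul, mul_comm]
    have := abs_truncPow_le (a := 0) (R := k + 1) (sq_nonneg ‖x‖)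
    rw [Real.rpow_zero] at this
    gcongr
    linarith
  · refine Eventually.of_forall fun x => ?_
    rw [hgen, abs_mul, mul_comm]
    gcongr
    have h0 := abs_truncPow_le (a := 0) (R := k + 1) (sq_nonneg ‖x‖)
    rw [Real.rpow_zero] at h0
    have h1 := hK1 (k + 1) (‖x‖ ^ 2) (hq k) (sq_nonneg _)
    have h2 := (hK2 (k + 1) (‖x‖ ^ 2) (hq k) (sq_nonneg _)).1
    refine (abs_add_le _ _).trans ?_
    refine (add_le_add h1 (abs_add_le _ _)).trans ?_
    rw [abs_mul, abs_mul, abs_mul, abs_mul, abs_two, abs_of_nonneg (by norm_num : (0 : ℝ) ≤ 4),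
      abs_of_nonneg (by positivity : 0 ≤ 1 + ‖x‖ ^ 2)]
    have h3 : 2 * |1 - β| * |truncPow 0 (k + 1) (‖x‖ ^ 2)| ≤ 2 * |1 - β| * 1 := by gcongr
    linarith

end CauchyClosure

/-! ### An inequality on the circle -/

section Circle

open Complex in
-- Equality for k = ±1, and also trivially for k = 0; for |k| ≥ 2 the bound |iᵏ − 1| ≤ 2 is enough.
theorem norm_I_zpow_sub_one_sq_le (k : ℤ) : ‖(I : ℂ) ^ k - 1‖ ^ 2 ≤ 2 * (k : ℝ) ^ 2 := by
  rcases eq_or_ne k 0 with rfl | h0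
  · simp
  have hI : ‖(I : ℂ) - 1‖ ^ 2 = 2 := by
    rw [← normSq_eq_norm_sq, normSq_apply]; simp; norm_num
  rcases eq_or_ne k 1 with rfl | h1
  · simp [hI]
  rcases eq_or_ne k (-1) with rfl | h2
  · have : (I : ℂ) ^ (-1 : ℤ) - 1 = -I - 1 := by simp
    rw [this, ← normSq_eq_norm_sq, normSq_apply]; simp; norm_num
  have h3 : (4 : ℝ) ≤ (k : ℝ) ^ 2 := by
    have : (4 : ℤ) ≤ k ^ 2 := by
      have : 2 ≤ |k| := by
        by_contra hk
        have : |k| < 2 := by omega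
        rw [abs_lt] at this
        omega
      rw [← sq_abs]; nlinarith
    exact_mod_cast this
  have h4 : ‖(I : ℂ) ^ k - 1‖ ≤ 2 := by
    refine (norm_sub_le _ _).trans ?_
    rw [norm_zpow, norm_I, one_zpow, norm_one]; norm_num
  nlinarith [norm_nonneg ((I : ℂ) ^ k - 1)]

open Complex in
theorem fourier_two_pi (k : ℤ) (x : ℝ) :
    fourier k (x : AddCircle (2 * Real.pi - 0)) = exp (k * x * I) := by
  rw [fourier_coe_apply]
  congr 1
  have : (Real.pi : ℂ) ≠ 0 := by exact_mod_cast Real.pi_ne_zero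
  push_cast
  field_simp
  ring

open Complex in
/-- The quarter-turn increment of a periodic function is controlled by its derivative. -/
theorem integral_quarter_turn_sq_le {φ φ' : ℝ → ℝ} (hd : ∀ s, HasDerivAt φ (φ' s) s)
    (hc : Continuous φ') (hper : Function.Periodic φ (2 * Real.pi)) :
    ∫ s in (0 : ℝ)..(2 * Real.pi), (φ (s + Real.pi / 2) - φ s) ^ 2 ≤
      2 * ∫ s in (0 : ℝ)..(2 * Real.pi), φ' s ^ 2 := by
  have hab : (0 : ℝ) < 2 * Real.pi := by positivity
  have hφc : Continuous φ := continuous_iff_continuousAt.2 fun s => (hd s).continuousAt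
  let f : ℝ → ℂ := fun s => φ s
  let f' : ℝ → ℂ := fun s => φ' s
  let g : ℝ → ℂ := fun s => ((φ (s + Real.pi / 2) - φ s : ℝ) : ℂ)
  have hfc : Continuous f := continuous_ofReal.comp hφc
  have hf'c : Continuous f' := continuous_ofReal.comp hc
  have hgc : Continuous g := continuous_ofReal.comp (by fun_prop)
  have hL2 : ∀ F : ℝ → ℂ, Continuous F → MemLp F 2 (volume.restrict (Ioc 0 (2 * Real.pi))) := by
    intro F hF
    obtain ⟨K, hK⟩ := (isCompact_Icc (a := (0 : ℝ)) (b := 2 * Real.pi)).exists_bound_of_continuousOn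
      hF.continuousOn
    refine MemLp.of_bound hF.aestronglyMeasurable K ?_
    filter_upwards [ae_restrict_mem measurableSet_Ioc] with s hs using hK s ⟨hs.1.le, hs.2⟩
  have hs' := hasSum_sq_fourierCoeffOn hab (hL2 f' hf'c)
  have hg' := hasSum_sq_fourierCoeffOn hab (hL2 g hgc)
  -- Periodicity cancels the boundary term, so differentiation multiplies the k-th coefficient by
  -- ik.
  have hderiv : ∀ k : ℤ, k ≠ 0 → ‖fourierCoeffOn hab f' k‖ ^ 2 =
      (k : ℝ) ^ 2 * ‖fourierCoeffOn hab f k‖ ^ 2 := by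
    intro k hk
    have h := fourierCoeffOn_of_hasDerivAt hab hk (f := f) (f' := f')
      (fun x _ => (hd x).ofReal_comp) (hf'c.intervalIntegrable _ _)
    have hp : f (2 * Real.pi) = f 0 := by
      have := hper 0
      simp only [zero_add] at this
      simp only [f, this]
    rw [hp, sub_self, mul_zero, zero_sub] at h
    rw [h]
    have hπ : (Real.pi : ℂ) ≠ 0 := by exact_mod_cast Real.pi_ne_zero
    have hkc : (k : ℂ) ≠ 0 := by exact_mod_cast hk
    have e : (1 / (-2 * Real.pi * I * k) * -((2 * Real.pi - 0) * fourierCoeffOn hab f' k) : ℂ) =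
        -(I * (k : ℂ)⁻¹ * fourierCoeffOn hab f' k) := by
      have hI : (1 / (-2 * Real.pi * I * k) : ℂ) = I * (1 / (2 * Real.pi * k)) := by
        field_simp
        rw [I_sq]
      rw [hI]
      field_simp
      ring
    push_cast at e ⊢
    rw [e, norm_neg, norm_mul, norm_mul, norm_I, norm_inv, one_mul, mul_pow, inv_pow]
    have : ‖(k : ℂ)‖ ^ 2 = (k : ℝ) ^ 2 := by
      rw [Complex.norm_intCast, sq_abs]
    rw [this]
    have : (k : ℝ) ≠ 0 := by exact_mod_cast hk
    field_simp
  -- A quarter turn multiplies the k-th coefficient by iᵏ; Parseval then reduces the inequality to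
  -- one coefficient at a time.
  have hshift : ∀ k : ℤ, fourierCoeffOn hab g k = (I ^ k - 1) * fourierCoeffOn hab f k := by
    intro k
    rw [fourierCoeffOn_eq_integral, fourierCoeffOn_eq_integral]
    simp only [fourier_two_pi, smul_eq_mul]
    have hI : (I : ℂ) ^ k = exp (k * (Real.pi / 2 : ℝ) * I) := by
      have h : exp (((Real.pi / 2 : ℝ) : ℂ) * I) = I := by
        push_cast
        exact exp_pi_div_two_mul_I
      rw [mul_assoc, exp_int_mul, h]
    set P : ℝ → ℂ := fun x => exp (((-k : ℤ) : ℂ) * x * I) * f x with hP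
    have hPper : Function.Periodic P (2 * Real.pi) := by
      intro x
      simp only [hP, f]
      rw [hper x]
      congr 1
      have : (((-k : ℤ) : ℂ) * ((x + 2 * Real.pi : ℝ) : ℂ) * I) =
          ((-k : ℤ) : ℂ) * x * I + ((-k : ℤ) : ℂ) * (2 * Real.pi * I) := by push_cast; ring
      rw [this, exp_add, exp_int_mul_two_pi_mul_I, mul_one]
    have hPc : Continuous P := by fun_prop
    have e1 : ∀ x : ℝ, exp (((-k : ℤ) : ℂ) * x * I) * g x = I ^ k * P (x + Real.pi / 2) - P x := by
      intro x
      simp only [hP, g, f, hI]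
      have : exp (((-k : ℤ) : ℂ) * ((x + Real.pi / 2 : ℝ) : ℂ) * I) =
          exp (((-k : ℤ) : ℂ) * x * I) * exp (-(k * ((Real.pi / 2 : ℝ) : ℂ) * I)) := by
        rw [← exp_add]; congr 1; push_cast; ring
      rw [this, exp_neg]
      have hne := exp_ne_zero ((k : ℂ) * ((Real.pi / 2 : ℝ) : ℂ) * I)
      field_simp
      push_cast
      ring
    simp only [e1]
    rw [intervalIntegral.integral_sub (Continuous.intervalIntegrable (by fun_prop) _ _)
      (hPc.intervalIntegrable _ _), intervalIntegral.integral_const_mul,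
      intervalIntegral.integral_comp_add_right (fun x => P x)]
    have e2 : ∫ x in (0 + Real.pi / 2)..(2 * Real.pi + Real.pi / 2), P x =
        ∫ x in (0 : ℝ)..(2 * Real.pi), P x := by
      have := hPper.intervalIntegral_add_eq (Real.pi / 2) 0
      rw [zero_add] at this
      rw [zero_add, add_comm (2 * Real.pi), this]
    rw [e2, ← sub_one_mul]
    simp only [Complex.real_smul]
    ring
  have hle := hasSum_le (fun k => ?_) hg' (hs'.mul_left 2)
  · simp only [sub_zero, smul_eq_mul] at hle
    have e1 : ∀ s, ‖g s‖ ^ 2 = (φ (s + Real.pi / 2) - φ s) ^ 2 := fun s => by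
      simp only [g, norm_real, Real.norm_eq_abs, sq_abs]
    have e2 : ∀ s, ‖f' s‖ ^ 2 = φ' s ^ 2 := fun s => by
      simp only [f', norm_real, Real.norm_eq_abs, sq_abs]
    simp only [e1, e2] at hle
    rw [mul_left_comm] at hle
    exact le_of_mul_le_mul_left hle (by positivity)
  · rcases eq_or_ne k 0 with rfl | hk
    · rw [hshift]
      simp
    · rw [hshift, hderiv k hk, norm_mul, mul_pow, ← mul_assoc]
      exact mul_le_mul_of_nonneg_right (norm_I_zpow_sub_one_sq_le k) (by positivity)

end Circle

/-! ### Rotations of a product -/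

section Rotation

variable {E : Type*} [NormedAddCommGroup E] [InnerProductSpace ℝ E]

/-- The rotation of angle `s` mixing the two factors of `E × E`. -/
def prodRotation (s : ℝ) : E × E →ₗ[ℝ] E × E :=
  (Real.cos s • LinearMap.fst ℝ E E + Real.sin s • LinearMap.snd ℝ E E).prod
    (-Real.sin s • LinearMap.fst ℝ E E + Real.cos s • LinearMap.snd ℝ E E)

theorem prodRotation_apply (s : ℝ) (p : E × E) :
    prodRotation s p = (Real.cos s • p.1 + Real.sin s • p.2,
      -Real.sin s • p.1 + Real.cos s • p.2) := rfl

theorem prodRotation_comp_neg (s : ℝ) :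
    (prodRotation s : E × E →ₗ[ℝ] E × E) ∘ₗ prodRotation (-s) = LinearMap.id := by
  have h := Real.cos_sq_add_sin_sq s
  refine LinearMap.ext fun p => ?_
  simp only [LinearMap.comp_apply, prodRotation_apply, Real.cos_neg, Real.sin_neg,
    LinearMap.id_apply]
  refine Prod.ext ?_ ?_
  · have : Real.cos s • (Real.cos s • p.1 + -Real.sin s • p.2) +
        Real.sin s • (- -Real.sin s • p.1 + Real.cos s • p.2) =
        (Real.cos s ^ 2 + Real.sin s ^ 2) • p.1 := by module
    simp only [this, h, one_smul]
  · have : -Real.sin s • (Real.cos s • p.1 + -Real.sin s • p.2) +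
        Real.cos s • (- -Real.sin s • p.1 + Real.cos s • p.2) =
        (Real.cos s ^ 2 + Real.sin s ^ 2) • p.2 := by module
    simp only [this, h, one_smul]

/-- Conjugation by the reflection (x, y) ↦ (x, −y) turns the rotation into its inverse, so its
determinant equals that of its inverse. Only |det| = 1 matters for Haar measure. -/
theorem det_prodRotation_sq (s : ℝ) :
    LinearMap.det (prodRotation s : E × E →ₗ[ℝ] E × E) ^ 2 = 1 := by
  let J : E × E →ₗ[ℝ] E × E := (LinearMap.fst ℝ E E).prod (-LinearMap.snd ℝ E E)
  have hJ : J ∘ₗ J = LinearMap.id := LinearMap.ext fun p => by simp [J]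
  have hJr : J ∘ₗ prodRotation s ∘ₗ J = prodRotation (-s) := LinearMap.ext fun p => by
    simp [J, prodRotation_apply, add_comm]
  have h1 : LinearMap.det J * LinearMap.det J = 1 := by
    rw [← LinearMap.det_comp, hJ, LinearMap.det_id]
  have h2 : LinearMap.det (prodRotation (-s) : E × E →ₗ[ℝ] E × E) =
      LinearMap.det (prodRotation s : E × E →ₗ[ℝ] E × E) := by
    rw [← hJr, LinearMap.det_comp, LinearMap.det_comp]
    linear_combination LinearMap.det (prodRotation s : E × E →ₗ[ℝ] E × E) * h1
  have h3 := congrArg LinearMap.det (prodRotation_comp_neg (E := E) s)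
  rw [LinearMap.det_comp, h2, LinearMap.det_id] at h3
  rw [sq, h3]

theorem measurePreserving_prodRotation [MeasurableSpace E] [BorelSpace E] [FiniteDimensional ℝ E]
    (μ : Measure E) [μ.IsAddHaarMeasure] (s : ℝ) :
    MeasurePreserving (prodRotation s : E × E →ₗ[ℝ] E × E) (μ.prod μ) (μ.prod μ) := by
  have hc : Continuous (prodRotation s : E × E →ₗ[ℝ] E × E) := LinearMap.continuous_of_finiteDimensional _
  refine ⟨hc.measurable, ?_⟩
  have h := det_prodRotation_sq (E := E) s
  have hne : LinearMap.det (prodRotation s : E × E →ₗ[ℝ] E × E) ≠ 0 := fun h0 => by simp [h0] at h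
  rw [Measure.map_linearMap_addHaar_eq_smul_addHaar _ hne]
  have : |(LinearMap.det (prodRotation s : E × E →ₗ[ℝ] E × E))⁻¹| = 1 := by
    rw [abs_inv, inv_eq_one]
    exact (pow_eq_one_iff_of_nonneg (abs_nonneg _) two_ne_zero).1 (by rw [sq_abs, h])
  rw [this, ENNReal.ofReal_one, one_smul]

theorem norm_sq_add_norm_sq_prodRotation (s : ℝ) (p : E × E) :
    ‖(prodRotation s p).1‖ ^ 2 + ‖(prodRotation s p).2‖ ^ 2 = ‖p.1‖ ^ 2 + ‖p.2‖ ^ 2 := by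
  simp only [prodRotation_apply, norm_add_sq_real, norm_smul, inner_smul_left, inner_smul_right,
    mul_pow, Real.norm_eq_abs, sq_abs, neg_sq, conj_trivial]
  linear_combination (‖p.1‖ ^ 2 + ‖p.2‖ ^ 2) * Real.cos_sq_add_sin_sq s

theorem continuous_prodRotation_left (p : E × E) :
    Continuous fun s : ℝ => (prodRotation s p : E × E) := by
  simp only [prodRotation_apply]; fun_prop

theorem lintegral_prodRotation [MeasurableSpace E] [BorelSpace E] [FiniteDimensional ℝ E]
    (μ : Measure E) [μ.IsAddHaarMeasure] {F : E × E → ℝ≥0∞} (hF : Measurable F) :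
    ∫⁻ p, (∫⁻ s in Ioc 0 (2 * Real.pi), F (prodRotation s p)) ∂(μ.prod μ) =
      ENNReal.ofReal (2 * Real.pi) * ∫⁻ p, F p ∂(μ.prod μ) := by
  have hc : Continuous fun q : (E × E) × ℝ => (prodRotation q.2 q.1 : E × E) := by
    simp only [prodRotation_apply]; fun_prop
  have hm : Measurable (Function.uncurry fun (p : E × E) (s : ℝ) => F (prodRotation s p)) :=
    hF.comp hc.measurable
  rw [lintegral_lintegral_swap hm.aemeasurable]
  · have : ∀ s : ℝ, ∫⁻ p, F (prodRotation s p) ∂(μ.prod μ) = ∫⁻ p, F p ∂(μ.prod μ) := fun s =>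
      (measurePreserving_prodRotation μ s).lintegral_comp hF
    simp only [this, lintegral_const, Measure.restrict_apply_univ, Real.volume_Ioc, sub_zero]
    rw [mul_comm]

/-- On an orbit the first component has the second as its derivative, and a quarter turn later it
equals the second. The circle inequality applies to H along the first component. -/
theorem integral_rotation_sub_sq_le {H : E → ℝ} {D : E → E}
    (hH : ∀ x, HasFDerivAt H (innerSL ℝ (D x)) x) (hD : Continuous D) (p : E × E) :
    ∫ s in (0 : ℝ)..(2 * Real.pi), (H (prodRotation s p).2 - H (prodRotation s p).1) ^ 2 ≤
      2 * ∫ s in (0 : ℝ)..(2 * Real.pi), ⟪D (prodRotation s p).1, (prodRotation s p).2⟫_ℝ ^ 2 := by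
  have hr1 : Continuous fun s : ℝ => (prodRotation s p : E × E) :=
    continuous_prodRotation_left p
  have hx : ∀ s, HasDerivAt (fun s => (prodRotation s p).1) (prodRotation s p).2 s := fun s =>
    ((Real.hasDerivAt_cos s).smul_const p.1).add ((Real.hasDerivAt_sin s).smul_const p.2)
  have hd : ∀ s, HasDerivAt (fun s => H (prodRotation s p).1)
      ⟪D (prodRotation s p).1, (prodRotation s p).2⟫_ℝ s := fun s => by
    have h1 := hH (prodRotation s p).1
    have h2 := hx s
    generalize hX : (fun s => (prodRotation s p).1) = X at h2
    rw [show (prodRotation s p).1 = X s from congrFun hX s] at h1 ⊢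
    have h3 := h1.comp_hasDerivAt s h2
    have e : (fun s => H (prodRotation s p).1) = H ∘ X := by rw [← hX]; rfl
    rw [e]
    exact h3
  have hc : Continuous fun s => ⟪D (prodRotation s p).1, (prodRotation s p).2⟫_ℝ :=
    (hD.comp (continuous_fst.comp hr1)).inner (continuous_snd.comp hr1)
  have hper : Function.Periodic (fun s => H (prodRotation s p).1) (2 * Real.pi) := fun s => by
    simp only [prodRotation_apply, Real.cos_add_two_pi, Real.sin_add_two_pi]
  have hq := integral_quarter_turn_sq_le hd hc hper
  have hsh : ∀ s, H (prodRotation (s + Real.pi / 2) p).1 = H (prodRotation s p).2 := fun s => by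
    simp only [prodRotation_apply, Real.cos_add_pi_div_two, Real.sin_add_pi_div_two]
  simpa only [hsh] using hq

theorem setLIntegral_ofReal_circle {G : ℝ → ℝ} (hG : Continuous G) (hG0 : ∀ s, 0 ≤ G s) :
    ∫⁻ s in Ioc 0 (2 * Real.pi), ENNReal.ofReal (G s) =
      ENNReal.ofReal (∫ s in (0 : ℝ)..(2 * Real.pi), G s) := by
  rw [intervalIntegral.integral_of_le (by positivity)]
  exact (ofReal_integral_eq_lintegral_ofReal (hG.integrableOn_Ioc)
    (Eventually.of_forall hG0)).symm

/-- Averaging the quarter-turn inequality over the rotations of `E × E`. -/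
theorem lintegral_sub_sq_le [MeasurableSpace E] [BorelSpace E] [FiniteDimensional ℝ E]
    (μ : Measure E) [μ.IsAddHaarMeasure] {H : E → ℝ} {D : E → E}
    (hH : ∀ x, HasFDerivAt H (innerSL ℝ (D x)) x) (hD : Continuous D)
    {M : ℝ → ℝ} (hM : ∀ r, 0 ≤ r → 0 ≤ M r) (hMc : Measurable M) :
    ∫⁻ p, ENNReal.ofReal ((H p.2 - H p.1) ^ 2 * M (‖p.1‖ ^ 2 + ‖p.2‖ ^ 2)) ∂(μ.prod μ) ≤
      ∫⁻ p, ENNReal.ofReal (2 * ⟪D p.1, p.2⟫_ℝ ^ 2 * M (‖p.1‖ ^ 2 + ‖p.2‖ ^ 2)) ∂(μ.prod μ) := by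
  have hHc : Continuous H := continuous_iff_continuousAt.2 fun x => (hH x).continuousAt
  have hpi : (0 : ℝ) < 2 * Real.pi := by positivity
  have h0 : ENNReal.ofReal (2 * Real.pi) ≠ 0 := by simpa using Real.pi_pos
  have hM' : Measurable fun p : E × E => M (‖p.1‖ ^ 2 + ‖p.2‖ ^ 2) :=
    hMc.comp (by fun_prop : Continuous fun p : E × E => ‖p.1‖ ^ 2 + ‖p.2‖ ^ 2).measurable
  have m1 : Continuous fun p : E × E => (H p.2 - H p.1) ^ 2 := by fun_prop
  have m2 : Continuous fun p : E × E => 2 * ⟪D p.1, p.2⟫_ℝ ^ 2 := by fun_prop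
  have n1 : Measurable fun p : E × E =>
      ENNReal.ofReal ((H p.2 - H p.1) ^ 2 * M (‖p.1‖ ^ 2 + ‖p.2‖ ^ 2)) :=
    (m1.measurable.mul hM').ennreal_ofReal
  have n2 : Measurable fun p : E × E =>
      ENNReal.ofReal (2 * ⟪D p.1, p.2⟫_ℝ ^ 2 * M (‖p.1‖ ^ 2 + ‖p.2‖ ^ 2)) :=
    (m2.measurable.mul hM').ennreal_ofReal
  rw [← ENNReal.mul_le_mul_iff_right h0 ENNReal.ofReal_ne_top, ← lintegral_prodRotation μ n1,
    ← lintegral_prodRotation μ n2]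
  refine lintegral_mono fun p => ?_
  have hr1 : Continuous fun s : ℝ => (prodRotation s p : E × E) :=
    continuous_prodRotation_left p
  have hm := hM (‖p.1‖ ^ 2 + ‖p.2‖ ^ 2) (by positivity)
  -- The weight is constant on each orbit, so it factors out of the integral in s.
  simp only [norm_sq_add_norm_sq_prodRotation]
  have c1 : Continuous fun s =>
      (H (prodRotation s p).2 - H (prodRotation s p).1) ^ 2 * M (‖p.1‖ ^ 2 + ‖p.2‖ ^ 2) :=
    (m1.comp hr1).mul continuous_const
  have c2 : Continuous fun s =>
      2 * ⟪D (prodRotation s p).1, (prodRotation s p).2⟫_ℝ ^ 2 * M (‖p.1‖ ^ 2 + ‖p.2‖ ^ 2) :=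
    (m2.comp hr1).mul continuous_const
  rw [setLIntegral_ofReal_circle c1 (fun s => mul_nonneg (sq_nonneg _) hm),
    setLIntegral_ofReal_circle c2 (fun s => mul_nonneg (by positivity) hm)]
  refine ENNReal.ofReal_le_ofReal ?_
  rw [intervalIntegral.integral_mul_const, intervalIntegral.integral_mul_const,
    intervalIntegral.integral_const_mul]
  exact mul_le_mul_of_nonneg_right (integral_rotation_sub_sq_le hH hD p) hm

end Rotation

/-! ### The Poincaré inequality orthogonally to the radial functions -/

section Sector

variable {n : ℕ} {β : ℝ}

local notation "𝔼" => EuclideanSpace ℝ (Fin n)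

theorem inner_sq_mul_cauchyDensity_le (p x : 𝔼) (q : ℝ) :
    |⟪p, x⟫_ℝ ^ 2 * (1 + ‖x‖ ^ 2) ^ q| ≤ ‖p‖ ^ 2 * (1 + ‖x‖ ^ 2) ^ (q + 1) := by
  have h0 : (0 : ℝ) < 1 + ‖x‖ ^ 2 := by positivity
  have h1 : ⟪p, x⟫_ℝ ^ 2 ≤ ‖p‖ ^ 2 * (1 + ‖x‖ ^ 2) := by
    have h := abs_real_inner_le_norm p x
    have h2 : ⟪p, x⟫_ℝ ^ 2 ≤ (‖p‖ * ‖x‖) ^ 2 := by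
      rw [← sq_abs]; exact pow_le_pow_left₀ (abs_nonneg _) h 2
    nlinarith [sq_nonneg ‖p‖]
  rw [abs_of_nonneg (by positivity), Real.rpow_add_one h0.ne']
  calc ⟪p, x⟫_ℝ ^ 2 * (1 + ‖x‖ ^ 2) ^ q ≤ (‖p‖ ^ 2 * (1 + ‖x‖ ^ 2)) * (1 + ‖x‖ ^ 2) ^ q := by gcongr
    _ = _ := by ring

theorem integrable_inner_sq_mul_cauchyDensity (p : 𝔼) {γ : ℝ} (hγ : (n : ℝ) / 2 + 1 < γ) :
    Integrable fun x : 𝔼 => ⟪p, x⟫_ℝ ^ 2 * (1 + ‖x‖ ^ 2) ^ (-γ) := by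
  have h := (integrable_cauchyDensity (n := n) (β := γ - 1) (by linarith)).const_mul (‖p‖ ^ 2)
  refine h.mono' ?_ (Eventually.of_forall fun x => ?_)
  · have := continuous_cauchyDensity n (-γ)
    exact (by fun_prop : Continuous _).aestronglyMeasurable
  · have := inner_sq_mul_cauchyDensity_le p x (-γ)
    rwa [show -γ + 1 = -(γ - 1) by ring] at this

/-- Integration by parts in direction p of ⟪p, x⟫ against (1 + ‖x‖²)^{−(γ−1)}. The margin 3/2 makes
the product of these two functions integrable. -/
theorem integral_inner_sq_mul_cauchyDensity (p : 𝔼) {γ : ℝ} (hγ : (n : ℝ) / 2 + 3 / 2 < γ) :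
    2 * (γ - 1) * ∫ x : 𝔼, ⟪p, x⟫_ℝ ^ 2 * (1 + ‖x‖ ^ 2) ^ (-γ) =
      ‖p‖ ^ 2 * ∫ x : 𝔼, (1 + ‖x‖ ^ 2) ^ (-(γ - 1)) := by
  have hg : ∀ x : 𝔼, HasFDerivAt (fun y : 𝔼 => (1 + ‖y‖ ^ 2) ^ (-(γ - 1)))
      ((2 * (-(γ - 1) * (1 + ‖x‖ ^ 2) ^ (-γ))) • innerSL ℝ x) x := fun x => by
    have := hasFDerivAt_cauchyDensity (n := n) (-(γ - 1)) x
    rwa [show -(γ - 1) - 1 = -γ by ring] at this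
  have hf : ∀ x : 𝔼, HasFDerivAt (fun y : 𝔼 => ⟪p, y⟫_ℝ) (innerSL ℝ p) x := fun x =>
    (innerSL ℝ p).hasFDerivAt
  have e1 : ∀ x : 𝔼, ⟪p, x⟫_ℝ * fderiv ℝ (fun y : 𝔼 => (1 + ‖y‖ ^ 2) ^ (-(γ - 1))) x p =
      -(2 * (γ - 1)) * (⟪p, x⟫_ℝ ^ 2 * (1 + ‖x‖ ^ 2) ^ (-γ)) := fun x => by
    rw [(hg x).fderiv]
    simp only [smul_apply, innerSL_apply_apply, smul_eq_mul, real_inner_comm x p]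
    ring
  have e2 : ∀ x : 𝔼, fderiv ℝ (fun y : 𝔼 => ⟪p, y⟫_ℝ) x p * (1 + ‖x‖ ^ 2) ^ (-(γ - 1)) =
      ‖p‖ ^ 2 * (1 + ‖x‖ ^ 2) ^ (-(γ - 1)) := fun x => by
    rw [(hf x).fderiv, innerSL_apply_apply, real_inner_self_eq_norm_sq]
  have h := integral_mul_fderiv_eq_neg_fderiv_mul_of_integrable (μ := (volume : Measure 𝔼))
    (f := fun y : 𝔼 => ⟪p, y⟫_ℝ) (g := fun y : 𝔼 => (1 + ‖y‖ ^ 2) ^ (-(γ - 1))) (v := p)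
    ?_ ?_ ?_ (fun x _ => (hf x).differentiableAt) (fun x _ => (hg x).differentiableAt)
  · simp only [e1, e2, integral_const_mul] at h
    linarith
  · simp only [e2]
    exact (integrable_cauchyDensity (by linarith)).const_mul _
  · simp only [e1]
    exact (integrable_inner_sq_mul_cauchyDensity p (by linarith)).const_mul _
  · have hi := (integrable_cauchyDensity (n := n) (β := γ - 3 / 2) (by linarith)).const_mul ‖p‖
    refine hi.mono' ?_ (Eventually.of_forall fun x => ?_)
    · have := continuous_cauchyDensity n (-(γ - 1))
      exact (by fun_prop : Continuous _).aestronglyMeasurable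
    · have h0 : (0 : ℝ) < 1 + ‖x‖ ^ 2 := by positivity
      have h1 : ‖x‖ ≤ (1 + ‖x‖ ^ 2) ^ (1 / 2 : ℝ) := by
        rw [← Real.sqrt_eq_rpow]
        exact Real.le_sqrt_of_sq_le (by linarith)
      rw [norm_mul, Real.norm_of_nonneg (Real.rpow_nonneg h0.le _)]
      calc ‖⟪p, x⟫_ℝ‖ * (1 + ‖x‖ ^ 2) ^ (-(γ - 1))
          ≤ (‖p‖ * (1 + ‖x‖ ^ 2) ^ (1 / 2 : ℝ)) * (1 + ‖x‖ ^ 2) ^ (-(γ - 1)) := by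
            gcongr
            exact (norm_inner_le_norm p x).trans (by gcongr)
        _ = ‖p‖ * (1 + ‖x‖ ^ 2) ^ (-(γ - 3 / 2)) := by
            rw [mul_assoc, ← Real.rpow_add h0]
            congr 2
            ring

/-- Sum the second-moment identity over an orthonormal basis and write ‖x‖² = (1 + ‖x‖²) − 1. -/
theorem integral_cauchyDensity_shift {γ : ℝ} (hγ : (n : ℝ) / 2 + 3 / 2 < γ) :
    2 * (γ - 1) * ∫ x : 𝔼, (1 + ‖x‖ ^ 2) ^ (-γ) =
      (2 * (γ - 1) - n) * ∫ x : 𝔼, (1 + ‖x‖ ^ 2) ^ (-(γ - 1)) := by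
  let b := EuclideanSpace.basisFun (Fin n) ℝ
  have h : ∀ i, _ := fun i => integral_inner_sq_mul_cauchyDensity (b i) hγ
  have hs := Finset.sum_congr (rfl : (Finset.univ : Finset (Fin n)) = Finset.univ) fun i _ => h i
  rw [← Finset.mul_sum, ← integral_finsetSum _ fun i _ =>
    integrable_inner_sq_mul_cauchyDensity (b i) (by linarith)] at hs
  have e : ∀ x : 𝔼, ∑ i, ⟪b i, x⟫_ℝ ^ 2 * (1 + ‖x‖ ^ 2) ^ (-γ) =
      (1 + ‖x‖ ^ 2) ^ (-(γ - 1)) - (1 + ‖x‖ ^ 2) ^ (-γ) := fun x => by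
    have h0 : (0 : ℝ) < 1 + ‖x‖ ^ 2 := by positivity
    rw [← Finset.sum_mul, show -(γ - 1) = -γ + 1 by ring, Real.rpow_add_one h0.ne']
    have : ∑ i, ⟪b i, x⟫_ℝ ^ 2 = ‖x‖ ^ 2 := by
      rw [← real_inner_self_eq_norm_sq, ← b.sum_inner_mul_inner x x]
      exact Finset.sum_congr rfl fun i _ => by rw [real_inner_comm, sq]
    rw [this]
    ring
  simp only [e] at hs
  rw [integral_sub (integrable_cauchyDensity (by linarith)) (integrable_cauchyDensity (by linarith))]
    at hs
  have h1 : ∀ i, ‖b i‖ = 1 := b.norm_eq_one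
  simp only [h1, one_pow, one_mul, Finset.sum_const, Finset.card_univ, Fintype.card_fin,
    nsmul_eq_mul] at hs
  linarith

/-- Scaling the weight `(A + ‖y‖²)^{-γ}` to `A = 1`. -/
theorem integral_mul_add_norm_sq_rpow {A γ : ℝ} (hA : 0 < A) (g : 𝔼 → ℝ) :
    ∫ y : 𝔼, g y * (A + ‖y‖ ^ 2) ^ (-γ) =
      A ^ ((n : ℝ) / 2 - γ) * ∫ z : 𝔼, g (√A • z) * (1 + ‖z‖ ^ 2) ^ (-γ) := by
  have h := Measure.integral_comp_smul (volume : Measure 𝔼)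
    (fun y : 𝔼 => g y * (A + ‖y‖ ^ 2) ^ (-γ)) (√A)
  have hs : 0 < √A := Real.sqrt_pos.2 hA
  rw [finrank_euclideanSpace, Fintype.card_fin, abs_of_pos (by positivity), smul_eq_mul] at h
  have e : ∀ z : 𝔼, g (√A • z) * (A + ‖√A • z‖ ^ 2) ^ (-γ) =
      A ^ (-γ) * (g (√A • z) * (1 + ‖z‖ ^ 2) ^ (-γ)) := fun z => by
    rw [norm_smul, Real.norm_of_nonneg hs.le, mul_pow, Real.sq_sqrt hA.le,
      show A + A * ‖z‖ ^ 2 = A * (1 + ‖z‖ ^ 2) by ring, Real.mul_rpow hA.le (by positivity)]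
    ring
  simp only [e, integral_const_mul] at h
  have hp : √A ^ n = A ^ ((n : ℝ) / 2) := by
    rw [Real.sqrt_eq_rpow, ← Real.rpow_natCast, ← Real.rpow_mul hA.le]
    congr 1; ring
  rw [hp] at h
  rw [sub_eq_add_neg, Real.rpow_add hA, mul_assoc, h, mul_inv_cancel_left₀ (by positivity)]

/-- The weighted Poincaré inequality for functions orthogonal to the radial functions. -/
theorem sector_poincare (hβ1 : 3 / 2 < β) {H : 𝔼 → ℝ}
    {D : 𝔼 → 𝔼} (hH : ∀ x, HasFDerivAt H (innerSL ℝ (D x)) x) (hD : Continuous D)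
    (hHs : HasCompactSupport H) (hDs : HasCompactSupport D)
    (horth : ∀ k : ℝ → ℝ, Continuous k → ∫ x, H x * k ‖x‖ = 0) :
    2 * (β - 1) * ∫ x, H x ^ 2 * (1 + ‖x‖ ^ 2) ^ (-β) ≤
      ∫ x, ‖D x‖ ^ 2 * (1 + ‖x‖ ^ 2) ^ (1 - β) := by
  have hHc : Continuous H := continuous_iff_continuousAt.2 fun x => (hH x).continuousAt
  -- Integrating one variable out of (1 + |x|² + |y|²)^{−γ} leaves a multiple of (1 + |x|²)^{n/2−γ};
  -- this γ makes the exponent −β.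
  set γ : ℝ := β + n / 2 with hγ
  set W : 𝔼 × 𝔼 → ℝ := fun p => (1 + (‖p.1‖ ^ 2 + ‖p.2‖ ^ 2)) ^ (-γ) with hW
  have hWc : Continuous W := (by fun_prop : Continuous fun p : 𝔼 × 𝔼 =>
    1 + (‖p.1‖ ^ 2 + ‖p.2‖ ^ 2)).rpow_const fun p => Or.inl (by positivity)
  have hW0 : ∀ p, 0 ≤ W p := fun p => by positivity
  have hγ0 : 0 ≤ γ := by positivity
  have hW1 : ∀ p : 𝔼 × 𝔼, W p ≤ (1 + ‖p.1‖ ^ 2) ^ (-γ) := fun p =>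
    Real.rpow_le_rpow_of_nonpos (by positivity) (by nlinarith [sq_nonneg ‖p.2‖]) (by linarith)
  have hW2 : ∀ p : 𝔼 × 𝔼, W p ≤ (1 + ‖p.2‖ ^ 2) ^ (-γ) := fun p =>
    Real.rpow_le_rpow_of_nonpos (by positivity) (by nlinarith [sq_nonneg ‖p.1‖]) (by linarith)
  have hdens : Integrable fun x : 𝔼 => (1 + ‖x‖ ^ 2) ^ (-γ) := integrable_cauchyDensity (by linarith)
  have hH2 : Integrable fun x => H x ^ 2 :=
    (hHc.pow 2).integrable_of_hasCompactSupport (by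
      simpa only [sq] using hHs.mul_right (f' := H))
  have hHi : Integrable H := hHc.integrable_of_hasCompactSupport hHs
  have hD2 : Integrable fun x => ‖D x‖ ^ 2 :=
    (hD.norm.pow 2).integrable_of_hasCompactSupport (by
      simpa only [sq] using hDs.norm.mul_right (f' := fun x => ‖D x‖))
  have i1 : Integrable (fun p : 𝔼 × 𝔼 => H p.1 ^ 2 * W p) (volume.prod volume) := by
    refine (hH2.mul_prod hdens).mono' (by fun_prop : Continuous _).aestronglyMeasurable
      (Eventually.of_forall fun p => ?_)
    rw [Real.norm_of_nonneg (mul_nonneg (sq_nonneg _) (hW0 p))]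
    exact mul_le_mul_of_nonneg_left (hW2 p) (sq_nonneg _)
  have i2 : Integrable (fun p : 𝔼 × 𝔼 => H p.2 ^ 2 * W p) (volume.prod volume) := by
    refine (hdens.mul_prod hH2).mono' (by fun_prop : Continuous _).aestronglyMeasurable
      (Eventually.of_forall fun p => ?_)
    rw [Real.norm_of_nonneg (mul_nonneg (sq_nonneg _) (hW0 p)), mul_comm]
    exact mul_le_mul_of_nonneg_right (hW1 p) (sq_nonneg _)
  have i3 : Integrable (fun p : 𝔼 × 𝔼 => H p.1 * (H p.2 * W p)) (volume.prod volume) := by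
    refine (hHi.norm.mul_prod hHi.norm).mono' (by fun_prop : Continuous _).aestronglyMeasurable
      (Eventually.of_forall fun p => ?_)
    rw [norm_mul, norm_mul, Real.norm_of_nonneg (hW0 p)]
    have : W p ≤ 1 := Real.rpow_le_one_of_one_le_of_nonpos
      (by nlinarith [sq_nonneg ‖p.1‖, sq_nonneg ‖p.2‖]) (by linarith)
    exact mul_le_mul_of_nonneg_left (mul_le_of_le_one_right (norm_nonneg _) this) (norm_nonneg _)
  have i4 : Integrable (fun p : 𝔼 × 𝔼 => ⟪D p.1, p.2⟫_ℝ ^ 2 * W p) (volume.prod volume) := by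
    refine (hD2.mul_prod (integrable_cauchyDensity (n := n) (β := γ - 1) (by linarith))).mono'
      (by fun_prop : Continuous _).aestronglyMeasurable (Eventually.of_forall fun p => ?_)
    have h := inner_sq_mul_cauchyDensity_le (D p.1) p.2 (-γ)
    rw [show -γ + 1 = -(γ - 1) by ring, abs_of_nonneg (by positivity)] at h
    rw [Real.norm_of_nonneg (mul_nonneg (sq_nonneg _) (hW0 p))]
    exact (mul_le_mul_of_nonneg_left (hW2 p) (sq_nonneg _)).trans h
  have hexp : ∀ p : 𝔼 × 𝔼, (H p.2 - H p.1) ^ 2 * W p =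
      (H p.2 ^ 2 * W p + H p.1 ^ 2 * W p) - 2 * (H p.1 * (H p.2 * W p)) := fun p => by ring
  have i5 : Integrable (fun p : 𝔼 × 𝔼 => (H p.2 - H p.1) ^ 2 * W p) (volume.prod volume) := by
    simp only [hexp]
    exact (i2.add i1).sub (i3.const_mul 2)
  have i6 : Integrable (fun p : 𝔼 × 𝔼 => 2 * ⟪D p.1, p.2⟫_ℝ ^ 2 * W p) (volume.prod volume) := by
    simpa only [mul_assoc] using i4.const_mul 2
  have hmain : ∫ p : 𝔼 × 𝔼, (H p.2 - H p.1) ^ 2 * W p ∂(volume.prod volume) ≤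
      ∫ p : 𝔼 × 𝔼, 2 * ⟪D p.1, p.2⟫_ℝ ^ 2 * W p ∂(volume.prod volume) := by
    have h := lintegral_sub_sq_le (volume : Measure 𝔼) hH hD (M := fun r => (1 + r) ^ (-γ))
      (fun r hr => by positivity) (by fun_prop)
    rw [← ofReal_integral_eq_lintegral_ofReal i5
        (Eventually.of_forall fun p => mul_nonneg (sq_nonneg _) (hW0 p)),
      ← ofReal_integral_eq_lintegral_ofReal i6
        (Eventually.of_forall fun p => mul_nonneg (by positivity) (hW0 p))] at h
    exact (ENNReal.ofReal_le_ofReal_iff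
      (integral_nonneg fun p => mul_nonneg (by positivity) (hW0 p))).1 h
  set c0 := ∫ x : 𝔼, (1 + ‖x‖ ^ 2) ^ (-γ) with hc0
  set c2 := ∫ x : 𝔼, (1 + ‖x‖ ^ 2) ^ (-(γ - 1)) with hc2
  have hc2pos : 0 < c2 := integral_cauchyDensity_pos (by linarith)
  have hrel : 2 * (γ - 1) * c0 = (2 * (γ - 1) - n) * c2 := integral_cauchyDensity_shift (by linarith)
  have hWx : ∀ x y : 𝔼, W (x, y) = (1 + ‖x‖ ^ 2 + ‖y‖ ^ 2) ^ (-γ) := fun x y => by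
    simp only [hW, add_assoc]
  have j1 : ∫ p : 𝔼 × 𝔼, H p.1 ^ 2 * W p ∂(volume.prod volume) =
      c0 * ∫ x, H x ^ 2 * (1 + ‖x‖ ^ 2) ^ (-β) := by
    rw [integral_prod _ i1, ← integral_const_mul]
    refine integral_congr_ae (Eventually.of_forall fun x => ?_)
    have h := integral_mul_add_norm_sq_rpow (n := n) (A := 1 + ‖x‖ ^ 2) (γ := γ) (by positivity)
      fun _ => H x ^ 2
    simp only [hWx]
    rw [h, integral_const_mul, show (n : ℝ) / 2 - γ = -β by rw [hγ]; ring]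
    ring
  have j2 : ∫ p : 𝔼 × 𝔼, H p.2 ^ 2 * W p ∂(volume.prod volume) =
      c0 * ∫ x, H x ^ 2 * (1 + ‖x‖ ^ 2) ^ (-β) := by
    rw [← j1, ← integral_prod_swap]
    simp only [Prod.fst_swap, Prod.snd_swap, hW, add_comm]
  -- For fixed x the weight is a radial function of y, to which H is orthogonal.
  have j3 : ∫ p : 𝔼 × 𝔼, H p.1 * (H p.2 * W p) ∂(volume.prod volume) = 0 := by
    rw [integral_prod _ i3]
    refine integral_eq_zero_of_ae (Eventually.of_forall fun x => ?_)
    have h := horth (fun r => (1 + ‖x‖ ^ 2 + r ^ 2) ^ (-γ))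
      ((by fun_prop : Continuous fun r : ℝ => 1 + ‖x‖ ^ 2 + r ^ 2).rpow_const
        fun r => Or.inl (by positivity))
    simp only [hWx, Pi.zero_apply]
    rw [integral_const_mul, h, mul_zero]
  -- Scaling y by √(1 + ‖x‖²) produces an extra factor 1 + ‖x‖² from the square: this is how the
  -- weight σ² of the energy arises.
  have j4 : 2 * (γ - 1) * ∫ p : 𝔼 × 𝔼, ⟪D p.1, p.2⟫_ℝ ^ 2 * W p ∂(volume.prod volume) =
      c2 * ∫ x, ‖D x‖ ^ 2 * (1 + ‖x‖ ^ 2) ^ (1 - β) := by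
    rw [integral_prod _ i4, ← integral_const_mul, ← integral_const_mul]
    refine integral_congr_ae (Eventually.of_forall fun x => ?_)
    have hx : (0 : ℝ) < 1 + ‖x‖ ^ 2 := by positivity
    have h := integral_mul_add_norm_sq_rpow (n := n) (A := 1 + ‖x‖ ^ 2) (γ := γ) hx
      fun y => ⟪D x, y⟫_ℝ ^ 2
    simp only [hWx]
    rw [h]
    simp only [inner_smul_right, mul_pow, Real.sq_sqrt hx.le, mul_assoc, integral_const_mul]
    have h2 := integral_inner_sq_mul_cauchyDensity (D x) (γ := γ) (by linarith)
    rw [show (n : ℝ) / 2 - γ = -β by rw [hγ]; ring, show 1 - β = -β + 1 by ring,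
      Real.rpow_add_one hx.ne']
    linear_combination (1 + ‖x‖ ^ 2) ^ (-β) * (1 + ‖x‖ ^ 2) * h2
  simp only [hexp] at hmain
  have i21 : Integrable (fun p : 𝔼 × 𝔼 => H p.2 ^ 2 * W p + H p.1 ^ 2 * W p)
    (volume.prod volume) := i2.add i1
  rw [integral_sub i21 (i3.const_mul 2), integral_add i2 i1, integral_const_mul, j1, j2, j3]
    at hmain
  simp only [mul_assoc, integral_const_mul] at hmain
  set X := ∫ x, H x ^ 2 * (1 + ‖x‖ ^ 2) ^ (-β)
  set Y := ∫ x, ‖D x‖ ^ 2 * (1 + ‖x‖ ^ 2) ^ (1 - β)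
  set Z := ∫ p : 𝔼 × 𝔼, ⟪D p.1, p.2⟫_ℝ ^ 2 * W p ∂(volume.prod volume)
  have hγ1 : 0 < γ - 1 := by linarith
  have hγn : 2 * (γ - 1) - n = 2 * (β - 1) := by rw [hγ]; ring
  rw [hγn] at hrel
  -- The averaged inequality reads c₀ X ≤ Z with 2(γ − 1) Z = c₂ Y, and the shift identity gives 2(γ
  -- − 1) c₀ = 2(β − 1) c₂.
  have h3 : c2 * (2 * (β - 1) * X) ≤ c2 * Y := by
    have : (2 * (γ - 1)) * (c0 * X) ≤ (2 * (γ - 1)) * Z :=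
      mul_le_mul_of_nonneg_left (by linarith) (by linarith)
    calc c2 * (2 * (β - 1) * X) = (2 * (γ - 1)) * (c0 * X) := by linear_combination -X * hrel
      _ ≤ _ := this
      _ = _ := j4
  exact le_of_mul_le_mul_left h3 hc2pos

end Sector

/-! ### Spherical means -/

section SphereMean

variable {n : ℕ} {β : ℝ}

local notation "𝔼" => EuclideanSpace ℝ (Fin n)

/-- Integration in polar coordinates. -/
theorem integral_eq_integral_sphere {E : Type*} [NormedAddCommGroup E] [NormedSpace ℝ E]
    [MeasurableSpace E] [BorelSpace E] [FiniteDimensional ℝ E] [Nontrivial E] (μ : Measure E)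
    [μ.IsAddHaarMeasure] {f : E → ℝ} (hf : Integrable f μ) :
    ∫ x, f x ∂μ = ∫ r in Ioi (0 : ℝ), r ^ (Module.finrank ℝ E - 1) *
      ∫ θ : Metric.sphere (0 : E) 1, f (r • (θ : E)) ∂μ.toSphere := by
  have hmp := μ.measurePreserving_homeomorphUnitSphereProd
  have hemb := (homeomorphUnitSphereProd E).measurableEmbedding
  set g : Metric.sphere (0 : E) 1 × Ioi (0 : ℝ) → ℝ := fun p => f ((p.2 : ℝ) • (p.1 : E)) with hg
  have hgf : ∀ x : ({0}ᶜ : Set E), g (homeomorphUnitSphereProd E x) = f x := fun x => by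
    have hx : ‖(x : E)‖ ≠ 0 := norm_ne_zero_iff.2 x.2
    simp only [hg, homeomorphUnitSphereProd_apply_snd_coe, homeomorphUnitSphereProd_apply_fst_coe,
      smul_smul, mul_inv_cancel₀ hx, one_smul]
  have hgi : Integrable g (μ.toSphere.prod (.volumeIoiPow (Module.finrank ℝ E - 1))) := by
    rw [← hmp.integrable_comp_emb hemb]
    have : g ∘ homeomorphUnitSphereProd E = f ∘ (↑) := funext hgf
    rw [this, ← integrableOn_iff_comap_subtypeVal (measurableSet_singleton _).compl]
    exact hf.integrableOn
  calc ∫ x, f x ∂μ = ∫ x : ({(0)}ᶜ : Set E), f x ∂(μ.comap (↑)) := by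
        rw [integral_subtype_comap (measurableSet_singleton _).compl f, restrict_compl_singleton]
    _ = ∫ p, g p ∂μ.toSphere.prod (.volumeIoiPow (Module.finrank ℝ E - 1)) := by
        rw [← hmp.integral_comp hemb]
        simp only [hgf]
    _ = ∫ r : Ioi (0 : ℝ), (∫ θ, g (θ, r) ∂μ.toSphere) ∂.volumeIoiPow (Module.finrank ℝ E - 1) :=
        integral_prod_symm _ hgi
    _ = _ := by
        simp only [Measure.volumeIoiPow, ENNReal.ofReal, hg]
        rw [integral_withDensity_eq_integral_smul
          ((measurable_subtype_coe.pow_const _).real_toNNReal),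
          integral_subtype_comap measurableSet_Ioi fun a : ℝ =>
            Real.toNNReal (a ^ (Module.finrank ℝ E - 1)) •
              ∫ θ : Metric.sphere (0 : E) 1, f (a • (θ : E)) ∂μ.toSphere]
        refine setIntegral_congr_fun measurableSet_Ioi fun r hr => ?_
        simp only [NNReal.smul_def, Real.coe_toNNReal _ (pow_nonneg (le_of_lt hr) _), smul_eq_mul]

/-- The mean of a function over the sphere of radius `r`. -/
def sphereMean (f : 𝔼 → ℝ) (r : ℝ) : ℝ :=
  ((volume : Measure 𝔼).toSphere.real univ)⁻¹ *
    ∫ θ : Metric.sphere (0 : 𝔼) 1, f (r • (θ : 𝔼)) ∂(volume : Measure 𝔼).toSphere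

theorem nontrivial_euclideanSpace (hn : 1 ≤ n) : Nontrivial 𝔼 := by
  have : Nonempty (Fin n) := ⟨⟨0, by omega⟩⟩
  infer_instance

theorem toSphere_real_univ_pos (hn : 1 ≤ n) : 0 < (volume : Measure 𝔼).toSphere.real univ := by
  have := nontrivial_euclideanSpace hn
  rw [Measure.toSphere_real_apply_univ]
  have h1 : 0 < volume.real (Metric.ball (0 : 𝔼) 1) :=
    ENNReal.toReal_pos (Metric.measure_ball_pos _ _ one_pos).ne' measure_ball_lt_top.ne
  have : 0 < Module.finrank ℝ 𝔼 := Module.finrank_pos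
  positivity

theorem sphereMean_mul_norm (f : 𝔼 → ℝ) (k : ℝ → ℝ) {r : ℝ} (hr : 0 ≤ r) :
    sphereMean (fun x => f x * k ‖x‖) r = sphereMean f r * k r := by
  have h : ∀ θ : Metric.sphere (0 : 𝔼) 1, ‖r • (θ : 𝔼)‖ = r := fun θ => by
    rw [norm_smul, norm_eq_of_mem_sphere, mul_one, Real.norm_of_nonneg hr]
  simp only [sphereMean, h, integral_mul_const, mul_assoc]

theorem sphereMean_comp_norm (hn : 1 ≤ n) (k : ℝ → ℝ) {r : ℝ} (hr : 0 ≤ r) :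
    sphereMean (fun x : 𝔼 => k ‖x‖) r = k r := by
  have h := sphereMean_mul_norm (fun _ : 𝔼 => 1) k hr
  simp only [one_mul] at h
  rw [h, sphereMean, integral_const, smul_eq_mul, mul_one,
    inv_mul_cancel₀ (toSphere_real_univ_pos hn).ne', one_mul]

theorem integral_eq_integral_sphereMean (hn : 1 ≤ n) {f : 𝔼 → ℝ} (hf : Integrable f) :
    ∫ x, f x = (volume : Measure 𝔼).toSphere.real univ *
      ∫ r in Ioi (0 : ℝ), r ^ (n - 1) * sphereMean f r := by
  have := nontrivial_euclideanSpace hn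
  rw [integral_eq_integral_sphere _ hf, ← integral_const_mul, finrank_euclideanSpace,
    Fintype.card_fin]
  refine setIntegral_congr_fun measurableSet_Ioi fun r _ => ?_
  simp only [sphereMean]
  rw [mul_left_comm, mul_inv_cancel_left₀ (toSphere_real_univ_pos hn).ne']

/-- A function and its spherical mean have the same integral against radial functions. -/
theorem integral_mul_norm_eq_sphereMean (hn : 1 ≤ n) {f : 𝔼 → ℝ} {k : ℝ → ℝ}
    (h1 : Integrable fun x => f x * k ‖x‖) (h2 : Integrable fun x : 𝔼 => sphereMean f ‖x‖ * k ‖x‖) :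
    ∫ x, f x * k ‖x‖ = ∫ x : 𝔼, sphereMean f ‖x‖ * k ‖x‖ := by
  rw [integral_eq_integral_sphereMean hn h1, integral_eq_integral_sphereMean hn h2]
  congr 1
  refine setIntegral_congr_fun measurableSet_Ioi fun r hr => ?_
  rw [sphereMean_mul_norm f k (le_of_lt hr),
    sphereMean_comp_norm hn (fun r => sphereMean f r * k r) (le_of_lt hr)]

/-- The integral of ⟪p, x⟫ against a radial weight is zero by parity on ℝⁿ; in polar coordinates it
is the spherical mean times positive factors. The exponent n + 2 only serves to ensure
integrability. -/
theorem sphereMean_inner_eq_zero (hn : 1 ≤ n) (p : 𝔼) : sphereMean (fun x : 𝔼 => ⟪p, x⟫_ℝ) 1 = 0 := by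
  have hi : Integrable fun x : 𝔼 => ⟪p, x⟫_ℝ * (1 + ‖x‖ ^ 2) ^ (-((n : ℝ) + 2)) := by
    refine ((integrable_cauchyDensity (n := n) (β := (n : ℝ) + 1) (by linarith [n.cast_nonneg (α := ℝ)])).const_mul
      ‖p‖).mono' ?_ (Eventually.of_forall fun x => ?_)
    · have := continuous_cauchyDensity n (-((n : ℝ) + 2))
      exact (by fun_prop : Continuous _).aestronglyMeasurable
    · have h0 : (0 : ℝ) < 1 + ‖x‖ ^ 2 := by positivity
      rw [norm_mul, Real.norm_of_nonneg (Real.rpow_nonneg h0.le _),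
        show -((n : ℝ) + 1) = -((n : ℝ) + 2) + 1 by ring, Real.rpow_add_one h0.ne',
        mul_comm (_ ^ _) (1 + _), ← mul_assoc]
      gcongr
      refine (norm_inner_le_norm p x).trans ?_
      gcongr
      nlinarith [sq_nonneg (‖x‖ - 1), sq_nonneg ‖x‖]
  have hz : ∫ x : 𝔼, ⟪p, x⟫_ℝ * (1 + ‖x‖ ^ 2) ^ (-((n : ℝ) + 2)) = 0 := by
    have h := integral_neg_eq_self (fun x : 𝔼 => ⟪p, x⟫_ℝ * (1 + ‖x‖ ^ 2) ^ (-((n : ℝ) + 2))) volume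
    simp only [inner_neg_right, norm_neg, neg_mul, integral_neg] at h
    linarith
  rw [integral_eq_integral_sphereMean hn hi] at hz
  have e : ∀ r ∈ Ioi (0 : ℝ), r ^ (n - 1) *
      sphereMean (fun x : 𝔼 => ⟪p, x⟫_ℝ * (1 + ‖x‖ ^ 2) ^ (-((n : ℝ) + 2))) r =
      sphereMean (fun x : 𝔼 => ⟪p, x⟫_ℝ) 1 * radialDensity (n + 1) ((n : ℝ) + 2) r := fun r hr => by
    rw [sphereMean_mul_norm (fun x : 𝔼 => ⟪p, x⟫_ℝ) (fun r => (1 + r ^ 2) ^ (-((n : ℝ) + 2)))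
      (le_of_lt hr)]
    have : sphereMean (fun x : 𝔼 => ⟪p, x⟫_ℝ) r = r * sphereMean (fun x : 𝔼 => ⟪p, x⟫_ℝ) 1 := by
      simp only [sphereMean, inner_smul_right, integral_const_mul, one_smul]
      ring
    rw [this, radialDensity, add_tsub_cancel_right]
    obtain ⟨m, rfl⟩ : ∃ m, n = m + 1 := ⟨n - 1, by omega⟩
    rw [add_tsub_cancel_right, pow_succ]
    ring
  rw [setIntegral_congr_fun measurableSet_Ioi e, integral_const_mul] at hz
  have hpos := integral_radialDensity_pos (n := n + 1) (by omega) (β := (n : ℝ) + 2)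
    (by push_cast; linarith [n.cast_nonneg (α := ℝ)])
  have hz' := (mul_eq_zero.1 hz).resolve_left (toSphere_real_univ_pos hn).ne'
  exact (mul_eq_zero.1 hz').resolve_right hpos.ne'

theorem continuous_integral_sphere {F : ℝ → Metric.sphere (0 : 𝔼) 1 → ℝ}
    (hF : Continuous (Function.uncurry F)) :
    Continuous fun r => ∫ θ, F r θ ∂(volume : Measure 𝔼).toSphere := by
  simpa using continuous_parametric_integral_of_continuous
    (μ := (volume : Measure 𝔼).toSphere) hF isCompact_univ

theorem continuous_sphereMean {f : 𝔼 → ℝ} (hf : Continuous f) : Continuous (sphereMean f) := by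
  refine continuous_const.mul (continuous_integral_sphere
    (F := fun r (θ : Metric.sphere (0 : 𝔼) 1) => f (r • (θ : 𝔼))) ?_)
  simp only [Function.uncurry_def]
  fun_prop

theorem sphereMean_eq_zero {f : 𝔼 → ℝ} {R r : ℝ} (hR : ∀ x, R < ‖x‖ → f x = 0) (hr : R < |r|) :
    sphereMean f r = 0 := by
  have : ∀ θ : Metric.sphere (0 : 𝔼) 1, f (r • (θ : 𝔼)) = 0 := fun θ => hR _ (by
    rw [norm_smul, norm_eq_of_mem_sphere, mul_one, Real.norm_eq_abs]; exact hr)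
  simp [sphereMean, this]

theorem exists_eq_zero_of_hasCompactSupport {F : Type*} [Zero F] {f : 𝔼 → F} (hf : HasCompactSupport f) :
    ∃ R, 0 ≤ R ∧ ∀ x, R < ‖x‖ → f x = 0 := by
  obtain ⟨R, hR⟩ := hf.isCompact.isBounded.subset_closedBall 0
  refine ⟨max R 0, le_max_right _ _, fun x hx => ?_⟩
  by_contra h
  have := hR (subset_tsupport f h)
  rw [Metric.mem_closedBall, dist_zero_right] at this
  exact absurd (this.trans (le_max_left R 0)) (not_le.2 hx)

theorem hasCompactSupport_sphereMean {f : 𝔼 → ℝ} (hf : HasCompactSupport f) :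
    HasCompactSupport (sphereMean f) := by
  obtain ⟨R, -, hR⟩ := exists_eq_zero_of_hasCompactSupport hf
  refine HasCompactSupport.intro (isCompact_Icc (a := -R) (b := R)) fun r hr => ?_
  refine sphereMean_eq_zero hR ?_
  rw [← not_le, abs_le]
  exact hr

/-- The derivative of the spherical mean. -/
def sphereMeanDeriv (h : 𝔼 → ℝ) (r : ℝ) : ℝ :=
  ((volume : Measure 𝔼).toSphere.real univ)⁻¹ *
    ∫ θ : Metric.sphere (0 : 𝔼) 1, fderiv ℝ h (r • (θ : 𝔼)) θ ∂(volume : Measure 𝔼).toSphere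

theorem continuous_sphereMeanDeriv {h : 𝔼 → ℝ} (hh : ContDiff ℝ 1 h) :
    Continuous (sphereMeanDeriv h) := by
  have hc : Continuous (fderiv ℝ h) := hh.continuous_fderiv one_ne_zero
  refine continuous_const.mul (continuous_integral_sphere
    (F := fun r (θ : Metric.sphere (0 : 𝔼) 1) => fderiv ℝ h (r • (θ : 𝔼)) θ) ?_)
  simp only [Function.uncurry_def]
  fun_prop

theorem hasDerivAt_sphereMean {h : 𝔼 → ℝ} (hh : ContDiff ℝ 1 h) (hs : HasCompactSupport h) (r : ℝ) :
    HasDerivAt (sphereMean h) (sphereMeanDeriv h r) r := by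
  have hc : Continuous (fderiv ℝ h) := hh.continuous_fderiv one_ne_zero
  have hh0 := hh.continuous
  obtain ⟨K, hK⟩ := (hs.fderiv (𝕜 := ℝ)).exists_bound_of_continuous hc
  refine HasDerivAt.const_mul _ ?_
  refine (hasDerivAt_integral_of_dominated_loc_of_deriv_le (bound := fun _ => K)
    (F := fun r (θ : Metric.sphere (0 : 𝔼) 1) => h (r • (θ : 𝔼)))
    (F' := fun r (θ : Metric.sphere (0 : 𝔼) 1) => fderiv ℝ h (r • (θ : 𝔼)) θ)
    (univ_mem (f := 𝓝 r)) ?_ ?_ ?_ ?_ (integrable_const K) ?_).2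
  · exact Eventually.of_forall fun r => (by fun_prop : Continuous _).aestronglyMeasurable
  · obtain ⟨K', hK'⟩ := hs.exists_bound_of_continuous hh0
    exact (integrable_const K').mono' (by fun_prop : Continuous _).aestronglyMeasurable
      (Eventually.of_forall fun θ => hK' _)
  · exact (by fun_prop : Continuous _).aestronglyMeasurable
  · refine Eventually.of_forall fun θ r _ => ?_
    refine ((fderiv ℝ h (r • (θ : 𝔼))).le_opNorm _).trans ?_
    rw [norm_eq_of_mem_sphere, mul_one]
    exact hK _
  · refine Eventually.of_forall fun θ r _ => ?_
    have h1 : HasDerivAt (fun r : ℝ => r • (θ : 𝔼)) (θ : 𝔼) r := by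
      simpa using (hasDerivAt_id r).smul_const (θ : 𝔼)
    exact ((hh.differentiable one_ne_zero) _).hasFDerivAt.comp_hasDerivAt r h1

theorem sphereMeanDeriv_zero (hn : 1 ≤ n) (h : 𝔼 → ℝ) : sphereMeanDeriv h 0 = 0 := by
  have := sphereMean_inner_eq_zero hn (gradient h 0)
  simpa only [sphereMean, inner_gradient_left, one_smul, sphereMeanDeriv, zero_smul] using this

theorem sphereMean_fderiv_self (h : 𝔼 → ℝ) (r : ℝ) :
    sphereMean (fun x => fderiv ℝ h x x) r = r * sphereMeanDeriv h r := by
  simp only [sphereMean, sphereMeanDeriv, map_smul, smul_eq_mul, integral_const_mul]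
  ring

/-- The gradient of the radialisation of `h`. -/
def meanGradient (h : 𝔼 → ℝ) (x : 𝔼) : 𝔼 := (sphereMeanDeriv h ‖x‖ / ‖x‖) • x

theorem norm_meanGradient (hn : 1 ≤ n) (h : 𝔼 → ℝ) (x : 𝔼) :
    ‖meanGradient h x‖ = |sphereMeanDeriv h ‖x‖| := by
  rcases eq_or_ne x 0 with rfl | hx
  · simp [meanGradient, sphereMeanDeriv_zero hn]
  · rw [meanGradient, norm_smul, Real.norm_eq_abs, abs_div, abs_norm,
      div_mul_cancel₀ _ (norm_ne_zero_iff.2 hx)]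

theorem continuous_meanGradient (hn : 1 ≤ n) {h : 𝔼 → ℝ} (hh : ContDiff ℝ 1 h) :
    Continuous (meanGradient h) := by
  have hc := continuous_sphereMeanDeriv hh
  refine continuous_iff_continuousAt.2 fun x => ?_
  rcases eq_or_ne x 0 with rfl | hx
  · rw [ContinuousAt, show meanGradient h 0 = 0 by simp [meanGradient], tendsto_zero_iff_norm_tendsto_zero]
    simp only [norm_meanGradient hn]
    have : Continuous fun x : 𝔼 => |sphereMeanDeriv h ‖x‖| := by fun_prop
    simpa [sphereMeanDeriv_zero hn] using this.tendsto 0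
  · have : ‖x‖ ≠ 0 := norm_ne_zero_iff.2 hx
    have h1 : ContinuousAt (fun x : 𝔼 => sphereMeanDeriv h ‖x‖) x := by fun_prop
    exact (h1.div continuous_norm.continuousAt this).smul continuousAt_id

/-- Away from 0, the chain rule through ‖y‖² and the square root. At 0, where the norm is not
differentiable, the spherical mean has zero derivative because linear functions average to zero on
the sphere. -/
theorem hasFDerivAt_sphereMean_norm (hn : 1 ≤ n) {h : 𝔼 → ℝ} (hh : ContDiff ℝ 1 h)
    (hs : HasCompactSupport h) (x : 𝔼) :
    HasFDerivAt (fun y : 𝔼 => sphereMean h ‖y‖) (innerSL ℝ (meanGradient h x)) x := by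
  rcases eq_or_ne x 0 with rfl | hx
  · have h0 := hasDerivAt_sphereMean hh hs 0
    rw [sphereMeanDeriv_zero hn, hasDerivAt_iff_isLittleO] at h0
    simp only [sub_zero, smul_zero] at h0
    have h1 : Tendsto (fun x : 𝔼 => ‖x‖) (𝓝 0) (𝓝 0) := by
      simpa using (continuous_norm (E := 𝔼)).tendsto 0
    rw [hasFDerivAt_iff_isLittleO]
    have h2 := (h0.comp_tendsto h1).of_norm_right
    simpa [meanGradient, Function.comp_def] using h2
  · have hx0 : 0 < ‖x‖ := norm_pos_iff.2 hx
    have h1 : HasDerivAt (fun s => sphereMean h (√s)) (sphereMeanDeriv h ‖x‖ * (1 / (2 * ‖x‖)))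
        (‖x‖ ^ 2) := by
      have h2 := Real.hasDerivAt_sqrt (x := ‖x‖ ^ 2) (by positivity)
      have h3 := hasDerivAt_sphereMean hh hs (√(‖x‖ ^ 2))
      have := h3.comp (‖x‖ ^ 2) h2
      rwa [Real.sqrt_sq hx0.le] at this
    have h4 := hasFDerivAt_comp_norm_sq h1
    simp only [Real.sqrt_sq (norm_nonneg _)] at h4
    convert! h4 using 1
    rw [meanGradient, map_smul]
    congr 1
    field_simp

end SphereMean

/-! ### The Poincaré inequality for the generalized Cauchy distribution -/

section CauchyPoincare

variable {n : ℕ} {β : ℝ}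

local notation "𝔼" => EuclideanSpace ℝ (Fin n)

theorem hasCompactSupport_comp_norm {F : Type*} [Zero F] {k : ℝ → F} (hk : HasCompactSupport k) :
    HasCompactSupport fun x : 𝔼 => k ‖x‖ := by
  obtain ⟨R, hR⟩ := hk.isCompact.isBounded.subset_closedBall 0
  refine HasCompactSupport.intro (isCompact_closedBall (0 : 𝔼) R) fun x hx => ?_
  by_contra h
  have := hR (subset_tsupport k h)
  rw [Metric.mem_closedBall, dist_zero_right, norm_norm] at this
  exact hx (by rwa [Metric.mem_closedBall, dist_zero_right])

theorem deriv_sphereMean {h : 𝔼 → ℝ} (hh : ContDiff ℝ 1 h) (hs : HasCompactSupport h) :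
    deriv (sphereMean h) = sphereMeanDeriv h :=
  funext fun r => (hasDerivAt_sphereMean hh hs r).deriv

theorem contDiff_sphereMean {h : 𝔼 → ℝ} (hh : ContDiff ℝ 1 h) (hs : HasCompactSupport h) :
    ContDiff ℝ 1 (sphereMean h) := by
  rw [contDiff_one_iff_deriv]
  refine ⟨fun r => (hasDerivAt_sphereMean hh hs r).differentiableAt, ?_⟩
  rw [deriv_sphereMean hh hs]
  exact continuous_sphereMeanDeriv hh

theorem hasCompactSupport_meanGradient {h : 𝔼 → ℝ} (hh : ContDiff ℝ 1 h)
    (hs : HasCompactSupport h) : HasCompactSupport (meanGradient h) := by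
  have h1 : HasCompactSupport (sphereMeanDeriv h) := by
    rw [← deriv_sphereMean hh hs]
    exact (hasCompactSupport_sphereMean hs).deriv
  have h2 : HasCompactSupport fun r => sphereMeanDeriv h r / r := by
    simp only [div_eq_mul_inv]
    exact h1.mul_right
  exact (hasCompactSupport_comp_norm h2).smul_right (f' := fun x : 𝔼 => x)

theorem continuous_gradient {h : 𝔼 → ℝ} (hh : ContDiff ℝ 1 h) : Continuous (gradient h) :=
  (InnerProductSpace.toDual ℝ 𝔼).symm.continuous.comp (hh.continuous_fderiv one_ne_zero)

theorem hasCompactSupport_gradient {h : 𝔼 → ℝ} (hs : HasCompactSupport h) :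
    HasCompactSupport (gradient h) :=
  (hs.fderiv (𝕜 := ℝ)).comp_left (map_zero (InnerProductSpace.toDual ℝ 𝔼).symm)

theorem hasFDerivAt_gradient {h : 𝔼 → ℝ} (hh : ContDiff ℝ 1 h) (x : 𝔼) :
    HasFDerivAt h (innerSL ℝ (gradient h x)) x := by
  have : innerSL ℝ (gradient h x) = fderiv ℝ h x := by
    ext v
    rw [innerSL_apply_apply, inner_gradient_left]
  rw [this]
  exact (hh.differentiable one_ne_zero x).hasFDerivAt

theorem integrable_cauchyMeasure_of_hasCompactSupport (hβ : (n : ℝ) / 2 < β) {f : 𝔼 → ℝ}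
    (hf : Continuous f) (hs : HasCompactSupport f) : Integrable f (cauchyMeasure n β) := by
  have := isProbabilityMeasure_cauchyMeasure hβ
  exact hf.integrable_of_hasCompactSupport hs

/-- The deviation from the spherical mean is orthogonal to the radial functions. -/
theorem integral_sub_sphereMean_mul (hn : 1 ≤ n) {h : 𝔼 → ℝ} (hh : Continuous h)
    (hs : HasCompactSupport h) {k : ℝ → ℝ} (hk : Continuous k) :
    ∫ x : 𝔼, (h x - sphereMean h ‖x‖) * k ‖x‖ = 0 := by
  have hc := continuous_sphereMean hh
  have h1 : Integrable fun x => h x * k ‖x‖ :=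
    (by fun_prop : Continuous fun x => h x * k ‖x‖).integrable_of_hasCompactSupport hs.mul_right
  have h2 : Integrable fun x : 𝔼 => sphereMean h ‖x‖ * k ‖x‖ :=
    (by fun_prop : Continuous fun x : 𝔼 => sphereMean h ‖x‖ * k ‖x‖).integrable_of_hasCompactSupport
      (hasCompactSupport_comp_norm (hasCompactSupport_sphereMean hs)).mul_right
  simp only [sub_mul]
  rw [integral_sub h1 h2, integral_mul_norm_eq_sphereMean hn h1 h2, sub_self]

theorem integral_cauchyMeasure_sub_sphereMean_mul (hn : 1 ≤ n) (hβ : (n : ℝ) / 2 < β) {h : 𝔼 → ℝ}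
    (hh : Continuous h) (hs : HasCompactSupport h) {k : ℝ → ℝ} (hk : Continuous k) :
    ∫ x, (h x - sphereMean h ‖x‖) * k ‖x‖ ∂(cauchyMeasure n β) = 0 := by
  have hc : Continuous fun r : ℝ => k r * (1 + r ^ 2) ^ (-β) :=
    hk.mul ((by fun_prop : Continuous fun r : ℝ => 1 + r ^ 2).rpow_const
      fun r => Or.inl (by positivity))
  rw [integral_cauchyMeasure hβ]
  have := integral_sub_sphereMean_mul hn hh hs hc
  simp only [← mul_assoc] at this
  rw [this, zero_div]

/-- Orthogonality of the two sectors for the energy. Against the radial field `meanGradient h` only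
the radial derivative of h is seen, and its spherical mean is the derivative of the spherical mean.
-/
theorem integral_cauchyMeasure_inner_gradient_sub (hn : 1 ≤ n) (hβ : (n : ℝ) / 2 < β) {h : 𝔼 → ℝ}
    (hh : ContDiff ℝ 1 h) (hs : HasCompactSupport h) :
    ∫ x, (1 + ‖x‖ ^ 2) * ⟪gradient h x - meanGradient h x, meanGradient h x⟫_ℝ
      ∂(cauchyMeasure n β) = 0 := by
  have c0 := continuous_cauchyDensity n (-β)
  have c1 := continuous_gradient hh
  have c2 := continuous_meanGradient hn hh
  have s2 := hasCompactSupport_meanGradient hh hs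
  let k : ℝ → ℝ := fun r => sphereMeanDeriv h r / r * ((1 + r ^ 2) * (1 + r ^ 2) ^ (-β))
  have e1 : ∀ x : 𝔼, (1 + ‖x‖ ^ 2) * ⟪gradient h x, meanGradient h x⟫_ℝ * (1 + ‖x‖ ^ 2) ^ (-β) =
      fderiv ℝ h x x * k ‖x‖ := fun x => by
    simp only [k]
    rw [meanGradient, inner_smul_right, inner_gradient_left]
    ring
  have e2 : ∀ x : 𝔼, (1 + ‖x‖ ^ 2) * ⟪meanGradient h x, meanGradient h x⟫_ℝ *
      (1 + ‖x‖ ^ 2) ^ (-β) = sphereMean (fun x => fderiv ℝ h x x) ‖x‖ * k ‖x‖ := fun x => by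
    simp only [k]
    rw [real_inner_self_eq_norm_sq, norm_meanGradient hn, sq_abs, sphereMean_fderiv_self]
    rcases eq_or_ne ‖x‖ 0 with h0 | h0
    · rw [h0, sphereMeanDeriv_zero hn]; ring
    · field_simp
  have i1 : Integrable fun x : 𝔼 => (1 + ‖x‖ ^ 2) * ⟪gradient h x, meanGradient h x⟫_ℝ *
      (1 + ‖x‖ ^ 2) ^ (-β) := by
    refine (by fun_prop : Continuous _).integrable_of_hasCompactSupport ?_
    refine HasCompactSupport.mul_right (HasCompactSupport.mul_left ?_)
    exact s2.mono fun x hx => by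
      contrapose! hx
      simp only [Function.mem_support, not_not] at hx ⊢
      rw [hx, inner_zero_right]
  have i2 : Integrable fun x : 𝔼 => (1 + ‖x‖ ^ 2) * ⟪meanGradient h x, meanGradient h x⟫_ℝ *
      (1 + ‖x‖ ^ 2) ^ (-β) := by
    refine (by fun_prop : Continuous _).integrable_of_hasCompactSupport ?_
    refine HasCompactSupport.mul_right (HasCompactSupport.mul_left ?_)
    exact s2.mono fun x hx => by
      contrapose! hx
      simp only [Function.mem_support, not_not] at hx ⊢
      rw [hx, inner_zero_right]
  rw [integral_cauchyMeasure hβ]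
  simp only [inner_sub_left, mul_sub, sub_mul]
  rw [integral_sub i1 i2]
  simp only [e1, e2] at i1 i2 ⊢
  rw [integral_mul_norm_eq_sphereMean hn i1 i2, sub_self, zero_div]

theorem sphereMean_poincare (hn : 1 ≤ n) (hβ : (n : ℝ) / 2 < β) (hβ1 : 1 ≤ β) {a : ℝ} (ha0 : 0 ≤ a)
    (ha1 : a ≤ 1) (hat : a ≤ β - n / 2) {h : 𝔼 → ℝ} (hh : ContDiff ℝ 1 h)
    (hs : HasCompactSupport h) :
    4 * a * (β - n / 2 - a) * (∫ x, sphereMean h ‖x‖ ^ 2 ∂(cauchyMeasure n β) -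
      (∫ x, sphereMean h ‖x‖ ∂(cauchyMeasure n β)) ^ 2) ≤
      ∫ x, (1 + ‖x‖ ^ 2) * ‖meanGradient h x‖ ^ 2 ∂(cauchyMeasure n β) := by
  have hp := radial_poincare hn hβ hβ1 ha0 ha1 hat (contDiff_sphereMean hh hs)
    (hasCompactSupport_sphereMean hs)
  have hZ := integral_radialDensity_pos hn hβ
  simp only [norm_meanGradient hn, sq_abs]
  rw [integral_cauchyMeasure_norm hn hβ fun r => sphereMean h r ^ 2,
    integral_cauchyMeasure_norm hn hβ fun r => sphereMean h r,
    integral_cauchyMeasure_norm hn hβ fun r => (1 + r ^ 2) * sphereMeanDeriv h r ^ 2,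
    integral_radialMeasure hn hβ, integral_radialMeasure hn hβ, integral_radialMeasure hn hβ,
    le_div_iff₀ hZ]
  rw [deriv_sphereMean hh hs] at hp
  refine le_trans (le_of_eq ?_) hp
  field_simp

theorem sector_poincare_cauchyMeasure (hn : 1 ≤ n) (hβ : (n : ℝ) / 2 < β) (hβ1 : 3 / 2 < β)
    {h : 𝔼 → ℝ} (hh : ContDiff ℝ 1 h) (hs : HasCompactSupport h) :
    2 * (β - 1) * ∫ x, (h x - sphereMean h ‖x‖) ^ 2 ∂(cauchyMeasure n β) ≤
      ∫ x, (1 + ‖x‖ ^ 2) * ‖gradient h x - meanGradient h x‖ ^ 2 ∂(cauchyMeasure n β) := by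
  have hp := sector_poincare (β := β) hβ1 (H := fun x => h x - sphereMean h ‖x‖)
    (D := fun x => gradient h x - meanGradient h x) (fun x => ?_)
    ((continuous_gradient hh).sub (continuous_meanGradient hn hh))
    (hs.sub (hasCompactSupport_comp_norm (hasCompactSupport_sphereMean hs)))
    ((hasCompactSupport_gradient hs).sub (hasCompactSupport_meanGradient hh hs))
    (fun k hk => integral_sub_sphereMean_mul hn hh.continuous hs hk)
  · rw [integral_cauchyMeasure hβ, integral_cauchyMeasure hβ, ← mul_div_assoc]
    refine div_le_div_of_nonneg_right (hp.trans (le_of_eq ?_)) (integral_cauchyDensity_pos hβ).le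
    refine integral_congr_ae (Eventually.of_forall fun x => ?_)
    have h0 : (0 : ℝ) < 1 + ‖x‖ ^ 2 := by positivity
    simp only
    rw [sub_eq_add_neg 1 β, Real.rpow_add h0, Real.rpow_one]
    ring
  · rw [map_sub]
    exact (hasFDerivAt_gradient hh x).sub (hasFDerivAt_sphereMean_norm hn hh hs x)

/-- The weighted Poincaré inequality for the generalized Cauchy distribution. -/
theorem cauchy_poincare (hn : 1 ≤ n) (hβ : (n : ℝ) / 2 < β) (hβ1 : 3 / 2 < β) {a l : ℝ}
    (ha0 : 0 ≤ a) (ha1 : a ≤ 1) (hat : a ≤ β - n / 2) (hl1 : l ≤ 4 * a * (β - n / 2 - a))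
    (hl2 : l ≤ 2 * (β - 1)) {h : 𝔼 → ℝ} (hh : ContDiff ℝ 1 h) (hs : HasCompactSupport h) :
    l * (∫ x, h x ^ 2 ∂(cauchyMeasure n β) - (∫ x, h x ∂(cauchyMeasure n β)) ^ 2) ≤
      ∫ x, (1 + ‖x‖ ^ 2) * ‖gradient h x‖ ^ 2 ∂(cauchyMeasure n β) := by
  have hprob := isProbabilityMeasure_cauchyMeasure hβ
  have h1 := sector_poincare_cauchyMeasure hn hβ hβ1 hh hs
  have h2 := sphereMean_poincare hn hβ (by linarith) ha0 ha1 hat hh hs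
  have h3 := integral_cauchyMeasure_inner_gradient_sub hn hβ hh hs
  have h4 := integral_cauchyMeasure_sub_sphereMean_mul hn hβ hh.continuous hs
    (continuous_sphereMean hh.continuous)
  have h5 := integral_cauchyMeasure_sub_sphereMean_mul hn hβ hh.continuous hs
    (continuous_const : Continuous fun _ : ℝ => (1 : ℝ))
  have ch := hh.continuous
  have cA : Continuous fun x : 𝔼 => sphereMean h ‖x‖ := (continuous_sphereMean ch).comp continuous_norm
  have sA : HasCompactSupport fun x : 𝔼 => sphereMean h ‖x‖ :=
    hasCompactSupport_comp_norm (hasCompactSupport_sphereMean hs)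
  have cG := continuous_gradient hh
  have cM := continuous_meanGradient hn hh
  have sG := hasCompactSupport_gradient hs
  have sM := hasCompactSupport_meanGradient hh hs
  have int : ∀ {f : 𝔼 → ℝ}, Continuous f → HasCompactSupport f → Integrable f (cauchyMeasure n β) :=
    fun hf hs => integrable_cauchyMeasure_of_hasCompactSupport hβ hf hs
  have sq_supp : ∀ {f : 𝔼 → ℝ}, HasCompactSupport f → HasCompactSupport fun x => f x ^ 2 :=
    fun hf => hf.comp_left (g := fun y : ℝ => y ^ 2) (by simp)
  set A : 𝔼 → ℝ := fun x => sphereMean h ‖x‖ with hA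
  set M := meanGradient h with hM
  have sH : HasCompactSupport fun x => h x - A x := hs.sub sA
  have sD : HasCompactSupport fun x => gradient h x - M x := sG.sub sM
  have iH : Integrable (fun x => (h x - A x) ^ 2) (cauchyMeasure n β) :=
    int (by fun_prop) (sq_supp sH)
  have iHA : Integrable (fun x => (h x - A x) * A x) (cauchyMeasure n β) :=
    int (by fun_prop) sA.mul_left
  have iA2 : Integrable (fun x => A x ^ 2) (cauchyMeasure n β) := int (by fun_prop) (sq_supp sA)
  have iA : Integrable A (cauchyMeasure n β) := int cA sA
  have ih : Integrable h (cauchyMeasure n β) := int ch hs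
  have iD : Integrable (fun x => (1 + ‖x‖ ^ 2) * ‖gradient h x - M x‖ ^ 2) (cauchyMeasure n β) :=
    int (by fun_prop) (sq_supp sD.norm).mul_left
  have iM : Integrable (fun x => (1 + ‖x‖ ^ 2) * ‖M x‖ ^ 2) (cauchyMeasure n β) :=
    int (by fun_prop) (sq_supp sM.norm).mul_left
  have iDM : Integrable (fun x => (1 + ‖x‖ ^ 2) * ⟪gradient h x - M x, M x⟫_ℝ)
      (cauchyMeasure n β) := by
    refine int (by fun_prop) (HasCompactSupport.mul_left (sM.mono fun x hx => ?_))
    contrapose! hx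
    simp only [Function.mem_support, not_not] at hx ⊢
    rw [hx, inner_zero_right]
  have e1 : ∫ x, h x ^ 2 ∂(cauchyMeasure n β) =
      ∫ x, (h x - A x) ^ 2 ∂(cauchyMeasure n β) + ∫ x, A x ^ 2 ∂(cauchyMeasure n β) := by
    have : ∀ x, h x ^ 2 = (h x - A x) ^ 2 + A x ^ 2 + 2 * ((h x - A x) * A x) := fun x => by ring
    simp only [this]
    have i12 : Integrable (fun x => (h x - A x) ^ 2 + A x ^ 2) (cauchyMeasure n β) := iH.add iA2
    rw [integral_add i12 (iHA.const_mul 2), integral_add iH iA2, integral_const_mul, h4, mul_zero,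
      add_zero]
  have e2 : ∫ x, h x ∂(cauchyMeasure n β) = ∫ x, A x ∂(cauchyMeasure n β) := by
    simp only [mul_one] at h5
    rw [integral_sub ih iA] at h5
    linarith
  have e3 : ∫ x, (1 + ‖x‖ ^ 2) * ‖gradient h x‖ ^ 2 ∂(cauchyMeasure n β) =
      ∫ x, (1 + ‖x‖ ^ 2) * ‖gradient h x - M x‖ ^ 2 ∂(cauchyMeasure n β) +
        ∫ x, (1 + ‖x‖ ^ 2) * ‖M x‖ ^ 2 ∂(cauchyMeasure n β) := by
    have : ∀ x, (1 + ‖x‖ ^ 2) * ‖gradient h x‖ ^ 2 = (1 + ‖x‖ ^ 2) * ‖gradient h x - M x‖ ^ 2 +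
        (1 + ‖x‖ ^ 2) * ‖M x‖ ^ 2 + 2 * ((1 + ‖x‖ ^ 2) * ⟪gradient h x - M x, M x⟫_ℝ) := fun x => by
      have := norm_add_sq_real (gradient h x - M x) (M x)
      rw [sub_add_cancel] at this
      rw [this]
      ring
    simp only [this]
    have i12 : Integrable (fun x => (1 + ‖x‖ ^ 2) * ‖gradient h x - M x‖ ^ 2 +
        (1 + ‖x‖ ^ 2) * ‖M x‖ ^ 2) (cauchyMeasure n β) := iD.add iM
    rw [integral_add i12 (iDM.const_mul 2), integral_add iD iM, integral_const_mul, h3, mul_zero,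
      add_zero]
  have hX : 0 ≤ ∫ x, (h x - A x) ^ 2 ∂(cauchyMeasure n β) := integral_nonneg fun x => sq_nonneg _
  have hV : 0 ≤ ∫ x, A x ^ 2 ∂(cauchyMeasure n β) - (∫ x, A x ∂(cauchyMeasure n β)) ^ 2 := by
    set m := ∫ x, A x ∂(cauchyMeasure n β) with hm
    have h0 : 0 ≤ ∫ x, (A x - m) ^ 2 ∂(cauchyMeasure n β) := integral_nonneg fun x => sq_nonneg _
    have : ∀ x, (A x - m) ^ 2 = A x ^ 2 - (2 * m * A x - m ^ 2) := fun x => by ring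
    simp only [this] at h0
    have iL : Integrable (fun x => 2 * m * A x - m ^ 2) (cauchyMeasure n β) :=
      (iA.const_mul _).sub (integrable_const _)
    rw [integral_sub iA2 iL,
      integral_sub (iA.const_mul _) (integrable_const _), integral_const_mul, ← hm] at h0
    simp only [integral_const, probReal_univ, smul_eq_mul, one_mul] at h0
    linarith
  -- Variance and energy are both sums over the two sectors, so any l below both sector constants is
  -- admissible.
  rw [e1, e2, e3, add_sub_assoc, mul_add]
  exact add_le_add ((mul_le_mul_of_nonneg_right hl2 hX).trans h1)
    ((mul_le_mul_of_nonneg_right hl1 hV).trans h2)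

end CauchyPoincare

/-! ### The spectral gaps -/

section SpectralGap

variable {n : ℕ} {β : ℝ}

/-- The spectral gap of the radial operator, as a function of `β - n / 2`. -/
def radialGap (t : ℝ) : ℝ := if t ≤ 2 then t ^ 2 else 4 * (t - 1)

theorem radialGap_of_le {t : ℝ} (ht : t ≤ 2) : radialGap t = t ^ 2 := if_pos ht

theorem radialGap_of_lt {t : ℝ} (ht : 2 < t) : radialGap t = 4 * (t - 1) := if_neg ht.not_ge

theorem radialGap_pos {t : ℝ} (ht : 0 < t) : 0 < radialGap t := by
  unfold radialGap
  split_ifs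
  · positivity
  · linarith

/-- The constant 4a(t − a) is maximal at the vertex a = t/2, unless the constraint a ≤ 1 forces a =
1. -/
theorem exists_radialGap_eq {t : ℝ} (ht : 0 < t) :
    ∃ a, 0 ≤ a ∧ a ≤ 1 ∧ a ≤ t ∧ 4 * a * (t - a) = radialGap t := by
  rcases le_or_gt t 2 with h | h
  · exact ⟨t / 2, by linarith, by linarith, by linarith, by rw [radialGap_of_le h]; ring⟩
  · exact ⟨1, zero_le_one, le_rfl, by linarith, by rw [radialGap_of_lt h]; ring⟩

/-- The moments of the radial weight blow up at the integrability threshold. -/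
theorem le_integral_radialDensity (hn : 1 ≤ n) {δ : ℝ} (hδ : 0 < δ) :
    2 ^ (-((n : ℝ) / 2 + δ)) / (2 * δ) ≤ ∫ r in Ioi 0, radialDensity n ((n : ℝ) / 2 + δ) r := by
  have hi := integrableOn_radialDensity hn (β := (n : ℝ) / 2 + δ) (by linarith)
  have h1 : ∫ r in Ioi (1 : ℝ), (2 : ℝ) ^ (-((n : ℝ) / 2 + δ)) * r ^ (-1 - 2 * δ) =
      2 ^ (-((n : ℝ) / 2 + δ)) / (2 * δ) := by
    rw [integral_const_mul, integral_Ioi_rpow_of_lt (by linarith) one_pos, Real.one_rpow,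
      show -1 - 2 * δ + 1 = -(2 * δ) by ring, neg_div_neg_eq, mul_one_div]
  have hsub : Ioi (1 : ℝ) ⊆ Ioi 0 := Ioi_subset_Ioi zero_le_one
  rw [← h1]
  refine (setIntegral_mono_on ?_ (hi.mono_set hsub) measurableSet_Ioi fun r hr => ?_).trans
    (setIntegral_mono_set hi ?_ hsub.eventuallyLE)
  · exact (integrableOn_Ioi_rpow_of_lt (by linarith) one_pos).const_mul _
  · have hr1 : (1 : ℝ) < r := hr
    have hr0 : 0 < r := by linarith
    have hv : (2 * r ^ 2) ^ (-((n : ℝ) / 2 + δ)) ≤ (1 + r ^ 2) ^ (-((n : ℝ) / 2 + δ)) :=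
      Real.rpow_le_rpow_of_nonpos (by positivity) (by nlinarith)
        (by have : (0 : ℝ) ≤ n := n.cast_nonneg
            linarith)
    have e : (2 : ℝ) ^ (-((n : ℝ) / 2 + δ)) * r ^ (-1 - 2 * δ) =
        r ^ (n - 1) * (2 * r ^ 2) ^ (-((n : ℝ) / 2 + δ)) := by
      rw [Real.mul_rpow zero_le_two (by positivity), ← Real.rpow_natCast r 2,
        ← Real.rpow_mul hr0.le, ← Real.rpow_natCast r (n - 1), mul_left_comm, ← Real.rpow_add hr0]
      congr 2
      push_cast [Nat.cast_sub hn]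
      ring
    rw [e]
    exact mul_le_mul_of_nonneg_left hv (by positivity)
  · filter_upwards [ae_restrict_mem measurableSet_Ioi] with r hr using (radialDensity_pos hr).le

variable {α : Type*} [MeasurableSpace α] {μ : Measure α} {q : α → ℝ}

theorem norm_sq_pow (hn : 1 ≤ n) (hβ : (n : ℝ) / 2 < β)
    (hq : MeasurePreserving q μ (radialMeasure n β)) {a : ℝ} {u : Lp ℝ 2 μ}
    (hu : u =ᵐ[μ] fun x => (1 + q x ^ 2) ^ a) :
    ‖u‖ ^ 2 = (∫ r in Ioi 0, radialDensity n (β - 2 * a) r) / ∫ r in Ioi 0, radialDensity n β r := by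
  have hm : Measurable fun r : ℝ => ((1 + r ^ 2) ^ a) ^ 2 := by fun_prop
  have h := integral_map (μ := μ) hq.aemeasurable (f := fun r : ℝ => ((1 + r ^ 2) ^ a) ^ 2)
    hm.aestronglyMeasurable
  rw [norm_sq_eq_integral hu, ← h, hq.map_eq, integral_radialMeasure hn hβ]
  congr 1
  refine setIntegral_congr_fun measurableSet_Ioi fun r _ => ?_
  have hv : 0 < 1 + r ^ 2 := by positivity
  simp only [radialDensity]
  rw [← Real.rpow_natCast, ← Real.rpow_mul hv.le, mul_left_comm, ← Real.rpow_add hv]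
  congr 2
  push_cast
  ring

/-- As the exponent a approaches the integrability threshold t/2 from below, the norm of (1 + q²)^a
tends to infinity while the lower-order term of its image stays bounded. -/
theorem exists_approx_of_le [IsProbabilityMeasure μ] (hn : 1 ≤ n) (hβ : (n : ℝ) / 2 < β)
    (hβ2 : β - n / 2 ≤ 2) (hq : MeasurePreserving q μ (radialMeasure n β))
    {G : Submodule ℝ (Lp ℝ 2 μ × Lp ℝ 2 μ)}
    (hG : ∀ a, 2 * a < β - n / 2 → ∃ u w : Lp ℝ 2 μ, u =ᵐ[μ] (fun x => (1 + q x ^ 2) ^ a) ∧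
      w =ᵐ[μ] (fun x => powImage n β a (q x ^ 2)) ∧ (u, w) ∈ G) {ε : ℝ} (hε : 0 < ε) :
    ∃ u w : Lp ℝ 2 μ, (u, w) ∈ G ∧ ‖w - (β - n / 2) ^ 2 • u‖ < ε * ‖u‖ := by
  set t := β - n / 2 with ht
  have hn0 : (0 : ℝ) ≤ n := n.cast_nonneg
  have ht0 : 0 < t := by linarith
  have hβ0 : 0 < β := by linarith
  set Z := ∫ r in Ioi 0, radialDensity n β r with hZ
  have hZ0 : 0 < Z := integral_radialDensity_pos hn hβ
  -- Chosen so that δ < d makes β² smaller than (ε/2)‖u‖, given the lower bound ‖u‖² ≥ 2^{−β} /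
  -- (2δZ).
  set d : ℝ := 2 ^ (-β) * ε ^ 2 / (8 * Z * β ^ 4) with hd
  have hd0 : 0 < d := by positivity
  obtain ⟨δ, hδ0, hδ⟩ : ∃ δ, 0 < δ ∧ δ < min (min t 1) (min (ε / 2) d) :=
    exists_between (by positivity)
  rw [lt_min_iff, lt_min_iff, lt_min_iff] at hδ
  obtain ⟨⟨hδt, hδ1⟩, hδε, hδd⟩ := hδ
  obtain ⟨a, ha⟩ : ∃ a, a = (t - δ) / 2 := ⟨_, rfl⟩
  obtain ⟨u, w, hu, hw, huw⟩ := hG a (by rw [ha]; linarith)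
  obtain ⟨z, -, hz, -, -⟩ := hG (a - 1) (by rw [ha]; linarith)
  refine ⟨u, w, huw, ?_⟩
  -- With a = (t − δ)/2 one has 4a(t − a) = t² − δ².
  have hdec : w - t ^ 2 • u = -(δ ^ 2) • u - (4 * a * (β - a)) • z := by
    refine Lp.ext ?_
    filter_upwards [hu, hw, hz, Lp.coeFn_sub w (t ^ 2 • u), Lp.coeFn_smul (t ^ 2) u,
      Lp.coeFn_sub (-(δ ^ 2) • u) ((4 * a * (β - a)) • z), Lp.coeFn_smul (-(δ ^ 2)) u,
      Lp.coeFn_smul (4 * a * (β - a)) z] with x h1 h2 h3 h4 h5 h6 h7 h8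
    rw [h4, h6, Pi.sub_apply, Pi.sub_apply, h5, h7, h8]
    simp only [Pi.smul_apply, smul_eq_mul, h1, h2, h3, powImage]
    rw [← ht, show δ = t - 2 * a by rw [ha]; ring]
    ring
  -- Since t ≤ 2, the exponent a − 1 is negative and z is bounded by 1.
  have hz1 : ‖z‖ ≤ 1 := by
    rw [← sq_le_one_iff₀ (norm_nonneg _), norm_sq_eq_integral hz]
    have hb : ∀ x, ((1 + q x ^ 2) ^ (a - 1)) ^ 2 ≤ (1 : ℝ) := fun x => by
      refine pow_le_one₀ (by positivity) (Real.rpow_le_one_of_one_le_of_nonpos ?_ ?_)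
      · nlinarith [sq_nonneg (q x)]
      · rw [ha]; linarith
    calc ∫ x, ((1 + q x ^ 2) ^ (a - 1)) ^ 2 ∂μ ≤ ∫ _, (1 : ℝ) ∂μ :=
          integral_mono_of_nonneg (Eventually.of_forall fun x => by positivity)
            (integrable_const _) (Eventually.of_forall hb)
      _ = 1 := by simp
  have hc : |4 * a * (β - a)| ≤ β ^ 2 := by
    rw [abs_of_nonneg (mul_nonneg (by rw [ha]; linarith) (by rw [ha]; linarith))]
    nlinarith [sq_nonneg (β - 2 * a)]
  have hbound : ‖w - t ^ 2 • u‖ ≤ δ ^ 2 * ‖u‖ + β ^ 2 := by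
    rw [hdec]
    refine (norm_sub_le _ _).trans (add_le_add ?_ ?_)
    · rw [norm_smul, norm_neg, Real.norm_of_nonneg (sq_nonneg δ)]
    · rw [norm_smul, Real.norm_eq_abs]
      nlinarith [abs_nonneg (4 * a * (β - a)), norm_nonneg z]
  have hlow : 2 ^ (-β) / (2 * δ * Z) ≤ ‖u‖ ^ 2 := by
    rw [norm_sq_pow hn hβ hq hu, ← hZ, show β - 2 * a = (n : ℝ) / 2 + δ by rw [ha, ht]; ring,
      ← div_div]
    refine div_le_div_of_nonneg_right (le_trans ?_ (le_integral_radialDensity hn hδ0)) hZ0.le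
    refine div_le_div_of_nonneg_right ?_ (by positivity)
    exact Real.rpow_le_rpow_of_exponent_le one_le_two (by linarith)
  have hbig : (β ^ 2) ^ 2 < (ε / 2 * ‖u‖) ^ 2 := by
    rw [mul_pow]
    refine lt_of_lt_of_le ?_ (mul_le_mul_of_nonneg_left hlow (sq_nonneg _))
    rw [hd, lt_div_iff₀ (by positivity)] at hδd
    rw [← mul_div_assoc, lt_div_iff₀ (by positivity)]
    nlinarith
  have hlt := lt_of_pow_lt_pow_left₀ 2 (by positivity) hbig
  have hsq : δ ^ 2 ≤ ε / 2 := by nlinarith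
  nlinarith [norm_nonneg u]

theorem exists_eigenvector_of_lt [IsProbabilityMeasure μ] (hβ2 : 2 < β - n / 2)
    (hq : MeasurePreserving q μ (radialMeasure n β)) {G : Submodule ℝ (Lp ℝ 2 μ × Lp ℝ 2 μ)}
    (hG : ∀ a, 2 * a < β - n / 2 → ∃ u w : Lp ℝ 2 μ, u =ᵐ[μ] (fun x => (1 + q x ^ 2) ^ a) ∧
      w =ᵐ[μ] (fun x => powImage n β a (q x ^ 2)) ∧ (u, w) ∈ G) :
    ∃ u : Lp ℝ 2 μ, u ≠ 0 ∧ (u, (4 * (β - n / 2 - 1)) • u) ∈ G := by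
  obtain ⟨u1, w1, hu1, hw1, h1⟩ := hG 1 (by linarith)
  obtain ⟨u0, w0, hu0, hw0, h0⟩ := hG 0 (by linarith)
  set t := β - n / 2 with ht
  have ht1 : t - 1 ≠ 0 := by linarith
  -- The constant cancelling the term −4(β − 1) in the image of 1 + r².
  set c := (β - 1) / (t - 1) with hc
  have hval : u1 - c • u0 =ᵐ[μ] fun x => 1 + q x ^ 2 - c := by
    filter_upwards [hu1, hu0, Lp.coeFn_sub u1 (c • u0), Lp.coeFn_smul c u0] with x e1 e2 e3 e4
    rw [e3, Pi.sub_apply, e4, Pi.smul_apply, e1, e2, Real.rpow_one, Real.rpow_zero, smul_eq_mul,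
      mul_one]
  refine ⟨u1 - c • u0, fun hz => ?_, ?_⟩
  · rw [hz] at hval
    -- The eigenfunction vanishes at no more than two radii, so it is a nonzero class.
    have hne : ∀ᵐ r ∂(radialMeasure n β), 1 + r ^ 2 - c ≠ 0 := by
      refine ae_normalizedDensity_of_ae (ae_restrict_of_ae ?_)
      have hfin : {r : ℝ | ¬ (1 + r ^ 2 - c ≠ 0)} ⊆ {√(c - 1), -√(c - 1)} := fun r hr => by
        have hr : 1 + r ^ 2 - c = 0 := not_not.1 hr
        have h2 : r ^ 2 = √(c - 1) ^ 2 := by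
          rw [Real.sq_sqrt (by nlinarith [sq_nonneg r])]; linarith
        exact sq_eq_sq_iff_eq_or_eq_neg.1 h2
      exact measure_mono_null hfin ((toFinite _).measure_zero _)
    have hne' := hq.quasiMeasurePreserving.ae hne
    have hF : ∀ᵐ _ ∂μ, False := by
      filter_upwards [hval, hne', Lp.coeFn_zero ℝ 2 μ] with x e1 e2 e3
      exact e2 (by rw [← e1, e3]; rfl)
    exact (IsProbabilityMeasure.ne_zero μ) (by simpa using hF)
  · have hw : (4 * (t - 1)) • (u1 - c • u0) = w1 - c • w0 := by
      refine Lp.ext ?_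
      filter_upwards [hval, hw1, hw0, Lp.coeFn_sub w1 (c • w0), Lp.coeFn_smul c w0,
        Lp.coeFn_smul (4 * (t - 1)) (u1 - c • u0)] with x e1 e2 e3 e4 e5 e6
      rw [e6, Pi.smul_apply, e1, e4, Pi.sub_apply, e5, Pi.smul_apply, e2, e3]
      simp only [powImage, sub_self, Real.rpow_one, Real.rpow_zero, smul_eq_mul, ← ht]
      rw [hc]
      field_simp
      ring
    rw [hw]
    exact G.sub_mem h1 (G.smul_mem c h0)

theorem exists_approx_of_eigenvector {H : Type*} [NormedAddCommGroup H] [InnerProductSpace ℝ H]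
    {G : Submodule ℝ (H × H)} {l : ℝ} {u : H} (hu : u ≠ 0) (h : (u, l • u) ∈ G) {ε : ℝ}
    (hε : 0 < ε) : ∃ u w : H, (u, w) ∈ G ∧ ‖w - l • u‖ < ε * ‖u‖ :=
  ⟨u, l • u, h, by rw [sub_self, norm_zero]; exact mul_pos hε (norm_pos_iff.2 hu)⟩

theorem exists_approx_radialGap [IsProbabilityMeasure μ] (hn : 1 ≤ n) (hβ : (n : ℝ) / 2 < β)
    (hq : MeasurePreserving q μ (radialMeasure n β)) {G : Submodule ℝ (Lp ℝ 2 μ × Lp ℝ 2 μ)}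
    (hG : ∀ a, 2 * a < β - n / 2 → ∃ u w : Lp ℝ 2 μ, u =ᵐ[μ] (fun x => (1 + q x ^ 2) ^ a) ∧
      w =ᵐ[μ] (fun x => powImage n β a (q x ^ 2)) ∧ (u, w) ∈ G) {ε : ℝ} (hε : 0 < ε) :
    ∃ u w : Lp ℝ 2 μ, (u, w) ∈ G ∧ ‖w - radialGap (β - n / 2) • u‖ < ε * ‖u‖ := by
  rcases le_or_gt (β - n / 2) 2 with h | h
  · rw [radialGap_of_le h]
    exact exists_approx_of_le hn hβ h hq hG hε
  · rw [radialGap_of_lt h]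
    obtain ⟨u, hu, huG⟩ := exists_eigenvector_of_lt h hq hG
    exact exists_approx_of_eigenvector hu huG hε

theorem oneLp_mem [IsProbabilityMeasure μ] (hβ : (n : ℝ) / 2 < β)
    {G : Submodule ℝ (Lp ℝ 2 μ × Lp ℝ 2 μ)}
    (hG : ∀ a, 2 * a < β - n / 2 → ∃ u w : Lp ℝ 2 μ, u =ᵐ[μ] (fun x => (1 + q x ^ 2) ^ a) ∧
      w =ᵐ[μ] (fun x => powImage n β a (q x ^ 2)) ∧ (u, w) ∈ G) : (oneLp μ, 0) ∈ G := by
  obtain ⟨u, w, hu, hw, h⟩ := hG 0 (by linarith)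
  have e1 : u = oneLp μ := Lp.ext <| by
    filter_upwards [hu, oneLp_ae μ] with x h1 h2
    rw [h1, h2, Real.rpow_zero]
  have e2 : w = 0 := Lp.ext <| by
    filter_upwards [hw, Lp.coeFn_zero ℝ 2 μ] with x h1 h2
    rw [h1, h2]
    simp [powImage]
  rwa [e1, e2] at h

theorem exists_radial_gap (hn : 2 ≤ n) (hβ : (n : ℝ) / 2 < β) :
    ∃ A, IsSelfAdjointRealization (radialOp n β) A ∧ IsSpectralGap A (radialGap (β - n / 2)) := by
  have hn1 : 1 ≤ n := by omega
  have hβ1 : 1 ≤ β := by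
    have : (2 : ℝ) ≤ n := by exact_mod_cast hn
    linarith
  have ht : 0 < β - n / 2 := by linarith
  have hprob := isProbabilityMeasure_radialMeasure hn1 hβ
  obtain ⟨a, ha0, ha1, hat, hgap⟩ := exists_radialGap_eq ht
  obtain ⟨A, hA, hl⟩ := exists_radial_realization hn hβ hβ1 ha0 ha1 hat
  rw [hgap] at hl
  have hG : ∀ a, 2 * a < β - n / 2 → ∃ u w : Lp ℝ 2 (radialMeasure n β),
      u =ᵐ[radialMeasure n β] (fun x => (1 + id x ^ 2) ^ a) ∧
      w =ᵐ[radialMeasure n β] (fun x => powImage n β a (id x ^ 2)) ∧ (u, w) ∈ A.graph := by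
    intro a ha
    obtain ⟨u, w, hu, hw, h⟩ := radial_pow_mem_closure hn1 hβ ha
    exact ⟨u, w, hu, hw, mem_graph_of_mem_closure hA.extends_op hA.selfAdjoint h⟩
  exact ⟨A, hA, isSpectralGap_of_poincare hA.selfAdjoint norm_oneLp (oneLp_mem hβ hG)
    (radialGap_pos ht) hl fun ε hε =>
      exists_approx_radialGap hn1 hβ (MeasurePreserving.id _) hG hε⟩

/-- A coordinate function; the second-moment identity shows that its norm is positive. -/
theorem exists_linear_eigenvector (hn : 1 ≤ n) (hβ : (n : ℝ) / 2 + 3 / 2 < β) :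
    ∃ u : Lp ℝ 2 (cauchyMeasure n β), u ≠ 0 ∧
      (u, (2 * (β - 1)) • u) ∈ closure ((cauchyOp n β).graph : Set _) := by
  have hβ' : (n : ℝ) / 2 < β := by linarith
  set p : EuclideanSpace ℝ (Fin n) := EuclideanSpace.basisFun (Fin n) ℝ ⟨0, hn⟩ with hp
  have hp1 : ‖p‖ = 1 := (EuclideanSpace.basisFun (Fin n) ℝ).norm_eq_one _
  obtain ⟨u, w, hu, hw, h⟩ := cauchy_linear_mem_closure (β := β) hn (by linarith) p
  have e : w = (2 * (β - 1)) • u := Lp.ext <| by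
    filter_upwards [hu, hw, Lp.coeFn_smul (2 * (β - 1)) u] with x h1 h2 h3
    rw [h2, h3, Pi.smul_apply, h1, smul_eq_mul]
  refine ⟨u, fun hz => ?_, e ▸ h⟩
  have h1 := norm_sq_eq_integral hu
  rw [hz, norm_zero, integral_cauchyMeasure hβ'] at h1
  have h2 := integral_inner_sq_mul_cauchyDensity p hβ
  have h3 := integral_cauchyDensity_pos (n := n) (β := β - 1) (by linarith)
  have h4 := integral_cauchyDensity_pos hβ'
  have h5 := (div_eq_zero_iff.1 (show _ = (0 : ℝ) by rw [← h1]; norm_num)).resolve_right h4.ne'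
  rw [h5, hp1] at h2
  linarith

/-- The value is the minimum of the two sector constants: 4(t − 1) ≤ 2(β − 1) exactly when β ≤ n +
1, and for t ≤ 2 one has t² ≤ 2t ≤ 2(β − 1). The near-optimizer is radial in the first range and
linear in the second. -/
theorem exists_cauchy_gap (hn : 3 ≤ n) (hβ : (n : ℝ) / 2 < β) :
    ∃ A, IsSelfAdjointRealization (cauchyOp n β) A ∧
      IsSpectralGap A (if β ≤ n + 1 then radialGap (β - n / 2) else 2 * (β - 1)) := by
  have hn1 : 1 ≤ n := by omega
  have hn3 : (3 : ℝ) ≤ n := by exact_mod_cast hn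
  have hβ1 : 3 / 2 < β := by linarith
  have ht : 0 < β - n / 2 := by linarith
  have hprob := isProbabilityMeasure_cauchyMeasure hβ
  obtain ⟨a, ha0, ha1, hat, hgap⟩ := exists_radialGap_eq ht
  set l := if β ≤ n + 1 then radialGap (β - n / 2) else 2 * (β - 1) with hl
  have hl1 : l ≤ radialGap (β - n / 2) := by
    rw [hl]
    split_ifs with h
    · exact le_rfl
    · rw [radialGap_of_lt (by linarith)]; linarith
  have hl2 : l ≤ 2 * (β - 1) := by
    rw [hl]
    split_ifs with h
    · rcases le_or_gt (β - n / 2) 2 with h2 | h2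
      · rw [radialGap_of_le h2]; nlinarith
      · rw [radialGap_of_lt h2]; linarith
    · exact le_rfl
  have hl0 : 0 < l := by
    rw [hl]
    split_ifs
    · exact radialGap_pos ht
    · linarith
  obtain ⟨A, hA, hP⟩ := exists_cauchy_realization hβ (l := l) fun h =>
    cauchy_poincare hn1 hβ hβ1 ha0 ha1 hat (hgap ▸ hl1) hl2 (contDiff_infty.1 h.2.1 1) h.2.2
  have hG : ∀ a, 2 * a < β - n / 2 → ∃ u w : Lp ℝ 2 (cauchyMeasure n β),
      u =ᵐ[cauchyMeasure n β] (fun x => (1 + ‖x‖ ^ 2) ^ a) ∧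
      w =ᵐ[cauchyMeasure n β] (fun x => powImage n β a (‖x‖ ^ 2)) ∧ (u, w) ∈ A.graph := by
    intro a ha
    obtain ⟨u, w, hu, hw, h⟩ := cauchy_pow_mem_closure hn1 hβ ha
    exact ⟨u, w, hu, hw, mem_graph_of_mem_closure hA.extends_op hA.selfAdjoint h⟩
  refine ⟨A, hA, isSpectralGap_of_poincare hA.selfAdjoint norm_oneLp (oneLp_mem hβ hG) hl0 hP
    fun ε hε => ?_⟩
  rcases le_or_gt β (n + 1) with h | h
  · rw [hl, if_pos h]
    exact exists_approx_radialGap hn1 hβ (measurePreserving_norm hn1 hβ) hG hε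
  · rw [hl, if_neg h.not_ge]
    obtain ⟨u, hu, huG⟩ := exists_linear_eigenvector hn1 (β := β) (by linarith)
    exact exists_approx_of_eigenvector hu
      (mem_graph_of_mem_closure hA.extends_op hA.selfAdjoint huG) hε

end SpectralGap

end CauchyGap

end

/-- The witnesses are the exact gaps. In the third regime the two gaps even coincide, and in the
fourth the gap of the full operator is 2(β − 1); the stated bounds are weaker. -/
theorem mainTheorem6 (n : ℕ) (hn : 3 ≤ n) (β : ℝ) (hβ : (n : ℝ) / 2 < β) :
    ∃ (Aμ : Lp ℝ 2 (CauchyGap.cauchyMeasure n β) →ₗ.[ℝ] Lp ℝ 2 (CauchyGap.cauchyMeasure n β))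
      (Aν : Lp ℝ 2 (CauchyGap.radialMeasure n β) →ₗ.[ℝ] Lp ℝ 2 (CauchyGap.radialMeasure n β))
      (lμ lν : ℝ),
      CauchyGap.IsSelfAdjointRealization (CauchyGap.cauchyOp n β) Aμ ∧
      CauchyGap.IsSelfAdjointRealization (CauchyGap.radialOp n β) Aν ∧
      CauchyGap.IsSpectralGap Aμ lμ ∧
      CauchyGap.IsSpectralGap Aν lν ∧
      (β ≤ (n : ℝ) / 2 + 2 →
        lμ = lν ∧ lν = (β - (n : ℝ) / 2) ^ 2) ∧
      ((n : ℝ) / 2 + 2 < β → β ≤ (n : ℝ) * ((n : ℝ) + 2) / ((n : ℝ) + 1) →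
        lμ = lν ∧ lν = 4 * (β - (n : ℝ) / 2 - 1)) ∧
      ((n : ℝ) * ((n : ℝ) + 2) / ((n : ℝ) + 1) < β → β ≤ (n : ℝ) + 1 →
        2 * β * ((n : ℝ) - 1) / (n : ℝ) ≤ lμ ∧ lμ ≤ lν ∧
          lν = 4 * (β - (n : ℝ) / 2 - 1)) ∧
      ((n : ℝ) + 1 < β →
        2 * β * ((n : ℝ) - 1) / (n : ℝ) ≤ lμ ∧ lμ ≤ 2 * (β - 1) ∧ 2 * (β - 1) < lν ∧
          lν = 4 * (β - (n : ℝ) / 2 - 1)) := by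
  have hn3 : (3 : ℝ) ≤ n := by exact_mod_cast hn
  obtain ⟨Aμ, hAμ, hgμ⟩ := CauchyGap.exists_cauchy_gap hn hβ
  obtain ⟨Aν, hAν, hgν⟩ := CauchyGap.exists_radial_gap (by omega : 2 ≤ n) hβ
  refine ⟨Aμ, Aν, _, _, hAμ, hAν, hgμ, hgν, fun h => ?_, fun h1 h2 => ?_, fun h1 h2 => ?_,
    fun h => ?_⟩
  · rw [if_pos (by linarith)]
    exact ⟨rfl, CauchyGap.radialGap_of_le (by linarith)⟩
  · rw [le_div_iff₀ (by positivity)] at h2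
    -- n(n + 2)/(n + 1) is below n + 1, since n(n + 2) = (n + 1)² − 1.
    rw [if_pos (by nlinarith)]
    exact ⟨rfl, CauchyGap.radialGap_of_lt (by linarith)⟩
  · rw [div_lt_iff₀ (by positivity)] at h1
    -- n(n + 2)/(n + 1) ≥ n/2 + 2 amounts to n² − n − 4 ≥ 0, true for n ≥ 3.
    have h3 : 2 < β - n / 2 := by nlinarith
    rw [if_pos h2, CauchyGap.radialGap_of_lt h3]
    refine ⟨?_, le_rfl, rfl⟩
    -- 2β(n − 1)/n ≤ 4(β − n/2 − 1) is equivalent to β ≥ n(n + 2)/(n + 1): the threshold separating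
    -- the second and third regimes.
    rw [div_le_iff₀ (by positivity)]
    nlinarith
  · rw [if_neg h.not_ge, CauchyGap.radialGap_of_lt (by linarith)]
    refine ⟨?_, le_rfl, by linarith, rfl⟩
    -- 2β(n − 1)/n ≤ 2(β − 1) is equivalent to β ≥ n.
    rw [div_le_iff₀ (by positivity)]
    nlinarith
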